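/- **Setting.** Let $\epsilon_i$, $i\in\mathbb Z$, be iid real random variables with an independent iid copy $\epsilon_i^*$, write $\boldsymbol\epsilon_t=(\epsilon_t,\epsilon_{t-1},\ldots)\in\mathbb R^\infty$, and let $\tilde{\boldsymbol\epsilon}_{t,j}$ be $\boldsymbol\epsilon_t$ with the single entry $\epsilon_{t-j}$ replaced by $\epsilon^*_{t-j}$. Let $G_n,G:\mathbb R\times\mathbb R^\infty\to\mathbb R^d$ be measurable, $X_{t,n}=G_n(t/n,\boldsymbol\epsilon_t)$ for $t=1,\ldots,n$, $\mu^n_u=\mathbb E\,G_n(u,\boldsymbol\epsilon_0)$ and $\mu_u=\mathbb E\,G(u,\boldsymbol\epsilon_0)$. Write $\|Z\|_{L_q}=(\mathbb E\|Z\|^q)^{1/q}$, $a_n\ll b_n$ for $a_n/b_n\to0$, and $$\|G_n\|_{p\text{-var}}=\sup_{0=u_0<\cdots<u_m=1}\Big(\sum_{i=1}^m\|G_n(u_i,\boldsymbol\epsilon_0)-G_n(u_{i-1},\boldsymbol\epsilon_0)\|_{L_q}^p\Big)^{1/p}.$$ Assume that for some $q>4$, $p\in[1,4)$, $C_G<\infty$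 and $\rho\in(0,1)$: * (A.1) $\sup_{u\in[0,1]}\|G_n(u,\boldsymbol\epsilon_0)-G(u,\boldsymbol\epsilon_0)\|_{L_q}\to0$; * (A.2) $\sup_n\sup_{u\in[0,1]}\|G_n(u,\boldsymbol\epsilon_0)\|_{L_q}+\sup_n\|G_n\|_{p\text{-var}}\le C_G$; * (A.3) $\|G_n(u,\boldsymbol\epsilon_t)-G_n(u,\tilde{\boldsymbol\epsilon}_{t,j})\|_{L_q}\le C_G\rho^j$ for all $n\ge1$, $j\ge0$, $t\in\mathbb Z$, $u\in[0,1]$. Let $f:\mathbb R^d\to\mathbb R$, and for some $\delta\in(0,\infty]$ let $\mathcal M^\delta$ be the open $\delta$-neighbourhood of the convex hull of $\{\mu_u:u\in[0,1]\}$. * (A.4) $f$ is twice differentiable on $\mathcal M^\delta$ and $|f|+\|Df\|+\|D^2f\|\le C_f<\infty$ there. Let $\tau_n\ge1$, $L_n$, $b_n$ be integer sequences with $\tau_n\ll n$; $\log(n)^{1+a}\ll L_n$ for some $a\in(0,1)$; $L_n\ll n^{1/p-1/4}$ and $L_n\ll n^{1/(2p)}$; $b_n\to\infty$, $b_n\ll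 n^{2/(3\max(p,2))}$ and $b_n\ll n^{(q-4)/(2q+4)}$. Let the pilot estimators $\hat\mu_{t,n}\in\mathbb R^d$, $\tau_n\le t\le n$, be measurable with respect to $\boldsymbol\epsilon_t$ and satisfy * (A.5) $\sum_{t=\tau_n}^n\|\hat\mu_{t,n}-\mu^n_{t/n}\|^2=o_P(\sqrt n)$; * (A.6) $P(\hat\mu_{t,n}\in\mathcal M^\delta\text{ for all }t=\tau_n,\ldots,n)\to1$. Let $Y_t\sim\mathcal N(0,1)$ be iid and independent of $(\epsilon_i)_{i\in\mathbb Z}$, and define, for $u\in[0,1]$, $$\widehat M_n(u)=\frac1{\sqrt n}\sum_{t=\tau_n+L_n}^{\lfloor nu\rfloor-b_n}Y_t\Big[\frac1{\sqrt{b_n}}\sum_{i=1}^{b_n}Df(\hat\mu_{t-L_n,n})\,(X_{t+i,n}-\hat\mu_{t-L_n,n})\Big].$$ **Theorem.** The series $\Sigma(v)=\sum_{h\in\mathbb Z}\mathrm{Cov}\big(G(v,\boldsymbol\epsilon_0),G(v,\boldsymbol\epsilon_h)\big)\in\mathbb R^{d\times d}$ converges absolutely for every $v\in[0,1]$, the function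 $v\mapsto Df(\mu_v)\Sigma(v)Df(\mu_v)^T$ is nonnegative and integrable on $[0,1]$, and the conditional distribution of $\widehat M_n$ given $\mathbb X_n=(X_{1,n},\ldots,X_{n,n})$ converges weakly in the Skorokhod space $D[0,1]$, in probability, to the law of $$M(u)=B\Big(\int_0^uDf(\mu_v)\,\Sigma(v)\,Df(\mu_v)^T\,dv\Big),\qquad u\in[0,1],$$ where $B$ is a standard Brownian motion. That is, for every neighbourhood $U$ of $\mathcal L(M)$ in the topology of weak convergence of probability measures on $D[0,1]$ (equivalently, for every ball around $\mathcal L(M)$ in any metric of weak convergence), $P\big(\mathcal L(\widehat M_n\mid\mathbb X_n)\notin U\big)\to0$. -/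

import Mathlib

open MeasureTheory ProbabilityTheory Filter Topology Asymptotics
open scoped NNReal ENNReal unitInterval Matrix

noncomputable section

namespace LocStat

/-! ### The Skorokhod space `D[0,1]` -/

/-- `x : [0,1] → ℝ` is càdlàg: right-continuous with left limits. -/
def IsCadlag (x : I → ℝ) : Prop :=
  ∀ t : I, ContinuousWithinAt x (Set.Ici t) t ∧ ∃ l : ℝ, Tendsto x (𝓝[<] t) (𝓝 l)

/-- The space `D[0,1]` of real càdlàg functions on `[0,1]`. -/
structure SkorokhodSpace where
  /-- the underlying function -/
  toFun : I → ℝ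
  /-- the function is càdlàg -/
  cadlag : IsCadlag toFun

namespace SkorokhodSpace

instance : CoeFun SkorokhodSpace (fun _ => I → ℝ) := ⟨toFun⟩

/-- The Skorokhod (J1) distance: the infimum, over the increasing bijections `r` of `[0,1]`
(which are automatically homeomorphisms), of `max (sup_t |r t - t|) (sup_t |x t - y (r t)|)`. -/
instance : PseudoEMetricSpace SkorokhodSpace where
  edist x y := ⨅ r : I ≃o I, max (⨆ t, edist (r t) t) (⨆ t, edist (x t) (y (r t)))
  edist_self x := by
    refine le_antisymm (iInf_le_of_le (OrderIso.refl I) ?_) bot_le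
    simp
  edist_comm x y := by
    have key : ∀ x y : SkorokhodSpace,
        (⨅ r : I ≃o I, max (⨆ t, edist (r t) t) (⨆ t, edist (x t) (y (r t)))) ≤
          ⨅ r : I ≃o I, max (⨆ t, edist (r t) t) (⨆ t, edist (y t) (x (r t))) := by
      intro x y
      refine le_iInf fun r => iInf_le_of_le r.symm (max_le_max ?_ ?_)
      · refine iSup_le fun t => le_iSup_of_le (r.symm t) ?_
        simp [edist_comm]
      · refine iSup_le fun t => le_iSup_of_le (r.symm t) ?_
        simp [edist_comm]
    exact le_antisymm (key x y) (key y x)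
  edist_triangle x y z := by
    refine ENNReal.le_iInf_add_iInf fun r s => iInf_le_of_le (r.trans s) (max_le ?_ ?_)
    · refine iSup_le fun t => ?_
      calc edist ((r.trans s) t) t ≤ edist (s (r t)) (r t) + edist (r t) t := edist_triangle _ _ _
        _ = edist (r t) t + edist (s (r t)) (r t) := add_comm _ _
        _ ≤ _ := add_le_add
          (le_max_of_le_left (le_iSup (fun t => edist (r t) t) t))
          (le_max_of_le_left (le_iSup (fun t => edist (s t) t) (r t)))
    · refine iSup_le fun t => ?_
      calc edist (x t) (z ((r.trans s) t)) ≤ edist (x t) (y (r t)) + edist (y (r t)) (z (s (r t))) :=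
            edist_triangle _ _ _
        _ ≤ _ := add_le_add
          (le_max_of_le_right (le_iSup (fun t => edist (x t) (y (r t))) t))
          (le_max_of_le_right (le_iSup (fun t => edist (y t) (z (s t))) (r t)))

/-- The Borel `σ`-algebra of the Skorokhod topology. -/
instance : MeasurableSpace SkorokhodSpace := borel SkorokhodSpace

instance : BorelSpace SkorokhodSpace := ⟨rfl⟩

/-- The step function `u ↦ h ⌊n u⌋` as an element of `D[0,1]`. -/
def ofFloor (n : ℕ) (h : ℕ → ℝ) : SkorokhodSpace where
  toFun u := h ⌊(n : ℝ) * (u : ℝ)⌋₊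
  cadlag := by
    have hf : ∀ u : I, h ⌊(n : ℝ) * (u : ℝ)⌋₊ =
        (fun k : ℤ => h k.toNat) ⌊(n : ℝ) * (u : ℝ)⌋ := fun u => rfl
    have hcont : Continuous fun u : I => (n : ℝ) * (u : ℝ) := by fun_prop
    intro t
    constructor
    · have h1 : Tendsto (fun u : I => (n : ℝ) * (u : ℝ)) (𝓝[≥] t) (𝓝[≥] ((n : ℝ) * (t : ℝ))) := by
        refine tendsto_nhdsWithin_iff.2 ⟨hcont.continuousAt.mono_left nhdsWithin_le_nhds, ?_⟩
        filter_upwards [self_mem_nhdsWithin] with u hu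
        exact mul_le_mul_of_nonneg_left (show (t : ℝ) ≤ (u : ℝ) from hu) (Nat.cast_nonneg n)
      have h2 := (tendsto_floor_right_pure_floor ((n : ℝ) * (t : ℝ))).comp h1
      have h3 := h2.eventually (eventually_pure.2 rfl :
        ∀ᶠ k in pure ⌊(n : ℝ) * (t : ℝ)⌋, k = ⌊(n : ℝ) * (t : ℝ)⌋)
      refine (tendsto_const_nhds (x := h ⌊(n : ℝ) * (t : ℝ)⌋₊)).congr' ?_
      filter_upwards [h3] with u hu
      rw [hf u, hf t]
      exact congrArg (fun k : ℤ => h k.toNat) hu.symm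
    · rcases Nat.eq_zero_or_pos n with rfl | hn
      · exact ⟨h 0, by simpa using tendsto_const_nhds⟩
      · have h1 : Tendsto (fun u : I => (n : ℝ) * (u : ℝ)) (𝓝[<] t)
            (𝓝[<] ((n : ℝ) * (t : ℝ))) := by
          refine tendsto_nhdsWithin_iff.2 ⟨hcont.continuousAt.mono_left nhdsWithin_le_nhds, ?_⟩
          filter_upwards [self_mem_nhdsWithin] with u hu
          exact mul_lt_mul_of_pos_left (show (u : ℝ) < (t : ℝ) from hu) (Nat.cast_pos.2 hn)
        have h2 := (tendsto_floor_left_pure_ceil_sub_one ((n : ℝ) * (t : ℝ))).comp h1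
        have h3 := h2.eventually (eventually_pure.2 rfl :
          ∀ᶠ k in pure (⌈(n : ℝ) * (t : ℝ)⌉ - 1), k = ⌈(n : ℝ) * (t : ℝ)⌉ - 1)
        refine ⟨h (⌈(n : ℝ) * (t : ℝ)⌉ - 1).toNat, tendsto_const_nhds.congr' ?_⟩
        filter_upwards [h3] with u hu
        rw [hf u]
        exact congrArg (fun k : ℤ => h k.toNat) hu.symm

end SkorokhodSpace

/-! ### Weak convergence in probability of random probability measures -/

/-- The random probability measures `Λ n` converge weakly to the fixed probability measure `ν`, in
probability: for every neighbourhood `U` of `ν` in the topology of weak convergence, the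
probability of `Λ n ∉ U` tends to `0`. For any metric `d` of weak convergence this says
that `d (Λ n) ν → 0` in probability. -/
def TendstoWeaklyInProbability {Ω S : Type*} [MeasurableSpace Ω] (P : Measure Ω)
    [MeasurableSpace S] [TopologicalSpace S] [OpensMeasurableSpace S]
    (Λ : ℕ → Ω → ProbabilityMeasure S) (ν : ProbabilityMeasure S) : Prop :=
  ∀ U ∈ 𝓝 ν, Tendsto (fun n => P {ω | Λ n ω ∉ U}) atTop (𝓝 0)

/-- The value of a Markov kernel at a point, as a probability measure. -/
def kernelLaw {A S : Type*} [MeasurableSpace A] [MeasurableSpace S] (κ : Kernel A S)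
    [IsMarkovKernel κ] (a : A) : ProbabilityMeasure S :=
  ⟨κ a, inferInstance⟩

/-! ### The locally stationary model -/

section Model

variable {Ω : Type*}

/-- The past `(ε_t, ε_{t-1}, …)` of the innovations. -/
def past (ε : ℤ → Ω → ℝ) (t : ℤ) (ω : Ω) : ℕ → ℝ :=
  fun i => ε (t - i) ω

/-- The past `(ε_t, …, ε_{t-j+1}, ε'_{t-j}, ε_{t-j-1}, …)` with the single innovation at time
`t - j` replaced by its copy. -/
def pastReplaced (ε ε' : ℤ → Ω → ℝ) (t : ℤ) (j : ℕ) (ω : Ω) : ℕ → ℝ :=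
  fun i => if i = j then ε' (t - i) ω else ε (t - i) ω

variable {d : ℕ}

/-- The triangular array `X_{t,n} = G_n(t/n, (ε_t, ε_{t-1}, …))`. -/
def obs (G : ℕ → ℝ → (ℕ → ℝ) → EuclideanSpace ℝ (Fin d)) (ε : ℤ → Ω → ℝ) (n t : ℕ) (ω : Ω) :
    EuclideanSpace ℝ (Fin d) :=
  G n ((t : ℝ) / (n : ℝ)) (past ε t ω)

/-- The data `(X_{1,n}, …, X_{n,n})`. -/
def data (G : ℕ → ℝ → (ℕ → ℝ) → EuclideanSpace ℝ (Fin d)) (ε : ℤ → Ω → ℝ) (n : ℕ) (ω : Ω) :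
    Fin n → EuclideanSpace ℝ (Fin d) :=
  fun k => obs G ε n (k + 1) ω

/-- `sup (∑ N(u_{i-1}, u_i)^p)^{1/p}` over all partitions `0 = u_0 < u_1 < … < u_m = 1`, for a
family `N` of distances. -/
def pVar (p : ℝ) (N : ℝ → ℝ → ℝ≥0∞) : ℝ≥0∞ :=
  ⨆ (m : ℕ) (u : Fin (m + 1) → ℝ) (_ : StrictMono u ∧ u 0 = 0 ∧ u (Fin.last m) = 1),
    (∑ i : Fin m, N (u i.castSucc) (u i.succ) ^ p) ^ (1 / p)

variable [MeasurableSpace Ω]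

/-- The `p`-variation on `[0,1]` of `u ↦ H(u, (ε_0, ε_{-1}, …)) ∈ L_q`. -/
def kernelPVar (P : Measure Ω) (ε : ℤ → Ω → ℝ) (q p : ℝ)
    (H : ℝ → (ℕ → ℝ) → EuclideanSpace ℝ (Fin d)) : ℝ≥0∞ :=
  pVar p fun u v => eLpNorm (fun ω => H v (past ε 0 ω) - H u (past ε 0 ω)) (ENNReal.ofReal q) P

/-- The local mean `E H(u, (ε_0, ε_{-1}, …))`. -/
def localMean (P : Measure Ω) (ε : ℤ → Ω → ℝ)
    (H : ℝ → (ℕ → ℝ) → EuclideanSpace ℝ (Fin d)) (u : ℝ) : EuclideanSpace ℝ (Fin d) :=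
  ∫ ω, H u (past ε 0 ω) ∂P

/-- The `δ`-neighbourhood (`δ = ∞` allowed) of the convex hull of `{μ_u : u ∈ [0,1]}`. -/
def meanNhd (μ : ℝ → EuclideanSpace ℝ (Fin d)) (δ : ℝ≥0∞) : Set (EuclideanSpace ℝ (Fin d)) :=
  {x | ∃ y ∈ convexHull ℝ (μ '' Set.Icc 0 1), edist x y < δ}

/-- The `(i,j)` entry of `Cov (H(v, (ε_0, ε_{-1}, …)), H(v, (ε_h, ε_{h-1}, …)))`. -/
def autoCov (P : Measure Ω) (ε : ℤ → Ω → ℝ) (H : ℝ → (ℕ → ℝ) → EuclideanSpace ℝ (Fin d))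
    (v : ℝ) (i j : Fin d) (h : ℤ) : ℝ :=
  cov[fun ω => H v (past ε 0 ω) i, fun ω => H v (past ε h ω) j; P]

/-- The local long-run covariance matrix
`Σ(v) = ∑_{h ∈ ℤ} Cov (H(v, (ε_0, …)), H(v, (ε_h, …)))`. -/
def longRunCov (P : Measure Ω) (ε : ℤ → Ω → ℝ) (H : ℝ → (ℕ → ℝ) → EuclideanSpace ℝ (Fin d))
    (v : ℝ) : Matrix (Fin d) (Fin d) ℝ :=
  Matrix.of fun i j => ∑' h : ℤ, autoCov P ε H v i j h

/-- The row vector `Df(x)` of partial derivatives. -/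
def gradRow (f : EuclideanSpace ℝ (Fin d) → ℝ) (x : EuclideanSpace ℝ (Fin d)) : Fin d → ℝ :=
  fun i => fderiv ℝ f x (EuclideanSpace.single i 1)

/-- `Df(μ_v) Σ(v) Df(μ_v)ᵀ`. -/
def varDensity (P : Measure Ω) (ε : ℤ → Ω → ℝ) (H : ℝ → (ℕ → ℝ) → EuclideanSpace ℝ (Fin d))
    (f : EuclideanSpace ℝ (Fin d) → ℝ) (v : ℝ) : ℝ :=
  gradRow f (localMean P ε H v) ⬝ᵥ (longRunCov P ε H v *ᵥ gradRow f (localMean P ε H v))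

end Model

/-- The multiplier bootstrap process
`u ↦ n^{-1/2} ∑_{t=τ+L}^{⌊nu⌋-b} Y_t [b^{-1/2} ∑_{i=1}^b Df(m_{t-L}) (X_{t+i} - m_{t-L})]`, computed
from a path `X` of the observations, `m` of the pilot estimator, and `Y` of the multipliers.
For `τ ≥ 1` the sum is empty when `⌊nu⌋ < b`. -/
def bootstrapPath {d : ℕ} (f : EuclideanSpace ℝ (Fin d) → ℝ) (n τ L b : ℕ)
    (X m : ℕ → EuclideanSpace ℝ (Fin d)) (Y : ℕ → ℝ) : SkorokhodSpace :=
  SkorokhodSpace.ofFloor n fun k =>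
    1 / √(n : ℝ) * ∑ t ∈ Finset.Icc (τ + L) (k - b),
      Y t * (1 / √(b : ℝ) * ∑ i ∈ Finset.Icc 1 b,
        fderiv ℝ f (m (t - L)) (X (t + i) - m (t - L)))

end LocStat

end

open LocStat

noncomputable section

namespace LocStat

/-! ### Weak convergence in probability -/

/-! Given the innovations, the bootstrap process is a sum of independent Gaussians `c t * Y t` whose
coefficients are functions of the observations and of the pilot. Its conditional law is therefore
that of a Brownian motion run along the partial sums of `c t ^ 2` (`integral_multiplierPath`). If
these random clocks converge in probability, at each `u`, to the continuous function V(u) = ∫₀ᵘ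
Df(μ_v) Σ(v) Df(μ_v)ᵀ dv, monotonicity makes the convergence uniform, and continuity of the Brownian
path turns it into convergence of integrals of bounded continuous functionals; no separate tightness
argument is needed. The data alone need not determine the pilot, but conditioning on less cannot
increase the L₁ distance between a conditional expectation and a constant
(`integral_abs_integral_sub_le`), so conditioning on the coefficients suffices.

What remains is that the average of the squared blocks converges to V(u)
(`tendsto_measure_sum_sq_pilotBlock`). Three facts give this. Replacing the pilot by the local mean
is negligible in mean square: the error splits into a gradient error, the drift of the local mean
over L + b steps (small by finite `p`-variation), and the pilot error itself. The squared blocks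
centred at the local means obey a law of large numbers (`tendsto_measure_sum_sq_blockSum`), because
blocks at distance 2b are almost uncorrelated. Their expectations converge to the long-run variance
at every time v outside a countable set (`tendsto_blockVar`), and bounded convergence integrates
this over v.

All moment bounds come from projecting `g (past ε t)` on the last `m` innovations (`appr`):
successive projections differ by O(ρ^m) in L₄, and for fixed `m` the differences over a block are
martingale differences in reversed time. This yields the √b bound for block sums
(`lpBdd_sum_sub_integral`) and the exponential decay of covariances. -/

/-- Weak convergence in probability follows from convergence in probability of the integrals of
bounded continuous functions. -/
theorem tendstoWeaklyInProbability_of_integral {Ω S : Type*} [MeasurableSpace Ω] {P : Measure Ω}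
    [MeasurableSpace S] [TopologicalSpace S] [OpensMeasurableSpace S]
    {Λ : ℕ → Ω → ProbabilityMeasure S} {ν : ProbabilityMeasure S}
    (h : ∀ φ : BoundedContinuousFunction S ℝ, ∀ η > 0, Tendsto (fun n =>
      P {ω | η ≤ |∫ x, φ x ∂(Λ n ω : Measure S) - ∫ x, φ x ∂(ν : Measure S)|}) atTop (𝓝 0)) :
    TendstoWeaklyInProbability P Λ ν := by
  -- The sets U with P(Λ n ∉ U) → 0 form a filter, even for non-measurable events since only
  -- monotonicity and subadditivity of P are used. Weak convergence in probability is convergence of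
  -- the identity along this filter, so the characterisation of weak convergence by integrals
  -- applies to it directly.
  let l : Filter (ProbabilityMeasure S) :=
    { sets := {U | Tendsto (fun n => P {ω | Λ n ω ∉ U}) atTop (𝓝 0)}
      univ_sets := by simp
      sets_of_superset := by
        intro U V hU hUV
        exact tendsto_of_tendsto_of_tendsto_of_le_of_le tendsto_const_nhds hU (fun _ => bot_le)
          fun n => measure_mono fun ω hω hmem => hω (hUV hmem)
      inter_sets := by
        intro U V hU hV
        have hU' : Tendsto (fun n => P {ω | Λ n ω ∉ U}) atTop (𝓝 0) := hU
        have hV' : Tendsto (fun n => P {ω | Λ n ω ∉ V}) atTop (𝓝 0) := hV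
        have hadd := hU'.add hV'
        rw [add_zero] at hadd
        refine tendsto_of_tendsto_of_tendsto_of_le_of_le tendsto_const_nhds hadd
          (fun _ => bot_le) fun n => (measure_mono fun ω hω => ?_).trans (measure_union_le _ _)
        by_cases hc : Λ n ω ∈ U
        · exact Or.inr fun hc' => hω ⟨hc, hc'⟩
        · exact Or.inl hc }
  have hl : Tendsto id l (𝓝 ν) := by
    rw [ProbabilityMeasure.tendsto_iff_forall_integral_tendsto]
    intro φ
    rw [Metric.tendsto_nhds]
    intro η hη
    refine tendsto_of_tendsto_of_tendsto_of_le_of_le tendsto_const_nhds (h φ η hη)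
      (fun _ => bot_le) fun n => measure_mono fun ω hω => ?_
    simpa [Real.dist_eq] using hω
  exact fun U hU => hl hU

/-! ### Step functions and uniform convergence in the Skorokhod space -/

namespace SkorokhodSpace

theorem ext {x y : SkorokhodSpace} (h : ∀ t, x t = y t) : x = y := by
  cases x; cases y; congr; exact funext h

theorem edist_le_iSup (x y : SkorokhodSpace) : edist x y ≤ ⨆ t, edist (x t) (y t) := by
  refine iInf_le_of_le (OrderIso.refl I) (max_le ?_ ?_) <;> simp

theorem edist_le_of_forall {x y : SkorokhodSpace} {r : ℝ} (h : ∀ t, |x t - y t| ≤ r) :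
    edist x y ≤ ENNReal.ofReal r := by
  refine (edist_le_iSup x y).trans (iSup_le fun t => ?_)
  rw [edist_dist, Real.dist_eq]
  exact ENNReal.ofReal_le_ofReal (h t)

theorem tendsto_of_tendstoUniformly {x : ℕ → SkorokhodSpace} {y : SkorokhodSpace}
    (h : TendstoUniformly (fun n => (x n : I → ℝ)) y atTop) : Tendsto x atTop (𝓝 y) := by
  rw [EMetric.tendsto_nhds]
  intro r hr
  obtain ⟨s, hs0, hsr⟩ := ENNReal.lt_iff_exists_real_btwn.1 hr
  have hs : 0 < s := by simpa using hsr.1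
  filter_upwards [Metric.tendstoUniformly_iff.1 h s hs] with n hn
  refine (edist_le_of_forall (r := s) fun t => ?_).trans_lt hsr.2
  have := (hn t).le
  rwa [dist_comm, Real.dist_eq] at this

theorem floor_mul_le (n : ℕ) (u : I) : ⌊(n : ℝ) * (u : ℝ)⌋₊ ≤ n := by
  refine (Nat.floor_mono (mul_le_of_le_one_right (Nat.cast_nonneg n) u.2.2)).trans ?_
  simp

theorem ofFloor_congr {n : ℕ} {h h' : ℕ → ℝ} (hh : ∀ k ≤ n, h k = h' k) :
    ofFloor n h = ofFloor n h' :=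
  ext fun u => hh _ (floor_mul_le n u)

/-- The step function with values `h 0, …, h n`. -/
def ofVec (n : ℕ) (h : Fin (n + 1) → ℝ) : SkorokhodSpace :=
  ofFloor n fun k => h (Fin.ofNat (n + 1) k)

theorem ofFloor_eq_ofVec (n : ℕ) (h : ℕ → ℝ) :
    ofFloor n h = ofVec n fun k => h k := by
  refine ofFloor_congr fun k hk => ?_
  simp [Nat.mod_eq_of_lt (Nat.lt_succ_of_le hk)]

/-- The Skorokhod distance is at most the uniform one. This gives Borel measurability of random step
functions from that of finitely many real variables, without a description of the Borel sets of
D[0,1]. -/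
theorem lipschitzWith_ofVec (n : ℕ) : LipschitzWith 1 (ofVec n) := by
  intro h h'
  refine (edist_le_iSup _ _).trans (iSup_le fun t => ?_)
  rw [ENNReal.coe_one, one_mul]
  exact edist_le_pi_edist h h' (Fin.ofNat (n + 1) ⌊(n : ℝ) * (t : ℝ)⌋₊)

theorem measurable_ofVec (n : ℕ) : Measurable (ofVec n) :=
  (lipschitzWith_ofVec n).continuous.measurable

theorem aemeasurable_ofFloor {Ω : Type*} [MeasurableSpace Ω] {P : Measure Ω} {n : ℕ}
    {Z : ℕ → Ω → ℝ} (hZ : ∀ k ≤ n, AEMeasurable (Z k) P) :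
    AEMeasurable (fun ω => ofFloor n fun k => Z k ω) P := by
  simp_rw [ofFloor_eq_ofVec]
  exact (measurable_ofVec n).comp_aemeasurable
    (aemeasurable_pi_lambda _ fun k => hZ k (Nat.lt_succ_iff.1 k.2))

/-- A continuous function on `[0,1]` as an element of `D[0,1]`. -/
def ofContinuous (x : I → ℝ) (hx : Continuous x) : SkorokhodSpace where
  toFun := x
  cadlag t := ⟨hx.continuousWithinAt, x t, hx.continuousAt.mono_left nhdsWithin_le_nhds⟩

end SkorokhodSpace

open SkorokhodSpace

theorem abs_floor_div_sub_le {n : ℕ} (hn : 0 < n) {u : ℝ} (hu : 0 ≤ u) :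
    |(⌊(n : ℝ) * u⌋₊ : ℝ) / n - u| ≤ 1 / n := by
  have hn' : (0 : ℝ) < n := Nat.cast_pos.2 hn
  have h1 := Nat.floor_le (mul_nonneg hn'.le hu)
  have h2 := Nat.lt_floor_add_one ((n : ℝ) * u)
  rw [abs_le]
  constructor
  · rw [neg_le_sub_iff_le_add, ← add_div, le_div_iff₀ hn']; linarith
  · rw [sub_le_iff_le_add, div_le_iff₀ hn', add_mul, one_div_mul_cancel hn'.ne']; linarith

/-! ### Brownian motion run along a deterministic clock. -/

section TimeChange

variable {Ω' : Type*} {B : ℝ≥0 → Ω' → ℝ}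

open Classical in
/-- The path `u ↦ B (V u)` as an element of `D[0,1]` where `B` is continuous. -/
def timeChange (B : ℝ≥0 → Ω' → ℝ) (V : C(I, ℝ≥0)) (ω : Ω') : SkorokhodSpace :=
  if h : Continuous (B · ω) then ofContinuous (fun u => B (V u) ω) (h.comp V.continuous)
  -- A dummy value, taken only on the null set of discontinuous paths.
  else ofFloor 0 0

theorem timeChange_apply {V : C(I, ℝ≥0)} {ω : Ω'} (h : Continuous (B · ω)) (u : I) :
    timeChange B V ω u = B (V u) ω := by
  simp [timeChange, h, ofContinuous]

/-- If the step functions with values `v n k` converge uniformly to `V`, then a continuous path run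
along the step functions converges in `D[0,1]` to the path run along `V`. -/
theorem tendsto_ofFloor_timeChange {V : C(I, ℝ≥0)} {ω : Ω'} (h : Continuous (B · ω))
    {N : ℕ → ℕ} {v : ℕ → ℕ → ℝ≥0}
    (hv : TendstoUniformly (fun n (u : I) => v n ⌊(N n : ℝ) * (u : ℝ)⌋₊) V atTop) :
    Tendsto (fun n => ofFloor (N n) fun k => B (v n k) ω) atTop (𝓝 (timeChange B V ω)) := by
  apply tendsto_of_tendstoUniformly
  obtain ⟨c, hc⟩ := (isCompact_range V.continuous).isBounded.bddAbove
  have hunif := (isCompact_Icc (a := (0 : ℝ≥0)) (b := c + 1)).uniformContinuousOn_of_continuous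
    h.continuousOn
  rw [Metric.uniformContinuousOn_iff] at hunif
  rw [Metric.tendstoUniformly_iff] at hv ⊢
  intro η hη
  obtain ⟨δ, hδ, hB⟩ := hunif η hη
  -- The cap at 1 keeps the step values inside [0, c + 1], where the path is uniformly continuous.
  filter_upwards [hv (min δ 1) (by positivity)] with n hn u
  rw [timeChange_apply h]
  have hVu : V u ≤ c := hc ⟨u, rfl⟩
  refine hB _ ⟨zero_le, hVu.trans (by simp)⟩ _ ⟨zero_le, ?_⟩ ((hn u).trans_le (min_le_left _ _))
  have := (hn u).trans_le (min_le_right _ _)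
  rw [NNReal.dist_eq, abs_lt] at this
  have h2 : ((v n ⌊(N n : ℝ) * (u : ℝ)⌋₊ : ℝ≥0) : ℝ) ≤ c + 1 := by
    have : (V u : ℝ) ≤ c := hVu
    linarith
  exact_mod_cast h2

theorem tendstoUniformly_floor (V : C(I, ℝ≥0)) :
    TendstoUniformly (fun (n : ℕ) (u : I) =>
      V (Set.projIcc 0 1 zero_le_one ((⌊(n : ℝ) * (u : ℝ)⌋₊ : ℝ) / n))) V atTop := by
  have hunif := CompactSpace.uniformContinuous_of_continuous V.continuous
  rw [Metric.uniformContinuous_iff] at hunif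
  rw [Metric.tendstoUniformly_iff]
  intro η hη
  obtain ⟨δ, hδ, hV⟩ := hunif η hη
  have h0 : Tendsto (fun n : ℕ => (1 : ℝ) / n) atTop (𝓝 0) := tendsto_one_div_atTop_nhds_zero_nat
  filter_upwards [h0.eventually (gt_mem_nhds hδ), eventually_gt_atTop 0] with n hn hn0 u
  apply hV
  have hmem : (⌊(n : ℝ) * (u : ℝ)⌋₊ : ℝ) / n ∈ Set.Icc (0 : ℝ) 1 := by
    refine ⟨by positivity, div_le_one_of_le₀ ?_ (Nat.cast_nonneg n)⟩
    exact_mod_cast floor_mul_le n u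
  rw [Set.projIcc_of_mem zero_le_one hmem, Subtype.dist_eq, dist_comm, Real.dist_eq]
  exact (abs_floor_div_sub_le hn0 u.2.1).trans_lt hn

variable [MeasurableSpace Ω'] {P' : Measure Ω'}

/-- The path is the almost sure limit in D[0,1] of its discretisations on the grid k/n, which are
measurable step functions. -/
theorem aemeasurable_timeChange (hB : IsBrownianReal B P') (V : C(I, ℝ≥0)) :
    AEMeasurable (timeChange B V) P' := by
  refine aemeasurable_of_tendsto_metrizable_ae atTop
    (f := fun n ω => ofFloor n fun k => B (V (Set.projIcc 0 1 zero_le_one ((k : ℝ) / n))) ω)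
    (fun n => aemeasurable_ofFloor fun k _ => hB.aemeasurable _) ?_
  filter_upwards [hB.cont] with ω hω
  exact tendsto_ofFloor_timeChange hω (N := id) (tendstoUniformly_floor V)

/-- Continuity in the time change of the expectation of a functional of Brownian motion. -/
theorem exists_forall_abs_integral_sub_le (hB : IsBrownianReal B P') [IsProbabilityMeasure P']
    (V : C(I, ℝ≥0)) (φ : BoundedContinuousFunction SkorokhodSpace ℝ) {η : ℝ} (hη : 0 < η) :
    ∃ r > 0, ∀ (n : ℕ) (v : ℕ → ℝ≥0),
      (∀ u : I, |(v ⌊(n : ℝ) * (u : ℝ)⌋₊ : ℝ) - V u| ≤ r) →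
        |∫ ω, φ (ofFloor n fun k => B (v k) ω) ∂P' - ∫ ω, φ (timeChange B V ω) ∂P'| ≤ η := by
  -- Counterexamples for the radii 1/(m + 1) would have clocks converging uniformly to V; almost
  -- sure convergence of the paths and dominated convergence contradict this.
  by_contra! hcon
  have hpos : ∀ m : ℕ, (0 : ℝ) < 1 / (m + 1) := fun m => by positivity
  choose N v hv hφ using fun m : ℕ => hcon (1 / (m + 1)) (hpos m)
  have hlim : Tendsto (fun m => ∫ ω, φ (ofFloor (N m) fun k => B (v m k) ω) ∂P') atTop
      (𝓝 (∫ ω, φ (timeChange B V ω) ∂P')) := by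
    refine tendsto_integral_of_dominated_convergence (fun _ => ‖φ‖) (fun m => ?_)
      (integrable_const _) (fun m => ae_of_all _ fun ω => φ.norm_coe_le_norm _) ?_
    · exact (φ.continuous.measurable.comp_aemeasurable
        (aemeasurable_ofFloor fun k _ => hB.aemeasurable _)).aestronglyMeasurable
    · filter_upwards [hB.cont] with ω hω
      refine (φ.continuous.tendsto _).comp (tendsto_ofFloor_timeChange hω ?_)
      rw [Metric.tendstoUniformly_iff]
      intro s hs
      filter_upwards [tendsto_one_div_add_atTop_nhds_zero_nat.eventually (gt_mem_nhds hs)]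
        with m hm u
      rw [dist_comm, NNReal.dist_eq]
      exact (hv m u).trans_lt hm
  obtain ⟨m, hm⟩ := (Metric.tendsto_nhds.1 hlim η hη).exists
  exact absurd (hφ m) (not_lt.2 (by rw [Real.dist_eq] at hm; exact hm.le))

end TimeChange

open SkorokhodSpace

/-! ### Gaussian multiplier processes -/

/-- The step function with values `∑_{t < K k} c t * y t`, `k ≤ n`. -/
def multiplierPath (n : ℕ) (K : ℕ → ℕ) (c y : ℕ → ℝ) : SkorokhodSpace :=
  ofFloor n fun k => ∑ t ∈ Finset.range (K k), c t * y t

theorem measurable_multiplierPath (n : ℕ) (K : ℕ → ℕ) :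
    Measurable fun z : (ℕ → ℝ) × (ℕ → ℝ) => multiplierPath n K z.1 z.2 := by
  simp_rw [multiplierPath, ofFloor_eq_ofVec]
  exact (measurable_ofVec n).comp (by fun_prop)

section Gaussian

variable {Ω Ω' : Type*} [MeasurableSpace Ω] [MeasurableSpace Ω'] {P : Measure Ω} {P' : Measure Ω'}
  {Y : ℕ → Ω → ℝ} {B : ℝ≥0 → Ω' → ℝ}

/-- The partial sums of squares. -/
def sqSum (c : ℕ → ℝ) (k : ℕ) : ℝ≥0 := ∑ t ∈ Finset.range k, ‖c t‖₊ ^ 2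

theorem coe_sqSum (c : ℕ → ℝ) (k : ℕ) : (sqSum c k : ℝ) = ∑ t ∈ Finset.range k, c t ^ 2 := by
  simp [sqSum]

theorem monotone_sqSum (c : ℕ → ℝ) : Monotone (sqSum c) := fun _ _ h =>
  Finset.sum_le_sum_of_subset (Finset.range_mono h)

/-- Both vectors have independent centred Gaussian entries, the `t`-th with variance `c t ^ 2`, so
both laws are the same product measure. -/
theorem map_multipliers_eq_map_increments (hY_indep : iIndepFun Y P)
    (hY_law : ∀ t, HasLaw (Y t) (gaussianReal 0 1) P) (hB : IsBrownianReal B P')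
    (c : ℕ → ℝ) (N : ℕ) :
    P.map (fun ω (t : Fin N) => c t * Y t ω) =
      P'.map (fun ω (t : Fin N) => B (sqSum c (t + 1)) ω - B (sqSum c t) ω) := by
  have h1 : iIndepFun (fun (t : Fin N) ω => c t * Y t ω) P :=
    (hY_indep.precomp (g := fun t : Fin N => (t : ℕ)) Fin.val_injective).comp
      (fun t x => c t * x) fun t => by fun_prop
  have h2 : iIndepFun (fun (t : Fin N) ω => B (sqSum c (t + 1)) ω - B (sqSum c t) ω) P' :=
    (hB.hasIndepIncrements.nat (monotone_sqSum c)).precomp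
      (g := fun t : Fin N => (t : ℕ)) Fin.val_injective
  have m1 : ∀ t : Fin N, AEMeasurable (fun ω => c t * Y t ω) P :=
    fun t => (hY_law t).aemeasurable.const_mul _
  have m2 : ∀ t : Fin N, AEMeasurable (fun ω => B (sqSum c (t + 1)) ω - B (sqSum c t) ω) P' :=
    fun t => (hB.aemeasurable _).sub (hB.aemeasurable _)
  rw [h1.map_fun_eq_pi_map m1, h2.map_fun_eq_pi_map m2]
  congr 1
  funext t
  have e1 := (gaussianReal_const_mul (hY_law t) (c t)).map_eq
  have e2 := (hB.hasLaw_sub (sqSum c (t + 1)) (sqSum c t)).map_eq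
  rw [e1]
  refine Eq.trans ?_ e2.symm
  congr 1
  · simp
  · rw [← NNReal.coe_inj, coe_nndist, Real.dist_eq]
    change _ = |(sqSum c (t + 1) : ℝ) - sqSum c t|
    rw [coe_sqSum, coe_sqSum, Finset.sum_range_succ, add_sub_cancel_left,
      abs_of_nonneg (sq_nonneg _)]
    simp

/-- The law of a Gaussian multiplier process is that of a time-changed Brownian motion. -/
theorem integral_multiplierPath (hY_indep : iIndepFun Y P)
    (hY_law : ∀ t, HasLaw (Y t) (gaussianReal 0 1) P) (hB : IsBrownianReal B P')
    (φ : BoundedContinuousFunction SkorokhodSpace ℝ) (n : ℕ) (K : ℕ → ℕ) (c : ℕ → ℝ) :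
    ∫ ω, φ (multiplierPath n K c fun t => Y t ω) ∂P =
      ∫ ω, φ (ofFloor n fun k => B (sqSum c (K k)) ω) ∂P' := by
  -- Any common upper bound of `K 0, …, K n` would do; the path then depends on the first `N`
  -- multipliers only.
  set N := ∑ k ∈ Finset.range (n + 1), K k with hN
  have hKN : ∀ k ≤ n, K k ≤ N := fun k hk =>
    Finset.single_le_sum (f := K) (fun _ _ => Nat.zero_le _)
      (Finset.mem_range.2 (Nat.lt_succ_of_le hk))
  let F : (Fin N → ℝ) → SkorokhodSpace := fun x =>
    ofFloor n fun k => ∑ t ∈ Finset.range (K k), if h : t < N then x ⟨t, h⟩ else 0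
  have hF : Measurable F := by
    have : F = fun x => ofVec n fun k => ∑ t ∈ Finset.range (K k),
        if h : t < N then x ⟨t, h⟩ else 0 := funext fun x => ofFloor_eq_ofVec _ _
    rw [this]
    refine (measurable_ofVec n).comp (measurable_pi_lambda _ fun k =>
      Finset.measurable_sum _ fun t _ => ?_)
    split_ifs <;> fun_prop
  have hφF : AEStronglyMeasurable (fun x => φ (F x))
      (P.map (fun ω (t : Fin N) => c t * Y t ω)) :=
    (φ.continuous.measurable.comp hF).aestronglyMeasurable
  have m1 : AEMeasurable (fun ω (t : Fin N) => c t * Y t ω) P :=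
    aemeasurable_pi_lambda _ fun t => (hY_law t).aemeasurable.const_mul _
  have m2 : AEMeasurable (fun ω (t : Fin N) => B (sqSum c (t + 1)) ω - B (sqSum c t) ω) P' :=
    aemeasurable_pi_lambda _ fun t => (hB.aemeasurable _).sub (hB.aemeasurable _)
  have key := map_multipliers_eq_map_increments hY_indep hY_law hB c N
  have e1 := integral_map m1 hφF
  have e2 := integral_map m2 (key ▸ hφF)
  rw [key, e2] at e1
  calc _ = ∫ ω, φ (F fun t : Fin N => c t * Y t ω) ∂P := by
        congr with ω
        congr 1
        refine ofFloor_congr fun k hk => Finset.sum_congr rfl fun t ht => ?_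
        simp [(Finset.mem_range.1 ht).trans_le (hKN k hk)]
    _ = _ := e1.symm
    _ = _ := by
        refine integral_congr_ae ?_
        -- The increments telescope to B(clock) − B(0), and B(0) = 0 almost surely.
        filter_upwards [hB.eval_zero_ae_eq_zero] with ω hω
        congr 1
        refine ofFloor_congr fun k hk => ?_
        have : ∀ t ∈ Finset.range (K k),
            (if h : t < N then (fun t : Fin N => B (sqSum c (t + 1)) ω - B (sqSum c t) ω) ⟨t, h⟩
              else 0) = B (sqSum c (t + 1)) ω - B (sqSum c t) ω := fun t ht => by
          simp [(Finset.mem_range.1 ht).trans_le (hKN k hk)]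
        rw [Finset.sum_congr rfl this, Finset.sum_range_sub (fun t => B (sqSum c t) ω)]
        simp [sqSum, hω]

end Gaussian

/-! ### Conditional laws -/

section Conditional

theorem integrable_of_abs_le {Ω : Type*} [MeasurableSpace Ω] {Q : Measure Ω} [IsFiniteMeasure Q]
    {f : Ω → ℝ} (K : ℝ) (hf : Measurable f) (h : ∀ x, |f x| ≤ K) : Integrable f Q :=
  Integrable.of_bound hf.aestronglyMeasurable K (ae_of_all _ fun x => by simpa using h x)

variable {Ω : Type*} [mΩ : MeasurableSpace Ω] {P : Measure Ω} [IsProbabilityMeasure P]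
  {A : Type*} [MeasurableSpace A]

/-- The `n + 1` values of the step function live in a standard Borel space, where a regular
conditional distribution exists; its image under `ofVec` is the required kernel. -/
theorem exists_hasCondDistrib_ofFloor {D : Ω → A} (hD : Measurable D) {n : ℕ} {Z : ℕ → Ω → ℝ}
    (hZ : ∀ k ≤ n, Measurable (Z k)) :
    ∃ κ : Kernel A SkorokhodSpace, IsMarkovKernel κ ∧
      HasCondDistrib (fun ω => ofFloor n fun k => Z k ω) D κ P := by
  have hV : Measurable fun ω (k : Fin (n + 1)) => Z k ω :=
    measurable_pi_lambda _ fun k => hZ k (Nat.lt_succ_iff.1 k.2)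
  have h : HasCondDistrib (fun ω (k : Fin (n + 1)) => Z k ω) D
      (condDistrib (fun ω (k : Fin (n + 1)) => Z k ω) D P) P :=
    ⟨(hD.prodMk hV).aemeasurable, (compProd_map_condDistrib hV.aemeasurable).symm⟩
  refine ⟨(condDistrib (fun ω (k : Fin (n + 1)) => Z k ω) D P).map (ofVec n),
    Kernel.IsMarkovKernel.map _ (measurable_ofVec n), ?_⟩
  convert! h.comp_left (measurable_ofVec n) using 1
  funext ω
  exact ofFloor_eq_ofVec _ _

/-- Conditioning on less information does not increase the `L₁` distance between a conditional
expectation and a constant; here the finer conditioning is on everything but an independent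
variable. -/
theorem integral_abs_integral_sub_le {C E S : Type*} [MeasurableSpace C] [MeasurableSpace E]
    [MeasurableSpace S] {D : Ω → A} {c : Ω → C} {W : Ω → E} {F : C × E → S}
    (hD : Measurable D) (hc : Measurable c) (hW : Measurable W) (hF : Measurable F)
    (hind : IndepFun (fun ω => (D ω, c ω)) W P) {κ : Kernel A S} [IsMarkovKernel κ]
    (hκ : HasCondDistrib (fun ω => F (c ω, W ω)) D κ P) {φ : S → ℝ} (hφ : Measurable φ) {K : ℝ}
    (hφK : ∀ x, |φ x| ≤ K) (θ : ℝ) :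
    Integrable (fun ω => |∫ x, φ x ∂κ (D ω) - θ|) P ∧
      ∫ ω, |∫ x, φ x ∂κ (D ω) - θ| ∂P ≤ ∫ ω, |∫ ω', φ (F (c ω, W ω')) ∂P - θ| ∂P := by
  have hK : 0 ≤ K := by
    obtain ⟨ω⟩ := P.nonempty_of_neZero
    exact (abs_nonneg _).trans (hφK (F (c ω, W ω)))
  set ψ : A → ℝ := fun a => ∫ x, φ x ∂κ a with hψ
  have hψm : Measurable ψ := (hφ.stronglyMeasurable.integral_kernel (κ := κ)).measurable
  have hψK : ∀ a, |ψ a| ≤ K := fun a => by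
    have := norm_integral_le_of_norm_le_const (μ := κ a) (f := φ) (C := K)
      (ae_of_all _ fun x => by simpa using hφK x)
    simpa using this
  set Φ : C → ℝ := fun a => ∫ ω', φ (F (a, W ω')) ∂P with hΦ
  have hΦm : Measurable Φ := by
    have : StronglyMeasurable (fun z : C × Ω => φ (F (z.1, W z.2))) :=
      (hφ.comp (hF.comp (by fun_prop))).stronglyMeasurable
    exact this.integral_prod_right.measurable
  have hΦK : ∀ a, |Φ a| ≤ K := fun a => by
    have := norm_integral_le_of_norm_le_const (μ := P) (f := fun ω' => φ (F (a, W ω'))) (C := K)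
      (ae_of_all _ fun x => by simpa using hφK _)
    simpa using this
  -- The sign of ψ − θ, a function of the data, so that |ψ − θ| = g (ψ − θ) and the absolute value
  -- disappears from the comparison.
  set g : A → ℝ := fun a => if θ ≤ ψ a then 1 else -1 with hg
  have hgm : Measurable g := Measurable.ite (measurableSet_le measurable_const hψm)
    measurable_const measurable_const
  have hg1 : ∀ a, |g a| ≤ 1 := fun a => by simp only [hg]; split_ifs <;> simp
  have hgψ : ∀ a, g a * (ψ a - θ) = |ψ a - θ| := fun a => by
    simp only [hg]; split_ifs with h
    · rw [one_mul, abs_of_nonneg (sub_nonneg.2 h)]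
    · rw [abs_of_neg (sub_neg.2 (not_le.1 h))]; ring
  -- The mean of g(D) φ(F(c, W)) is computed twice: by disintegration along κ, and in `e2` by
  -- Fubini, as W is independent of (D, c). Hence ψ may be replaced by the finer conditional mean
  -- Φ(c).
  have e1 : ∫ ω, g (D ω) * ψ (D ω) ∂P = ∫ ω, g (D ω) * φ (F (c ω, W ω)) ∂P := by
    have hm : Measurable fun z : A × S => g z.1 * φ z.2 := by fun_prop
    have hb : ∀ z : A × S, |g z.1 * φ z.2| ≤ 1 * K := fun z => by
      rw [abs_mul]; exact mul_le_mul (hg1 _) (hφK _) (abs_nonneg _) zero_le_one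
    have := hκ.map_eq
    have hpm : IsProbabilityMeasure (P.map D) := Measure.isProbabilityMeasure_map hD.aemeasurable
    calc ∫ ω, g (D ω) * ψ (D ω) ∂P = ∫ a, g a * ψ a ∂(P.map D) :=
          (integral_map hD.aemeasurable (hgm.mul hψm).aestronglyMeasurable).symm
      _ = ∫ a, ∫ x, g a * φ x ∂κ a ∂(P.map D) := by simp_rw [integral_const_mul, hψ]
      _ = ∫ z, g z.1 * φ z.2 ∂((P.map D) ⊗ₘ κ) :=
          (Measure.integral_compProd (integrable_of_abs_le _ hm hb)).symm
      _ = ∫ z, g z.1 * φ z.2 ∂(P.map fun ω => (D ω, F (c ω, W ω))) := by rw [this]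
      _ = _ := integral_map hκ.aemeasurable hm.aestronglyMeasurable
  have e2 : ∫ ω, g (D ω) * φ (F (c ω, W ω)) ∂P = ∫ ω, g (D ω) * Φ (c ω) ∂P := by
    have hm : Measurable fun z : (A × C) × E => g z.1.1 * φ (F (z.1.2, z.2)) := by fun_prop
    have hb : ∀ z : (A × C) × E, |g z.1.1 * φ (F (z.1.2, z.2))| ≤ 1 * K := fun z => by
      rw [abs_mul]; exact mul_le_mul (hg1 _) (hφK _) (abs_nonneg _) zero_le_one
    have hDc : Measurable fun ω => (D ω, c ω) := hD.prodMk hc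
    have hprod := (indepFun_iff_map_prod_eq_prod_map_map hDc.aemeasurable hW.aemeasurable).1 hind
    have i1 : IsProbabilityMeasure (P.map fun ω => (D ω, c ω)) :=
      Measure.isProbabilityMeasure_map hDc.aemeasurable
    have i2 : IsProbabilityMeasure (P.map W) := Measure.isProbabilityMeasure_map hW.aemeasurable
    calc ∫ ω, g (D ω) * φ (F (c ω, W ω)) ∂P
        = ∫ z, g z.1.1 * φ (F (z.1.2, z.2)) ∂(P.map fun ω => ((D ω, c ω), W ω)) :=
          (integral_map (hDc.prodMk hW).aemeasurable hm.aestronglyMeasurable).symm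
      _ = ∫ z, ∫ w, g z.1 * φ (F (z.2, w)) ∂(P.map W) ∂(P.map fun ω => (D ω, c ω)) := by
          rw [hprod, integral_prod _ (integrable_of_abs_le _ hm hb)]
      _ = ∫ ω, ∫ w, g (D ω) * φ (F (c ω, w)) ∂(P.map W) ∂P :=
          integral_map hDc.aemeasurable
            (hm.stronglyMeasurable.integral_prod_right).aestronglyMeasurable
      _ = _ := by
          congr with ω
          have hs : Measurable fun w => φ (F (c ω, w)) := hφ.comp (hF.comp (by fun_prop))
          rw [integral_const_mul, integral_map hW.aemeasurable hs.aestronglyMeasurable]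
  have hi : Integrable (fun ω => |ψ (D ω) - θ|) P :=
    ((integrable_of_abs_le K (hψm.comp hD) fun ω => hψK _).sub (integrable_const θ)).abs
  refine ⟨hi, ?_⟩
  have j1 : Integrable (fun ω => g (D ω) * ψ (D ω)) P :=
    integrable_of_abs_le (1 * K) ((hgm.mul hψm).comp hD) fun ω => by
      rw [abs_mul]; exact mul_le_mul (hg1 _) (hψK _) (abs_nonneg _) zero_le_one
  have j2 : Integrable (fun ω => g (D ω) * Φ (c ω)) P :=
    integrable_of_abs_le (1 * K) ((hgm.comp hD).mul (hΦm.comp hc)) fun ω => by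
      rw [abs_mul]; exact mul_le_mul (hg1 _) (hΦK _) (abs_nonneg _) zero_le_one
  have j3 : Integrable (fun ω => g (D ω) * θ) P :=
    (integrable_of_abs_le 1 (hgm.comp hD) fun ω => hg1 _).mul_const θ
  calc ∫ ω, |ψ (D ω) - θ| ∂P = ∫ ω, (g (D ω) * ψ (D ω) - g (D ω) * θ) ∂P := by
        congr with ω; rw [← hgψ]; ring
    _ = ∫ ω, (g (D ω) * Φ (c ω) - g (D ω) * θ) ∂P := by
        rw [integral_sub j1 j3, integral_sub j2 j3, e1, e2]
    _ ≤ ∫ ω, |Φ (c ω) - θ| ∂P := by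
        refine integral_mono (j2.sub j3)
          ((integrable_of_abs_le K (hΦm.comp hc) fun ω => hΦK _).sub (integrable_const θ)).abs fun ω => ?_
        change g (D ω) * Φ (c ω) - g (D ω) * θ ≤ |Φ (c ω) - θ|
        rw [← mul_sub]
        refine (le_abs_self _).trans ?_
        rw [abs_mul]
        exact mul_le_of_le_one_left (abs_nonneg _) (hg1 _)

end Conditional

open SkorokhodSpace

/-! ### From convergence of conditional variances to conditional weak convergence. -/

section MultiplierLimit

variable {Ω Ω' : Type*} [MeasurableSpace Ω] [MeasurableSpace Ω'] {P : Measure Ω} {P' : Measure Ω'}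
  {Y : ℕ → Ω → ℝ} {B : ℝ≥0 → Ω' → ℝ}

/-- Pointwise convergence in probability of monotone functions to a continuous function is
uniform. -/
theorem tendsto_measure_uniform_of_pointwise {V : C(I, ℝ≥0)} {v : ℕ → Ω → I → ℝ≥0}
    (hmono : ∀ n ω, Monotone (v n ω))
    (hV : ∀ u : I, ∀ η > 0, Tendsto (fun n => P {ω | η ≤ |(v n ω u : ℝ) - V u|}) atTop (𝓝 0))
    {r : ℝ} (hr : 0 < r) :
    Tendsto (fun n => P {ω | ¬ ∀ u : I, |(v n ω u : ℝ) - V u| ≤ r}) atTop (𝓝 0) := by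
  have hunif := CompactSpace.uniformContinuous_of_continuous V.continuous
  rw [Metric.uniformContinuous_iff] at hunif
  obtain ⟨δ, hδ, hVδ⟩ := hunif (r / 2) (half_pos hr)
  obtain ⟨m, hm0, hm⟩ : ∃ m : ℕ, 0 < m ∧ (1 : ℝ) / m < δ := by
    obtain ⟨m, hm⟩ := exists_nat_one_div_lt hδ
    exact ⟨m + 1, Nat.succ_pos m, by exact_mod_cast hm⟩
  have hm0' : (0 : ℝ) < m := Nat.cast_pos.2 hm0
  -- A grid of mesh 1/m across which V varies by less than r/2. Off finitely many events of small
  -- probability the error at the grid points is below r/2, and monotonicity sandwiches `v n ω u`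
  -- between neighbouring grid values.
  let g : ℕ → I := fun i => Set.projIcc 0 1 zero_le_one ((i : ℝ) / m)
  have hsum : Tendsto (fun n => ∑ i ∈ Finset.range (m + 1),
      P {ω | r / 2 ≤ |(v n ω (g i) : ℝ) - V (g i)|}) atTop (𝓝 0) := by
    simpa using tendsto_finsetSum (Finset.range (m + 1)) fun i _ => hV (g i) (r / 2) (half_pos hr)
  refine tendsto_of_tendsto_of_tendsto_of_le_of_le tendsto_const_nhds hsum (fun _ => bot_le)
    fun n => (measure_mono fun ω hω => ?_).trans (measure_biUnion_finset_le _ _)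
  by_contra hcon
  simp only [Set.mem_iUnion, not_exists, Set.mem_ofPred_eq, not_le, Finset.mem_range] at hcon
  refine hω fun u => ?_
  have hgr : ∀ i ≤ m, ((g i : I) : ℝ) = i / m := fun i hi => by
    have : (i : ℝ) / m ∈ Set.Icc (0 : ℝ) 1 :=
      ⟨by positivity, div_le_one_of_le₀ (by exact_mod_cast hi) hm0'.le⟩
    simp [g, Set.projIcc_of_mem zero_le_one this]
  have hu := u.2
  have hfl : (⌊(m : ℝ) * u⌋₊ : ℝ) ≤ m * u := Nat.floor_le (by have := hu.1; positivity)
  have hfl2 : (m : ℝ) * u < ⌊(m : ℝ) * u⌋₊ + 1 := Nat.lt_floor_add_one _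
  have hflm : ⌊(m : ℝ) * u⌋₊ ≤ m := floor_mul_le m u
  have hclm : ⌈(m : ℝ) * u⌉₊ ≤ m := Nat.ceil_le.2 (mul_le_of_le_one_right hm0'.le hu.2)
  have hcl : (m : ℝ) * u ≤ ⌈(m : ℝ) * u⌉₊ := Nat.le_ceil _
  have hcl2 : (⌈(m : ℝ) * u⌉₊ : ℝ) < m * u + 1 := Nat.ceil_lt_add_one (by have := hu.1; positivity)
  have lo : g ⌊(m : ℝ) * u⌋₊ ≤ u := by
    change ((g ⌊(m : ℝ) * u⌋₊ : I) : ℝ) ≤ u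
    rw [hgr _ hflm, div_le_iff₀ hm0']; linarith
  have hi : u ≤ g ⌈(m : ℝ) * u⌉₊ := by
    change (u : ℝ) ≤ ((g ⌈(m : ℝ) * u⌉₊ : I) : ℝ)
    rw [hgr _ hclm, le_div_iff₀ hm0']; linarith
  have dlo : dist (g ⌊(m : ℝ) * u⌋₊) u < δ := by
    refine lt_of_le_of_lt ?_ hm
    rw [Subtype.dist_eq, Real.dist_eq, hgr _ hflm]
    exact abs_floor_div_sub_le hm0 hu.1
  have dhi : dist (g ⌈(m : ℝ) * u⌉₊) u < δ := by
    refine lt_of_le_of_lt ?_ hm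
    rw [Subtype.dist_eq, Real.dist_eq, hgr _ hclm, abs_le]
    constructor
    · rw [neg_le_sub_iff_le_add, ← add_div, le_div_iff₀ hm0']; linarith
    · rw [sub_le_iff_le_add, div_le_iff₀ hm0', add_mul, one_div_mul_cancel hm0'.ne']; linarith
  have l1 := hcon _ (Nat.lt_succ_of_le hflm)
  have l2 := hcon _ (Nat.lt_succ_of_le hclm)
  have l3 := hVδ dlo
  have l4 := hVδ dhi
  rw [NNReal.dist_eq] at l3 l4
  have mlo : (v n ω (g ⌊(m : ℝ) * u⌋₊) : ℝ) ≤ v n ω u := by exact_mod_cast hmono n ω lo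
  have mhi : (v n ω u : ℝ) ≤ v n ω (g ⌈(m : ℝ) * u⌉₊) := by exact_mod_cast hmono n ω hi
  rw [abs_lt] at l1 l2 l3 l4
  rw [abs_le]
  constructor <;> linarith [l1.1, l1.2, l2.1, l2.2, l3.1, l3.2, l4.1, l4.2]

/-- Gaussian multiplier processes converge weakly in probability, conditionally on data that are
independent of the multipliers, when the conditional variances converge in probability. -/
theorem tendstoWeaklyInProbability_multiplierPath [IsProbabilityMeasure P]
    [IsProbabilityMeasure P'] (hY_meas : ∀ t, Measurable (Y t))
    (hY_indep : iIndepFun Y P) (hY_law : ∀ t, HasLaw (Y t) (gaussianReal 0 1) P)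
    (hB : IsBrownianReal B P') (V : C(I, ℝ≥0)) {A : ℕ → Type*} [∀ n, MeasurableSpace (A n)]
    {D : ∀ n, Ω → A n} (hD : ∀ n, Measurable (D n)) {c : ℕ → Ω → ℕ → ℝ}
    (hc : ∀ n, Measurable (c n)) {K : ℕ → ℕ → ℕ} (hK : ∀ n, Monotone (K n))
    (hind : ∀ n, IndepFun (fun ω => (D n ω, c n ω)) (fun ω t => Y t ω) P)
    (hV : ∀ u : I, ∀ η > 0, Tendsto (fun n => P {ω | η ≤
      |(sqSum (c n ω) (K n ⌊(n : ℝ) * (u : ℝ)⌋₊) : ℝ) - V u|}) atTop (𝓝 0))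
    (κ : ∀ n, Kernel (A n) SkorokhodSpace) [∀ n, IsMarkovKernel (κ n)]
    (hκ : ∀ n, HasCondDistrib (fun ω => multiplierPath n (K n) (c n ω) fun t => Y t ω) (D n)
      (κ n) P) :
    TendstoWeaklyInProbability P (fun n ω => kernelLaw (κ n) (D n ω))
      ⟨P'.map (timeChange B V), Measure.isProbabilityMeasure_map (aemeasurable_timeChange hB V)⟩ := by
  refine tendstoWeaklyInProbability_of_integral fun φ η hη => ?_
  change Tendsto (fun n => P {ω | η ≤ |∫ x, φ x ∂κ n (D n ω) -
    ∫ x, φ x ∂(P'.map (timeChange B V))|}) atTop (𝓝 0)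
  rw [integral_map (aemeasurable_timeChange hB V) φ.continuous.measurable.aestronglyMeasurable]
  set θ := ∫ ω, φ (timeChange B V ω) ∂P' with hθ
  have hφm : Measurable φ := φ.continuous.measurable
  have hφK : ∀ x, |φ x| ≤ ‖φ‖ := fun x => φ.norm_coe_le_norm x
  have hθK : |θ| ≤ ‖φ‖ := by
    simpa using norm_integral_le_of_norm_le_const (μ := P') (C := ‖φ‖)
      (f := fun ω => φ (timeChange B V ω)) (ae_of_all _ fun ω => hφK (timeChange B V ω))
  have hYm : Measurable fun ω t => Y t ω := measurable_pi_lambda _ hY_meas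
  have hbound := fun n => integral_abs_integral_sub_le (hD n) (hc n) hYm
    (measurable_multiplierPath n (K n)) (hind n) (hκ n) hφm hφK θ
  set Φ : ℕ → Ω → ℝ := fun n ω => ∫ ω', φ (multiplierPath n (K n) (c n ω) fun t => Y t ω') ∂P
    with hΦ
  have hΦK : ∀ n ω, |Φ n ω| ≤ ‖φ‖ := fun n ω => by
    simpa using norm_integral_le_of_norm_le_const (μ := P) (C := ‖φ‖)
      (f := fun ω' => φ (multiplierPath n (K n) (c n ω) fun t => Y t ω')) (ae_of_all _ fun ω' => hφK (multiplierPath n (K n) (c n ω) fun t => Y t ω'))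
  -- Φ is the conditional mean given the coefficients. Where the clock is uniformly within `r` of V
  -- it differs from θ by at most s/2, and elsewhere by at most 2‖φ‖.
  have hlim : Tendsto (fun n => ∫ ω, |Φ n ω - θ| ∂P) atTop (𝓝 0) := by
    rw [Metric.tendsto_nhds]
    intro s hs
    obtain ⟨r, hr, hclose⟩ := exists_forall_abs_integral_sub_le hB V φ (half_pos hs)
    have hbad := tendsto_measure_uniform_of_pointwise (P := P) (V := V)
      (v := fun n ω u => sqSum (c n ω) (K n ⌊(n : ℝ) * (u : ℝ)⌋₊))
      (fun n ω u u' huu' => monotone_sqSum _ (hK n (Nat.floor_mono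
        (mul_le_mul_of_nonneg_left huu' (Nat.cast_nonneg n))))) hV hr
    have hbad' : Tendsto (fun n => 2 * ‖φ‖ * P.real {ω | ¬ ∀ u : I,
        |(sqSum (c n ω) (K n ⌊(n : ℝ) * (u : ℝ)⌋₊) : ℝ) - V u| ≤ r}) atTop (𝓝 0) := by
      have := ((ENNReal.tendsto_toReal ENNReal.zero_ne_top).comp hbad).const_mul (2 * ‖φ‖)
      rwa [ENNReal.toReal_zero, mul_zero] at this
    filter_upwards [hbad'.eventually (gt_mem_nhds (half_pos hs))] with n hn
    set E := {ω | ¬ ∀ u : I, |(sqSum (c n ω) (K n ⌊(n : ℝ) * (u : ℝ)⌋₊) : ℝ) - V u| ≤ r}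
      with hE
    -- The event `E` is defined through uncountably many `u`; its measurable hull has the same
    -- probability and avoids proving it measurable.
    have hpt : ∀ ω, |Φ n ω - θ| ≤ s / 2 + (toMeasurable P E).indicator (fun _ => 2 * ‖φ‖) ω := by
      intro ω
      by_cases hω : ω ∈ toMeasurable P E
      · rw [Set.indicator_of_mem hω]
        have := abs_sub (Φ n ω) θ
        linarith [hΦK n ω]
      · have hω' : ω ∉ E := fun h => hω (subset_toMeasurable P E h)
        rw [Set.indicator_of_notMem hω, add_zero]
        simp only [hE, Set.mem_ofPred_eq, not_not] at hω'
        have := hclose n (fun k => sqSum (c n ω) (K n k)) hω'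
        rw [← integral_multiplierPath hY_indep hY_law hB φ n (K n) (c n ω)] at this
        exact this
    have hint : Integrable (fun ω => s / 2 + (toMeasurable P E).indicator (fun _ => 2 * ‖φ‖) ω) P :=
      (integrable_const _).add
        ((integrable_const _).indicator (measurableSet_toMeasurable P E))
    have hle := integral_mono_of_nonneg (ae_of_all _ fun ω => abs_nonneg (Φ n ω - θ)) hint
      (ae_of_all _ hpt)
    rw [integral_add (integrable_const _)
      ((integrable_const _).indicator (measurableSet_toMeasurable P E)),
      integral_indicator_const _ (measurableSet_toMeasurable P E)] at hle
    simp only [integral_const, smul_eq_mul, measureReal_def, measure_univ, measure_toMeasurable,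
      ENNReal.toReal_one, one_mul] at hle
    rw [Real.dist_eq, sub_zero, abs_of_nonneg (integral_nonneg fun ω => abs_nonneg _)]
    rw [measureReal_def] at hn
    linarith
  have hreal : Tendsto (fun n => P.real {ω | η ≤ |∫ x, φ x ∂κ n (D n ω) - θ|}) atTop (𝓝 0) := by
    have hlim' : Tendsto (fun n => η⁻¹ * ∫ ω, |Φ n ω - θ| ∂P) atTop (𝓝 0) := by
      simpa using hlim.const_mul η⁻¹
    refine squeeze_zero (fun _ => measureReal_nonneg) (fun n => ?_) hlim'
    have h1 := mul_meas_ge_le_integral_of_nonneg (μ := P)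
      (ae_of_all _ fun ω => abs_nonneg (∫ x, φ x ∂κ n (D n ω) - θ)) (hbound n).1 η
    rw [le_inv_mul_iff₀ hη]
    exact h1.trans (hbound n).2
  refine (ENNReal.tendsto_toReal_iff (fun n => measure_ne_top _ _) ENNReal.zero_ne_top).1 ?_
  simpa [measureReal_def] using hreal

end MultiplierLimit

/-! ### Conditional expectations for independent families -/

section CondExp

variable {Ω : Type*}

theorem setIntegral_inter_of_indep {m₁ m₂ mΩ : MeasurableSpace Ω} {P : Measure Ω}
    [IsProbabilityMeasure P]
    (h₁ : m₁ ≤ mΩ) (h₂ : m₂ ≤ mΩ) (hind : Indep m₁ m₂ P) {f : Ω → ℝ}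
    (hf : StronglyMeasurable[m₁] f) (hint : Integrable f P) {s t : Set Ω}
    (hs : MeasurableSet[m₁] s) (ht : MeasurableSet[m₂] t) :
    ∫ ω in s ∩ t, f ω ∂P = P.real t * ∫ ω in s, f ω ∂P := by
  have hi : Integrable (s.indicator f) P := hint.indicator (h₁ _ hs)
  have e := condExp_indep_eq (μ := P) h₁ h₂ (hf.indicator hs) hind
  rw [Set.inter_comm, ← setIntegral_indicator (h₁ _ hs), ← setIntegral_condExp h₂ hi ht,
    setIntegral_congr_ae (g := fun _ => P[s.indicator f]) (h₂ _ ht) (e.mono fun _ h _ => h),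
    setIntegral_const, integral_indicator (h₁ _ hs), smul_eq_mul]

/-- Adding an independent `σ`-algebra does not change a conditional expectation. -/
theorem condExp_sup_of_indep {m₁ m₂ m₃ mΩ : MeasurableSpace Ω} {P : Measure Ω}
    [IsProbabilityMeasure P]
    (h₁₃ : m₁ ≤ m₃) (h₂ : m₂ ≤ mΩ) (h₃ : m₃ ≤ mΩ) (hind : Indep m₃ m₂ P) {f : Ω → ℝ}
    (hf : StronglyMeasurable[m₃] f) (hint : Integrable f P) :
    P[f | m₁ ⊔ m₂] =ᵐ[P] P[f | m₁] := by
  have h₁ := h₁₃.trans h₃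
  have h₁₂ : m₁ ⊔ m₂ ≤ mΩ := sup_le h₁ h₂
  -- Intersections s ∩ t form a π-system generating the join, and on them independence factors P(t)
  -- out of both integrals.
  let S : Set (Set Ω) := {u | ∃ s t, MeasurableSet[m₁] s ∧ MeasurableSet[m₂] t ∧ u = s ∩ t}
  have hS : m₁ ⊔ m₂ = MeasurableSpace.generateFrom S := by
    refine le_antisymm (sup_le ?_ ?_) (MeasurableSpace.generateFrom_le ?_)
    · exact fun s hs => .basic _ ⟨s, Set.univ, hs, .univ, (Set.inter_univ s).symm⟩
    · exact fun t ht => .basic _ ⟨Set.univ, t, .univ, ht, (Set.univ_inter t).symm⟩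
    · rintro _ ⟨s, t, hs, ht, rfl⟩
      exact MeasurableSet.inter (m := m₁ ⊔ m₂) (le_sup_left (a := m₁) _ hs)
        (le_sup_right (a := m₁) _ ht)
  have hpi : IsPiSystem S := by
    rintro _ ⟨s, t, hs, ht, rfl⟩ _ ⟨s', t', hs', ht', rfl⟩ -
    exact ⟨s ∩ s', t ∩ t', hs.inter hs', ht.inter ht', Set.inter_inter_inter_comm _ _ _ _⟩
  have hm : StronglyMeasurable[m₁ ⊔ m₂] (P[f | m₁]) :=
    (stronglyMeasurable_condExp (m := m₁)).mono le_sup_left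
  refine (ae_eq_condExp_of_forall_setIntegral_eq h₁₂ hint
    (fun _ _ _ => integrable_condExp.integrableOn) (fun u hu _ => ?_)
    hm.aestronglyMeasurable).symm
  induction u, hu using MeasurableSpace.induction_on_inter hS hpi with
  | empty => simp
  | basic u hu =>
    obtain ⟨s, t, hs, ht, rfl⟩ := hu
    rw [setIntegral_inter_of_indep h₃ h₂ hind hf hint (h₁₃ _ hs) ht,
      setIntegral_inter_of_indep h₃ h₂ hind (stronglyMeasurable_condExp.mono h₁₃)
        integrable_condExp (h₁₃ _ hs) ht, setIntegral_condExp h₁ hint hs]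
  | compl u hu ih =>
    rw [setIntegral_compl (h₁₂ _ hu) integrable_condExp, setIntegral_compl (h₁₂ _ hu) hint,
      ih (measure_lt_top _ _), integral_condExp h₁]
  | iUnion u hd hu ih =>
    rw [integral_iUnion (fun i => h₁₂ _ (hu i)) hd integrable_condExp.integrableOn,
      integral_iUnion (fun i => h₁₂ _ (hu i)) hd hint.integrableOn]
    exact tsum_congr fun i => ih i (measure_lt_top _ _)

end CondExp

/-! ### Conditioning on subfamilies of an independent family. -/

section Sig

variable {Ω : Type*} {ι : Type*} {η : ι → Ω → ℝ}

/-- The `σ`-algebra generated by `η i`, `i ∈ A`. -/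
@[reducible]
def sig (η : ι → Ω → ℝ) (A : Set ι) : MeasurableSpace Ω :=
  ⨆ i ∈ A, MeasurableSpace.comap (η i) inferInstance

theorem sig_mono {A A' : Set ι} (h : A ⊆ A') : sig η A ≤ sig η A' :=
  biSup_mono h

theorem sig_union (A A' : Set ι) : sig η (A ∪ A') = sig η A ⊔ sig η A' := iSup_union

theorem sig_iUnion {κ : Type*} (A : κ → Set ι) : sig η (⋃ k, A k) = ⨆ k, sig η (A k) :=
  iSup_iUnion _ _

theorem measurable_sig {A : Set ι} {i : ι} (hi : i ∈ A) : Measurable[sig η A] (η i) :=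
  (comap_measurable (η i)).mono (le_iSup₂ (f := fun i (_ : i ∈ A) =>
    MeasurableSpace.comap (η i) inferInstance) i hi) le_rfl

theorem sig_eq_comap (A : Set ι) :
    sig η A = MeasurableSpace.comap (fun ω (i : A) => η i ω) MeasurableSpace.pi := by
  rw [sig, MeasurableSpace.pi, MeasurableSpace.comap_iSup, iSup_subtype']
  simp_rw [MeasurableSpace.comap_comp]
  rfl

variable [mΩ : MeasurableSpace Ω] {P : Measure Ω}

theorem sig_le (hη : ∀ i, Measurable (η i)) (A : Set ι) : sig η A ≤ mΩ :=
  iSup₂_le fun i _ => (hη i).comap_le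

theorem indep_sig (hη : ∀ i, Measurable (η i)) (hind : iIndepFun η P) {A A' : Set ι}
    (h : Disjoint A A') : Indep (sig η A) (sig η A') P :=
  indep_iSup_of_disjoint (fun i => (hη i).comap_le) hind.iIndep h

/-- Split A' into A ∩ A' and A' \ A: the second piece is independent of everything `f` depends on,
so it drops out of the conditioning. -/
theorem condExp_sig_inter [IsProbabilityMeasure P] (hη : ∀ i, Measurable (η i))
    (hind : iIndepFun η P) {A A' : Set ι} {f : Ω → ℝ} (hf : StronglyMeasurable[sig η A] f)
    (hint : Integrable f P) : P[f | sig η A'] =ᵐ[P] P[f | sig η (A ∩ A')] := by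
  have h := condExp_sup_of_indep (m₁ := sig η (A ∩ A')) (m₂ := sig η (A' \ A)) (m₃ := sig η A)
    (sig_mono Set.inter_subset_left) (sig_le hη _) (sig_le hη _)
    (indep_sig hη hind Set.disjoint_sdiff_right) hf hint
  rwa [← sig_union, Set.inter_comm, Set.inter_union_sdiff, Set.inter_comm] at h

/-- An iid family has the same law as its image under an injective reindexing. -/
theorem map_comp_injective_eq (hη : ∀ i, Measurable (η i)) (hind : iIndepFun η P) {i₀ : ι}
    (hid : ∀ i, IdentDistrib (η i) (η i₀) P P) {κ : Type*} {r r' : κ → ι}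
    (hr : Function.Injective r) (hr' : Function.Injective r') :
    P.map (fun ω k => η (r k) ω) = P.map (fun ω k => η (r' k) ω) := by
  rw [(hind.precomp hr).map_fun_eq_infinitePi_map fun k => hη (r k),
    (hind.precomp hr').map_fun_eq_infinitePi_map fun k => hη (r' k)]
  congr 1
  funext k
  exact ((hid (r k)).trans (hid (r' k)).symm).map_eq

/-- Replacing a variable by a copy does not change the conditional expectation given other
variables. -/
theorem condExp_sig_swap [IsProbabilityMeasure P] (hη : ∀ i, Measurable (η i))
    (hind : iIndepFun η P) {i₀ : ι} (hid : ∀ i, IdentDistrib (η i) (η i₀) P P) {A : Set ι}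
    {r : Equiv.Perm ι} (hr : ∀ i ∈ A, r i = i) {F : (ι → ℝ) → ℝ} (hF : Measurable F)
    (hint : Integrable (fun ω => F fun i => η i ω) P) :
    P[fun ω => F fun i => η (r i) ω | sig η A] =ᵐ[P] P[fun ω => F fun i => η i ω | sig η A] := by
  have hlaw := map_comp_injective_eq hη hind hid r.injective Function.injective_id
  have m1 : Measurable fun ω i => η (r i) ω := measurable_pi_lambda _ fun i => hη _
  have m2 : Measurable fun ω i => η i ω := measurable_pi_lambda _ fun i => hη _
  simp only [id] at hlaw
  have hint' : Integrable (fun ω => F fun i => η (r i) ω) P := by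
    have h2 := (integrable_map_measure hF.aestronglyMeasurable m2.aemeasurable).2 hint
    rw [← hlaw] at h2
    exact (integrable_map_measure hF.aestronglyMeasurable m1.aemeasurable).1 h2
  refine ae_eq_condExp_of_forall_setIntegral_eq (sig_le hη _) hint
    (fun _ _ _ => integrable_condExp.integrableOn) (fun s hs _ => ?_)
    stronglyMeasurable_condExp.aestronglyMeasurable
  rw [setIntegral_condExp (sig_le hη _) hint' hs]
  have hs' := sig_le hη _ _ hs
  rw [sig_eq_comap] at hs
  obtain ⟨T, hT, rfl⟩ := hs
  rw [← integral_indicator hs', ← integral_indicator hs']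
  -- The indicator of the conditioning event involves only coordinates fixed by `r`, so it can be
  -- absorbed into the functional; the whole family and its permutation then have the same law.
  let H : (ι → ℝ) → ℝ := ((fun x (i : A) => x i) ⁻¹' T).indicator F
  have hH : Measurable H := hF.indicator (measurable_pi_lambda _ (fun i => measurable_pi_apply _) hT)
  calc _ = ∫ ω, H (fun i => η (r i) ω) ∂P := by
        congr with ω
        simp only [H, Set.indicator, Set.mem_preimage]
        congr 2
        refine congrArg (· ∈ T) (funext fun i => ?_)
        change η i ω = η (r i) ω
        rw [hr i i.2]
    _ = ∫ x, H x ∂(P.map fun ω i => η (r i) ω) :=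
        (integral_map m1.aemeasurable hH.aestronglyMeasurable).symm
    _ = ∫ ω, H (fun i => η i ω) ∂P := by
        rw [hlaw, integral_map m2.aemeasurable hH.aestronglyMeasurable]
    _ = _ := rfl

end Sig

/-! ### Bounds on moments -/

section Moments

variable {Ω : Type*} [mΩ : MeasurableSpace Ω] {P : Measure Ω} {E : Type*} [NormedAddCommGroup E]

/-- `f` has `L_r` norm at most `c`. -/
structure LpBdd (P : Measure Ω) (r : ℝ≥0∞) (f : Ω → E) (c : ℝ) : Prop where
  aesm : AEStronglyMeasurable f P
  le : eLpNorm f r P ≤ ENNReal.ofReal c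

namespace LpBdd

variable {r : ℝ≥0∞} {f g : Ω → E} {c c' : ℝ}

theorem memLp (h : LpBdd P r f c) : MemLp f r P := ⟨h.aesm, h.le.trans_lt ENNReal.ofReal_lt_top⟩

theorem mono (h : LpBdd P r f c) (hc : c ≤ c') : LpBdd P r f c' :=
  ⟨h.aesm, h.le.trans (ENNReal.ofReal_le_ofReal hc)⟩

theorem congr (h : LpBdd P r f c) (hfg : f =ᵐ[P] g) : LpBdd P r g c :=
  ⟨h.aesm.congr hfg, (eLpNorm_congr_ae hfg).symm.le.trans h.le⟩

theorem exponent_mono [IsProbabilityMeasure P] {r' : ℝ≥0∞} (h : LpBdd P r f c) (hr : r' ≤ r) :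
    LpBdd P r' f c :=
  ⟨h.aesm, (eLpNorm_le_eLpNorm_of_exponent_le hr h.aesm).trans h.le⟩

theorem add (hr : 1 ≤ r) (hf : LpBdd P r f c) (hg : LpBdd P r g c') (hc : 0 ≤ c) (hc' : 0 ≤ c') :
    LpBdd P r (fun ω => f ω + g ω) (c + c') :=
  ⟨hf.aesm.add hg.aesm, (eLpNorm_add_le hf.aesm hg.aesm hr).trans
    ((add_le_add hf.le hg.le).trans_eq (ENNReal.ofReal_add hc hc').symm)⟩

theorem neg (hf : LpBdd P r f c) : LpBdd P r (fun ω => -f ω) c :=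
  ⟨hf.aesm.neg, (eLpNorm_neg f r P).le.trans hf.le⟩

theorem sub (hr : 1 ≤ r) (hf : LpBdd P r f c) (hg : LpBdd P r g c') (hc : 0 ≤ c) (hc' : 0 ≤ c') :
    LpBdd P r (fun ω => f ω - g ω) (c + c') := by
  simpa [sub_eq_add_neg] using add hr hf hg.neg hc hc'

theorem sum (hr : 1 ≤ r) {ι : Type*} {s : Finset ι} {f : ι → Ω → E} {c : ι → ℝ}
    (h : ∀ i ∈ s, LpBdd P r (f i) (c i)) (hc : ∀ i ∈ s, 0 ≤ c i) :
    LpBdd P r (fun ω => ∑ i ∈ s, f i ω) (∑ i ∈ s, c i) := by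
  have e : (fun ω => ∑ i ∈ s, f i ω) = ∑ i ∈ s, f i := by ext; simp
  rw [e]
  refine ⟨Finset.aestronglyMeasurable_sum _ fun i hi => (h i hi).aesm, ?_⟩
  rw [ENNReal.ofReal_sum_of_nonneg hc]
  exact (eLpNorm_sum_le (fun i hi => (h i hi).aesm) hr).trans
    (Finset.sum_le_sum fun i hi => (h i hi).le)

theorem const_mul {f : Ω → ℝ} (h : LpBdd P r f c) (k : ℝ) :
    LpBdd P r (fun ω => k * f ω) (|k| * c) := by
  refine ⟨h.aesm.const_mul k, ?_⟩
  rw [show (fun ω => k * f ω) = k • f from rfl, eLpNorm_const_smul,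
    ENNReal.ofReal_mul (abs_nonneg k), ← Real.norm_eq_abs, ofReal_norm]
  gcongr
  exact h.le

theorem of_norm_le {F : Type*} [NormedAddCommGroup F] {g : Ω → F} (hf : LpBdd P r f c)
    (hg : AEStronglyMeasurable g P) {k : ℝ} (hk : 0 ≤ k) (h : ∀ ω, ‖g ω‖ ≤ k * ‖f ω‖) :
    LpBdd P r g (k * c) := by
  refine ⟨hg, (eLpNorm_le_mul_eLpNorm_of_ae_le_mul (ae_of_all _ h) r).trans ?_⟩
  rw [ENNReal.ofReal_mul hk]
  gcongr
  exact hf.le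

theorem of_tendsto {f : ℕ → Ω → E} (h : ∀ n, LpBdd P r (f n) c) {g : Ω → E}
    (hg : AEStronglyMeasurable g P) (hfg : ∀ᵐ ω ∂P, Tendsto (fun n => f n ω) atTop (𝓝 (g ω))) :
    LpBdd P r g c :=
  ⟨hg, Lp.eLpNorm_le_of_ae_tendsto (Eventually.of_forall fun n => (h n).le) (fun n => (h n).aesm)
    hfg⟩

theorem of_tendsto_const {c : ℕ → ℝ} {c' : ℝ} (h : ∀ n, LpBdd P r f (c n))
    (hc : Tendsto c atTop (𝓝 c')) : LpBdd P r f c' :=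
  ⟨(h 0).aesm, ge_of_tendsto ((ENNReal.continuous_ofReal.tendsto _).comp hc)
    (Eventually.of_forall fun n => (h n).le)⟩

theorem norm (h : LpBdd P r f c) : LpBdd P r (fun ω => ‖f ω‖) c :=
  ⟨h.aesm.norm, (eLpNorm_norm f).le.trans h.le⟩

theorem integral_abs_le {f : Ω → ℝ} (h : LpBdd P 1 f c) (hc : 0 ≤ c) :
    Integrable f P ∧ ∫ ω, |f ω| ∂P ≤ c := by
  have hi := memLp_one_iff_integrable.1 h.memLp
  refine ⟨hi, ?_⟩
  have h2 := h.le
  rw [eLpNorm_one_eq_lintegral_enorm, ← ofReal_integral_norm_eq_lintegral_enorm hi,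
    ENNReal.ofReal_le_ofReal_iff hc] at h2
  simpa using h2

theorem mul {r₁ r₂ r₃ : ℝ≥0∞} [ENNReal.HolderTriple r₁ r₂ r₃] {f g : Ω → ℝ}
    (hf : LpBdd P r₁ f c) (hg : LpBdd P r₂ g c') (hc : 0 ≤ c) :
    LpBdd P r₃ (fun ω => f ω * g ω) (c * c') := by
  refine ⟨hf.aesm.mul hg.aesm, ?_⟩
  have := eLpNorm_smul_le_mul_eLpNorm (p := r₁) (q := r₂) (r := r₃) hg.aesm hf.aesm
  refine this.trans ?_
  rw [ENNReal.ofReal_mul hc]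
  exact mul_le_mul' hf.le hg.le

instance : ENNReal.HolderTriple 4 4 2 where
  inv_add_inv_eq_inv := by
    have h4 : (4 : ℝ≥0∞) = 2 * 2 := by norm_num
    rw [h4, ENNReal.mul_inv (by simp) (by simp), ← mul_add, ENNReal.inv_two_add_inv_two, mul_one]

theorem mul_four {f g : Ω → ℝ} (hf : LpBdd P 4 f c) (hg : LpBdd P 4 g c') (hc : 0 ≤ c) :
    LpBdd P 2 (fun ω => f ω * g ω) (c * c') := hf.mul hg hc

theorem mul_two {f g : Ω → ℝ} (hf : LpBdd P 2 f c) (hg : LpBdd P 2 g c') (hc : 0 ≤ c) :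
    LpBdd P 1 (fun ω => f ω * g ω) (c * c') := hf.mul hg hc

theorem integral_sq_le {f : Ω → ℝ} (hf : LpBdd P 2 f c) (hc : 0 ≤ c) :
    ∫ ω, f ω ^ 2 ∂P ≤ c ^ 2 := by
  have h := ((hf.mul_two hf hc).integral_abs_le (mul_nonneg hc hc)).2
  simpa [pow_two] using h

theorem integral_pow_four_le {f : Ω → ℝ} (hf : LpBdd P 4 f c) (hc : 0 ≤ c) :
    ∫ ω, f ω ^ 4 ∂P ≤ c ^ 4 := by
  have h := (hf.mul_four hf hc).integral_sq_le (mul_nonneg hc hc)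
  calc ∫ ω, f ω ^ 4 ∂P = ∫ ω, (f ω * f ω) ^ 2 ∂P := by congr with ω; ring
    _ ≤ (c * c) ^ 2 := h
    _ = c ^ 4 := by ring

theorem of_integral_pow_four_le {f : Ω → ℝ} (hf : MemLp f 4 P) (hc : 0 ≤ c)
    (h : ∫ ω, f ω ^ 4 ∂P ≤ c ^ 4) : LpBdd P 4 f c := by
  refine ⟨hf.1, ?_⟩
  rw [hf.eLpNorm_eq_integral_rpow_norm (by norm_num) (by norm_num)]
  apply ENNReal.ofReal_le_ofReal
  have h4 : (4 : ℝ≥0∞).toReal = 4 := by norm_num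
  rw [h4]
  have e : ∫ ω, ‖f ω‖ ^ (4 : ℝ) ∂P = ∫ ω, f ω ^ 4 ∂P := by
    congr with ω
    rw [show (4 : ℝ) = ((4 : ℕ) : ℝ) by norm_num, Real.rpow_natCast, Real.norm_eq_abs]
    exact Even.pow_abs (by decide) _
  rw [e]
  calc _ ≤ (c ^ 4) ^ (4 : ℝ)⁻¹ := Real.rpow_le_rpow (integral_nonneg fun ω => by positivity) h
        (by norm_num)
    _ = c := by
        rw [← Real.rpow_natCast, ← Real.rpow_mul hc]; norm_num

theorem abs_integral_le [IsProbabilityMeasure P] {f : Ω → ℝ} (hr : 1 ≤ r) (hf : LpBdd P r f c)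
    (hc : 0 ≤ c) : |∫ ω, f ω ∂P| ≤ c :=
  (abs_integral_le_integral_abs).trans ((hf.exponent_mono hr).integral_abs_le hc).2

theorem abs_covariance_le [IsProbabilityMeasure P] {f g : Ω → ℝ} (hf : LpBdd P 2 f c)
    (hg : LpBdd P 2 g c') (hc : 0 ≤ c) (hc' : 0 ≤ c') : |cov[f, g; P]| ≤ 2 * (c * c') := by
  rw [covariance_eq_sub hf.memLp hg.memLp]
  have h1 := (hf.mul_two hg hc).abs_integral_le le_rfl (mul_nonneg hc hc')
  have h2 := hf.abs_integral_le (by norm_num) hc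
  have h3 := hg.abs_integral_le (by norm_num) hc'
  refine (abs_sub _ _).trans ?_
  rw [abs_mul]
  have := mul_le_mul h2 h3 (abs_nonneg _) hc
  have e : (f * g : Ω → ℝ) = fun ω => f ω * g ω := rfl
  rw [e]
  linarith

end LpBdd

theorem integrable_pow_mul_pow_of_memLp_four {f g : Ω → ℝ} (hf : MemLp f 4 P) (hg : MemLp g 4 P)
    {i j : ℕ} (hij : i + j = 4) : Integrable (fun ω => f ω ^ i * g ω ^ j) P := by
  have h1 : Integrable (fun ω => f ω ^ 4) P := by
    have := hf.integrable_norm_pow (p := 4) (by norm_num)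
    refine this.congr (ae_of_all _ fun ω => ?_)
    exact Even.pow_abs (by decide) _
  have h2 : Integrable (fun ω => g ω ^ 4) P := by
    have := hg.integrable_norm_pow (p := 4) (by norm_num)
    refine this.congr (ae_of_all _ fun ω => ?_)
    exact Even.pow_abs (by decide) _
  refine (h1.add h2).mono' ((hf.1.pow i).mul (hg.1.pow j)) (ae_of_all _ fun ω => ?_)
  rw [norm_mul, norm_pow, norm_pow, Real.norm_eq_abs, Real.norm_eq_abs]
  change _ ≤ f ω ^ 4 + g ω ^ 4
  rw [← Even.pow_abs (by decide : Even 4) (f ω), ← Even.pow_abs (by decide : Even 4) (g ω)]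
  rcases le_total |f ω| |g ω| with h | h
  · calc |f ω| ^ i * |g ω| ^ j ≤ |g ω| ^ i * |g ω| ^ j := by gcongr
      _ = |g ω| ^ 4 := by rw [← pow_add, hij]
      _ ≤ _ := by have := pow_nonneg (abs_nonneg (f ω)) 4; linarith
  · calc |f ω| ^ i * |g ω| ^ j ≤ |f ω| ^ i * |f ω| ^ j := by gcongr
      _ = |f ω| ^ 4 := by rw [← pow_add, hij]
      _ ≤ _ := by have := pow_nonneg (abs_nonneg (g ω)) 4; linarith

/-- Fourth moments of sums of martingale differences. -/
theorem integral_sum_martingale_diff_pow_four_le {D : ℕ → Ω → ℝ} {m : ℕ → MeasurableSpace Ω}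
    [IsProbabilityMeasure P] (hm : ∀ k, m k ≤ mΩ) {N : ℕ}
    (hmeas : ∀ k < N, StronglyMeasurable[m k] fun ω => ∑ j ∈ Finset.range k, D j ω)
    (hzero : ∀ k < N, P[D k | m k] =ᵐ[P] 0) {c : ℝ} (hc : 0 ≤ c)
    (hD : ∀ k < N, LpBdd P 4 (D k) c) :
    ∀ k ≤ N, MemLp (fun ω => ∑ j ∈ Finset.range k, D j ω) 4 P ∧
      ∫ ω, (∑ j ∈ Finset.range k, D j ω) ^ 4 ∂P ≤ 16 * k ^ 2 * c ^ 4 := by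
  intro k
  induction k with
  | zero => intro _; simp
  | succ k ih =>
    intro hk
    obtain ⟨ihm, ih⟩ := ih (Nat.le_of_succ_le hk)
    have hDk := hD k hk
    have hDm := hDk.memLp
    set S : Ω → ℝ := fun ω => ∑ j ∈ Finset.range k, D j ω with hS
    have hsum : ∀ ω, ∑ j ∈ Finset.range (k + 1), D j ω = S ω + D k ω := fun ω =>
      Finset.sum_range_succ _ _
    simp only [hsum]
    refine ⟨ihm.add hDm, ?_⟩
    have i40 := integrable_pow_mul_pow_of_memLp_four ihm hDm (i := 4) (j := 0) rfl
    have i31 := integrable_pow_mul_pow_of_memLp_four ihm hDm (i := 3) (j := 1) rfl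
    have i04 := integrable_pow_mul_pow_of_memLp_four ihm hDm (i := 0) (j := 4) rfl
    have i22 := integrable_pow_mul_pow_of_memLp_four ihm hDm (i := 2) (j := 2) rfl
    simp only [pow_zero, pow_one, mul_one, one_mul] at i40 i31 i04
    -- The partial sum is `m k`-measurable and `D k` has conditional mean zero given `m k`. Only
    -- this is used, and the `m k` need not be nested.
    have hcross : ∫ ω, S ω ^ 3 * D k ω ∂P = 0 := by
      have hS3 : StronglyMeasurable[m k] (fun ω => S ω ^ 3) := (hmeas k hk).pow 3
      have e := condExp_mul_of_stronglyMeasurable_left (μ := P) hS3 (g := D k) i31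
        (hDm.integrable (by norm_num))
      calc ∫ ω, S ω ^ 3 * D k ω ∂P = ∫ ω, (P[(fun ω => S ω ^ 3) * D k | m k]) ω ∂P :=
            (integral_condExp (hm k)).symm
        _ = ∫ ω, (0 : ℝ) ∂P := by
            refine integral_congr_ae ?_
            filter_upwards [e, hzero k hk] with ω h1 h2
            rw [h1, Pi.mul_apply, h2, Pi.zero_apply, mul_zero]
        _ = 0 := by simp
    have hD4 : ∫ ω, D k ω ^ 4 ∂P ≤ c ^ 4 := hDk.integral_pow_four_le hc
    have hc4 : 0 ≤ c ^ 4 := by positivity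
    -- Young's inequality with weight 8k, balanced so that the induction bound 16 k² c⁴ on the
    -- fourth moment of S yields a term linear in k.
    have h22 : ∫ ω, S ω ^ 2 * D k ω ^ 2 ∂P ≤ 4 * k * c ^ 4 := by
      rcases Nat.eq_zero_or_pos k with rfl | hk0
      · simp [hS]
      have hk' : (0 : ℝ) < k := Nat.cast_pos.2 hk0
      calc ∫ ω, S ω ^ 2 * D k ω ^ 2 ∂P
          ≤ ∫ ω, ((8 * k : ℝ)⁻¹ * S ω ^ 4 + 2 * k * D k ω ^ 4) ∂P := by
            refine integral_mono i22 ((i40.const_mul _).add (i04.const_mul _)) fun ω => ?_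
            have h := sq_nonneg (S ω ^ 2 - 4 * k * D k ω ^ 2)
            have e : (8 * k : ℝ)⁻¹ * S ω ^ 4 + 2 * k * D k ω ^ 4 - S ω ^ 2 * D k ω ^ 2 =
                (8 * k : ℝ)⁻¹ * (S ω ^ 2 - 4 * k * D k ω ^ 2) ^ 2 := by field_simp; ring
            have : 0 ≤ (8 * k : ℝ)⁻¹ * (S ω ^ 2 - 4 * k * D k ω ^ 2) ^ 2 := by positivity
            simp only
            linarith
        _ = (8 * k : ℝ)⁻¹ * ∫ ω, S ω ^ 4 ∂P + 2 * k * ∫ ω, D k ω ^ 4 ∂P := by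
            rw [integral_add (i40.const_mul _) (i04.const_mul _), integral_const_mul,
              integral_const_mul]
        _ ≤ (8 * k : ℝ)⁻¹ * (16 * k ^ 2 * c ^ 4) + 2 * k * c ^ 4 := by gcongr
        _ = 4 * k * c ^ 4 := by field_simp; ring
    -- The term 4 S D³ is absorbed: the right side minus the left equals 2 D² (S − D)². The
    -- induction closes because 16k² + 32k + 3 ≤ 16(k + 1)².
    calc ∫ ω, (S ω + D k ω) ^ 4 ∂P
        ≤ ∫ ω, (S ω ^ 4 + 4 * (S ω ^ 3 * D k ω) + 8 * (S ω ^ 2 * D k ω ^ 2) + 3 * D k ω ^ 4) ∂P := by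
          refine integral_mono (by
            simpa using integrable_pow_mul_pow_of_memLp_four (ihm.add hDm) hDm
              (i := 4) (j := 0) rfl)
            (((i40.add (i31.const_mul _)).add (i22.const_mul _)).add (i04.const_mul _)) fun ω => ?_
          simp only
          nlinarith [mul_nonneg (sq_nonneg (D k ω)) (sq_nonneg (S ω - D k ω))]
      _ = ∫ ω, S ω ^ 4 ∂P + 4 * ∫ ω, S ω ^ 3 * D k ω ∂P + 8 * ∫ ω, S ω ^ 2 * D k ω ^ 2 ∂P
          + 3 * ∫ ω, D k ω ^ 4 ∂P := by
          have j1 : Integrable (fun ω => S ω ^ 4 + 4 * (S ω ^ 3 * D k ω)) P :=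
            i40.add (i31.const_mul 4)
          have j2 : Integrable (fun ω => S ω ^ 4 + 4 * (S ω ^ 3 * D k ω)
              + 8 * (S ω ^ 2 * D k ω ^ 2)) P := j1.add (i22.const_mul 8)
          rw [integral_add j2 (i04.const_mul _), integral_add j1 (i22.const_mul _),
            integral_add i40 (i31.const_mul _), integral_const_mul, integral_const_mul,
            integral_const_mul]
      _ ≤ 16 * k ^ 2 * c ^ 4 + 4 * 0 + 8 * (4 * k * c ^ 4) + 3 * c ^ 4 := by
          rw [hcross]; gcongr
      _ ≤ 16 * ((k + 1 : ℕ) : ℝ) ^ 2 * c ^ 4 := by push_cast; nlinarith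

end Moments

/-! ### Functionals of the innovations -/

section Innovations

variable {Ω : Type*} {ε ε' : ℤ → Ω → ℝ}

/-- The `σ`-algebra generated by the innovations with times in `S`. -/
@[reducible]
def timeSig (ε ε' : ℤ → Ω → ℝ) (S : Set ℤ) : MeasurableSpace Ω :=
  sig (Sum.elim ε ε') (Sum.inl '' S)

theorem timeSig_mono {S S' : Set ℤ} (h : S ⊆ S') : timeSig ε ε' S ≤ timeSig ε ε' S' :=
  sig_mono (Set.image_mono h)

theorem measurable_past_timeSig (t : ℤ) :
    Measurable[timeSig ε ε' (Set.Iic t)] (past ε t) := by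
  refine @measurable_pi_lambda _ _ _ (timeSig ε ε' (Set.Iic t)) _ _ fun i => ?_
  exact measurable_sig (η := Sum.elim ε ε') (i := Sum.inl (t - i)) ⟨t - i, by simp, rfl⟩

variable [mΩ : MeasurableSpace Ω] {P : Measure Ω}

/-- iid innovations together with iid copies. -/
structure Innovations (P : Measure Ω) (ε ε' : ℤ → Ω → ℝ) : Prop where
  meas : ∀ i, Measurable (Sum.elim ε ε' i)
  indep : iIndepFun (Sum.elim ε ε') P
  ident : ∀ i, IdentDistrib (Sum.elim ε ε' i) (Sum.elim ε ε' (Sum.inl 0)) P P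

/-- `g` has `L₄` norm at most `C` and geometrically decaying physical dependence measure. -/
structure GeomDep (P : Measure Ω) (ε ε' : ℤ → Ω → ℝ) (ρ C : ℝ) (g : (ℕ → ℝ) → ℝ) : Prop where
  meas : Measurable g
  bdd : LpBdd P 4 (fun ω => g (past ε 0 ω)) C
  dep : ∀ (t : ℤ) (j : ℕ),
    LpBdd P 4 (fun ω => g (past ε t ω) - g (pastReplaced ε ε' t j ω)) (C * ρ ^ j)

namespace Innovations

theorem measurable_eps (h : Innovations P ε ε') (t : ℤ) : Measurable (ε t) := h.meas (Sum.inl t)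

theorem measurable_past (h : Innovations P ε ε') (t : ℤ) : Measurable (past ε t) :=
  measurable_pi_lambda _ fun _ => h.measurable_eps _

theorem timeSig_le (h : Innovations P ε ε') (S : Set ℤ) : timeSig ε ε' S ≤ mΩ :=
  sig_le h.meas _

theorem identDistrib_shift (h : Innovations P ε ε') (s : ℤ) :
    IdentDistrib (fun ω i => ε (i + s) ω) (fun ω i => ε i ω) P P where
  aemeasurable_fst := (measurable_pi_lambda _ fun _ => h.measurable_eps _).aemeasurable
  aemeasurable_snd := (measurable_pi_lambda _ fun _ => h.measurable_eps _).aemeasurable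
  map_eq := map_comp_injective_eq h.meas h.indep h.ident
    (r := fun i : ℤ => Sum.inl (i + s)) (r' := Sum.inl)
    (fun i j hij => by simpa using hij) Sum.inl_injective

theorem identDistrib_past (h : Innovations P ε ε') (t : ℤ) :
    IdentDistrib (past ε t) (past ε 0) P P := by
  have := (h.identDistrib_shift t).comp (u := fun (x : ℤ → ℝ) (i : ℕ) => x (0 - i))
    (measurable_pi_lambda _ fun i => measurable_pi_apply _)
  convert! this using 1
  funext ω i
  simp only [past, Function.comp]
  congr 1
  ring

theorem identDistrib_past_pair (h : Innovations P ε ε') (t k : ℤ) :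
    IdentDistrib (fun ω => (past ε t ω, past ε (t + k) ω))
      (fun ω => (past ε 0 ω, past ε k ω)) P P := by
  have := (h.identDistrib_shift t).comp
    (u := fun (x : ℤ → ℝ) => ((fun i : ℕ => x (0 - i)), fun i : ℕ => x (k - i)))
    ((measurable_pi_lambda _ fun i => measurable_pi_apply _).prodMk
      (measurable_pi_lambda _ fun i => measurable_pi_apply _))
  convert! this using 1
  funext ω
  refine Prod.ext (funext fun i => ?_) (funext fun i => ?_) <;>
  · change ε _ ω = ε _ ω
    congr 1
    ring

theorem covariance_past (h : Innovations P ε ε') {g g' : (ℕ → ℝ) → ℝ} (hg : Measurable g)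
    (hg' : Measurable g') (t k : ℤ) :
    cov[fun ω => g (past ε t ω), fun ω => g' (past ε (t + k) ω); P] =
      cov[fun ω => g (past ε 0 ω), fun ω => g' (past ε k ω); P] := by
  have hp := h.identDistrib_past_pair t k
  have m1 : AEStronglyMeasurable (fun z : (ℕ → ℝ) × (ℕ → ℝ) => g z.1)
      (P.map fun ω => (past ε t ω, past ε (t + k) ω)) :=
    (hg.comp measurable_fst).aestronglyMeasurable
  have m2 : AEStronglyMeasurable (fun z : (ℕ → ℝ) × (ℕ → ℝ) => g' z.2)
      (P.map fun ω => (past ε t ω, past ε (t + k) ω)) :=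
    (hg'.comp measurable_snd).aestronglyMeasurable
  have e1 := covariance_map_fun m1 m2 hp.aemeasurable_fst
  have e2 := covariance_map_fun (hp.map_eq ▸ m1) (hp.map_eq ▸ m2) hp.aemeasurable_snd
  rw [hp.map_eq, e2] at e1
  exact e1.symm

theorem lpBdd_past {E : Type*} [NormedAddCommGroup E] [MeasurableSpace E] [BorelSpace E]
    [SecondCountableTopology E] (h : Innovations P ε ε') {r : ℝ≥0∞} {g : (ℕ → ℝ) → E}
    (hg : Measurable g) {c : ℝ} (hb : LpBdd P r (fun ω => g (past ε 0 ω)) c) (t : ℤ) :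
    LpBdd P r (fun ω => g (past ε t ω)) c :=
  ⟨(hg.comp (h.measurable_past t)).aestronglyMeasurable,
    (((h.identDistrib_past t).comp hg).eLpNorm_eq r).le.trans hb.le⟩

theorem integral_past {E : Type*} [NormedAddCommGroup E] [NormedSpace ℝ E] [MeasurableSpace E]
    [BorelSpace E] (h : Innovations P ε ε') {g : (ℕ → ℝ) → E}
    (hg : Measurable g) (t : ℤ) : ∫ ω, g (past ε t ω) ∂P = ∫ ω, g (past ε 0 ω) ∂P :=
  ((h.identDistrib_past t).comp hg).integral_eq

end Innovations

/-- The conditional expectation of `g (past ε t)` given the last `m` innovations. -/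
def appr (P : Measure Ω) (ε ε' : ℤ → Ω → ℝ) (g : (ℕ → ℝ) → ℝ) (t : ℤ) (m : ℕ) : Ω → ℝ :=
  P[fun ω => g (past ε t ω) | timeSig ε ε' (Set.Ioc (t - m) t)]

theorem stronglyMeasurable_appr (g : (ℕ → ℝ) → ℝ) (t : ℤ) (m : ℕ) :
    StronglyMeasurable[timeSig ε ε' (Set.Ioc (t - m) t)] (appr P ε ε' g t m) :=
  stronglyMeasurable_condExp

variable {ρ C : ℝ} {g : (ℕ → ℝ) → ℝ}

section

variable (h : Innovations P ε ε')

include h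

theorem GeomDep.lpBdd (hg : GeomDep P ε ε' ρ C g) (t : ℤ) :
    LpBdd P 4 (fun ω => g (past ε t ω)) C := h.lpBdd_past hg.meas hg.bdd t

variable [IsProbabilityMeasure P]

theorem GeomDep.integrable (hg : GeomDep P ε ε' ρ C g) (t : ℤ) :
    Integrable (fun ω => g (past ε t ω)) P :=
  (hg.lpBdd h t).memLp.integrable (by norm_num)

/-- The replaced past does not involve the innovation at time t − m, so conditioning on the last m +
1 innovations amounts to conditioning on the last m. Exchanging the copy with the original then
leaves the conditional expectation unchanged, since neither belongs to that window. -/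
theorem condExp_pastReplaced (hg : GeomDep P ε ε' ρ C g) (t : ℤ) (m : ℕ) :
    P[fun ω => g (pastReplaced ε ε' t m ω) | timeSig ε ε' (Set.Ioc (t - (m + 1 : ℕ)) t)] =ᵐ[P]
      appr P ε ε' g t m := by
  let r : Equiv.Perm (ℤ ⊕ ℤ) := Equiv.swap (Sum.inl (t - m)) (Sum.inr (t - m))
  have hr : ∀ (ω : Ω) (i : ℕ), pastReplaced ε ε' t m ω i =
      Sum.elim ε ε' (r (Sum.inl (t - i))) ω := fun ω i => by
    simp only [pastReplaced, r]
    split_ifs with hi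
    · subst hi; simp
    · rw [Equiv.swap_apply_of_ne_of_ne (by simp; omega) (by simp)]; rfl
  let A : Set (ℤ ⊕ ℤ) := Sum.inl '' (Set.Iic t \ {t - m}) ∪ {Sum.inr (t - m)}
  have hm : Measurable[sig (Sum.elim ε ε') A] (pastReplaced ε ε' t m) := by
    refine @measurable_pi_lambda _ _ _ (sig (Sum.elim ε ε') A) _ _ fun i => ?_
    by_cases hi : i = m
    · subst hi
      have : (fun ω => pastReplaced ε ε' t i ω i) = Sum.elim ε ε' (Sum.inr (t - i)) := by
        funext ω; simp [pastReplaced]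
      rw [this]
      exact measurable_sig (Or.inr rfl)
    · have : (fun ω => pastReplaced ε ε' t m ω i) = Sum.elim ε ε' (Sum.inl (t - i)) := by
        funext ω; simp [pastReplaced, hi]
      rw [this]
      refine measurable_sig (Or.inl ⟨t - i, ⟨by simp, ?_⟩, rfl⟩)
      simp only [Set.mem_singleton_iff]
      omega
  have hA : A ∩ Sum.inl '' Set.Ioc (t - (m + 1 : ℕ)) t = Sum.inl '' Set.Ioc (t - m) t := by
    ext x
    rcases x with x | x <;> simp [A]
    omega
  have hint : Integrable (fun ω => g (pastReplaced ε ε' t m ω)) P := by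
    have h1 := (hg.dep t m).memLp.integrable (by norm_num)
    refine ((hg.integrable h t).sub h1).congr (ae_of_all _ fun ω => ?_)
    simp
  have e1 := condExp_sig_inter (P := P) (A' := Sum.inl '' Set.Ioc (t - (m + 1 : ℕ)) t) h.meas
    h.indep (hg.meas.comp hm).stronglyMeasurable hint
  rw [hA] at e1
  refine e1.trans ?_
  have e2 := condExp_sig_swap (P := P) h.meas h.indep h.ident
    (A := Sum.inl '' Set.Ioc (t - m) t) (r := r) (by
      rintro _ ⟨i, hi, rfl⟩
      refine Equiv.swap_apply_of_ne_of_ne ?_ (by simp)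
      simp only [ne_eq, Sum.inl.injEq]
      rintro rfl
      simp at hi)
    (F := fun x => g fun i : ℕ => x (Sum.inl (t - i)))
    (hg.meas.comp (measurable_pi_lambda _ fun i => measurable_pi_apply _)) (hg.integrable h t)
  have e3 : (fun ω => g (pastReplaced ε ε' t m ω)) =
      fun ω => g fun i : ℕ => Sum.elim ε ε' (r (Sum.inl (t - i))) ω := by
    funext ω; congr 1; funext i; exact hr ω i
  rw [Function.comp_def, e3]
  exact e2

/-- By `condExp_pastReplaced` the difference is the conditional expectation of `g (past ε t) - g
(pastReplaced ε ε' t m)`, and conditioning contracts the L₄ norm. -/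
theorem GeomDep.lpBdd_appr_succ_sub (hg : GeomDep P ε ε' ρ C g) (t : ℤ) (m : ℕ) :
    LpBdd P 4 (fun ω => appr P ε ε' g t (m + 1) ω - appr P ε ε' g t m ω) (C * ρ ^ m) := by
  have h1 := (hg.dep t m).memLp.integrable (by norm_num)
  have hint : Integrable (fun ω => g (pastReplaced ε ε' t m ω)) P := by
    refine ((hg.integrable h t).sub h1).congr (ae_of_all _ fun ω => ?_)
    simp
  have e := condExp_sub (hg.integrable h t) hint (timeSig ε ε' (Set.Ioc (t - (m + 1 : ℕ)) t))
  have hb : LpBdd P 4 (P[(fun ω => g (past ε t ω)) - fun ω => g (pastReplaced ε ε' t m ω) |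
      timeSig ε ε' (Set.Ioc (t - (m + 1 : ℕ)) t)]) (C * ρ ^ m) :=
    ⟨integrable_condExp.1, (eLpNorm_condExp_le_eLpNorm _ (by norm_num)).trans (hg.dep t m).le⟩
  refine hb.congr ?_
  filter_upwards [e, condExp_pastReplaced h hg t m] with ω h1 h2
  rw [h1, Pi.sub_apply, h2]
  rfl

/-- The martingale difference property in reversed time: of the window of length m + 1 only its last
m times lie after t − m, and the tower property gives the projection on those. -/
theorem condExp_appr_succ_sub (t : ℤ) (m : ℕ) :
    P[fun ω => appr P ε ε' g t (m + 1) ω - appr P ε ε' g t m ω | timeSig ε ε' (Set.Ioi (t - m))]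
      =ᵐ[P] 0 := by
  have i1 : Integrable (appr P ε ε' g t (m + 1)) P := integrable_condExp
  have i0 : Integrable (appr P ε ε' g t m) P := integrable_condExp
  have e := condExp_sub i1 i0 (timeSig ε ε' (Set.Ioi (t - m)))
  have e0 := condExp_of_stronglyMeasurable (μ := P) (h.timeSig_le (Set.Ioi (t - m)))
    ((stronglyMeasurable_appr (P := P) (ε := ε) (ε' := ε') g t m).mono
      (timeSig_mono fun x hx => hx.1)) i0
  have e1 := condExp_sig_inter (P := P) (A' := Sum.inl '' Set.Ioi (t - m)) h.meas h.indep
    (stronglyMeasurable_appr g t (m + 1)) i1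
  rw [← Set.image_inter Sum.inl_injective] at e1
  have hset : Set.Ioc (t - (m + 1 : ℕ)) t ∩ Set.Ioi (t - m) = Set.Ioc (t - m) t := by
    ext x; simp; omega
  rw [hset] at e1
  have e2 := condExp_condExp_of_le (μ := P) (f := fun ω => g (past ε t ω))
    (timeSig_mono (ε := ε) (ε' := ε') (S := Set.Ioc (t - m) t) (S' := Set.Ioc (t - (m + 1 : ℕ)) t)
      fun x hx => ⟨by have := hx.1; push_cast; omega, hx.2⟩) (h.timeSig_le _)
  filter_upwards [e, e1, e2] with ω h0 h1 h2
  have h3 : (P[appr P ε ε' g t (m + 1) | timeSig ε ε' (Set.Ioi (t - m))]) ω =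
      appr P ε ε' g t m ω := h1.trans h2
  refine h0.trans ?_
  rw [Pi.sub_apply, h3, e0]
  simp

theorem appr_zero (t : ℤ) (hg : GeomDep P ε ε' ρ C g) :
    appr P ε ε' g t 0 = fun _ => ∫ ω, g (past ε 0 ω) ∂P := by
  have : timeSig ε ε' (Set.Ioc (t - (0 : ℕ)) t) = ⊥ := by simp [timeSig, sig]
  rw [appr, this, condExp_bot, h.integral_past hg.meas]

theorem tendsto_appr (hg : GeomDep P ε ε' ρ C g) (t : ℤ) :
    ∀ᵐ ω ∂P, Tendsto (fun m => appr P ε ε' g t m ω) atTop (𝓝 (g (past ε t ω))) := by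
  let ℱ : Filtration ℕ mΩ :=
    { seq := fun m => timeSig ε ε' (Set.Ioc (t - m) t)
      mono' := fun i j hij => timeSig_mono fun x hx => ⟨by have := hx.1; omega, hx.2⟩
      le' := fun m => h.timeSig_le _ }
  have hsup : ⨆ m, ℱ m = timeSig ε ε' (Set.Iic t) := by
    have : Set.Iic t = ⋃ m : ℕ, Set.Ioc (t - m) t := by
      ext x
      simp only [Set.mem_Iic, Set.mem_iUnion, Set.mem_Ioc]
      exact ⟨fun hx => ⟨(t - x).toNat + 1, by omega, hx⟩, fun ⟨_, hx⟩ => hx.2⟩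
    rw [this, timeSig, Set.image_iUnion, sig_iUnion]
  refine (hg.integrable h t).tendsto_ae_condExp (ℱ := ℱ) ?_
  rw [hsup]
  exact (hg.meas.comp (measurable_past_timeSig t)).stronglyMeasurable

/-- Sum the geometric series of projection increments from m on; Lévy's upward theorem
(`tendsto_appr`) identifies the limit and the bound passes to it. -/
theorem GeomDep.lpBdd_appr_sub (hg : GeomDep P ε ε' ρ C g) (hρ0 : 0 < ρ) (hρ1 : ρ < 1)
    (hC : 0 ≤ C) (t : ℤ) (m : ℕ) :
    LpBdd P 4 (fun ω => g (past ε t ω) - appr P ε ε' g t m ω) (C * ρ ^ m / (1 - ρ)) := by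
  have hρ' : 0 < 1 - ρ := sub_pos.2 hρ1
  have key : ∀ k : ℕ, LpBdd P 4 (fun ω => appr P ε ε' g t (m + k) ω - appr P ε ε' g t m ω)
      (C * ρ ^ m / (1 - ρ)) := fun k => by
    have hs := LpBdd.sum (P := P) (r := 4) (s := Finset.range k) (by norm_num)
      (fun i _ => hg.lpBdd_appr_succ_sub h t (m + i)) (fun i _ => by positivity)
    have e : (fun ω => ∑ i ∈ Finset.range k,
        (appr P ε ε' g t (m + i + 1) ω - appr P ε ε' g t (m + i) ω)) =
        fun ω => appr P ε ε' g t (m + k) ω - appr P ε ε' g t m ω := by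
      funext ω
      exact Finset.sum_range_sub (fun i => appr P ε ε' g t (m + i) ω) k
    rw [e] at hs
    refine hs.mono ?_
    simp_rw [pow_add, ← mul_assoc]
    rw [← Finset.mul_sum, div_eq_mul_inv, geom_sum_eq hρ1.ne]
    gcongr
    rw [← neg_div_neg_eq, neg_sub, neg_sub, div_eq_mul_inv]
    exact mul_le_of_le_one_left (by positivity) (by have := pow_pos hρ0 k; linarith)
  refine LpBdd.of_tendsto key (((hg.lpBdd h t).aesm).sub integrable_condExp.1) ?_
  filter_upwards [tendsto_appr h hg t] with ω hω
  exact (hω.comp (tendsto_add_atTop_nat m |>.congr fun k => add_comm _ _)).sub_const _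

theorem lpBdd_sum_appr_succ_sub {g : ℕ → (ℕ → ℝ) → ℝ} {b : ℕ} (s : ℤ)
    (hg : ∀ i < b, GeomDep P ε ε' ρ C (g i)) (hρ0 : 0 < ρ) (hC : 0 ≤ C) (m : ℕ) :
    LpBdd P 4 (fun ω => ∑ i ∈ Finset.range b,
      (appr P ε ε' (g i) (s + i) (m + 1) ω - appr P ε ε' (g i) (s + i) m ω))
      (2 * √b * (C * ρ ^ m)) := by
  have hc : 0 ≤ C * ρ ^ m := by positivity
  let D : ℕ → Ω → ℝ := fun i ω =>
    appr P ε ε' (g i) (s + i) (m + 1) ω - appr P ε ε' (g i) (s + i) m ω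
  have hDm : ∀ i : ℕ, StronglyMeasurable[timeSig ε ε' (Set.Ioc (s + i - (m + 1 : ℕ)) (s + i))] (D i) :=
    fun i => (stronglyMeasurable_appr _ _ _).sub ((stronglyMeasurable_appr _ _ _).mono
      (timeSig_mono fun x hx => ⟨by have := hx.1; push_cast; omega, hx.2⟩))
  -- The block is summed from its last term backwards. The increment at time s + i is centred given
  -- the innovations after s + i − m, and all increments at later times of the block are functions
  -- of those.
  have hmain := integral_sum_martingale_diff_pow_four_le (P := P) (N := b)
    (D := fun j => D (b - 1 - j))
    (m := fun j => timeSig ε ε' (Set.Ioi (s + (b - 1 - j : ℕ) - m)))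
    (fun j => h.timeSig_le _) (fun j hj => by
      refine Finset.stronglyMeasurable_fun_sum _ fun i hi => (hDm _).mono (timeSig_mono fun x hx => ?_)
      have h1 := hx.1
      have h2 := Finset.mem_range.1 hi
      simp only [Set.mem_Ioi]
      omega) (fun j hj => condExp_appr_succ_sub h _ _) hc
    (fun j hj => (hg _ (by omega)).lpBdd_appr_succ_sub h _ _) b le_rfl
  have hre : ∀ ω, ∑ j ∈ Finset.range b, D (b - 1 - j) ω = ∑ i ∈ Finset.range b, D i ω :=
    fun ω => Finset.sum_range_reflect (fun i => D i ω) b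
  simp only [hre] at hmain
  refine LpBdd.of_integral_pow_four_le hmain.1 (by positivity) (hmain.2.trans (le_of_eq ?_))
  have : √(b : ℝ) ^ 4 = (b : ℝ) ^ 2 := by
    rw [show (4 : ℕ) = 2 * 2 from rfl, pow_mul, Real.sq_sqrt (Nat.cast_nonneg b)]
  rw [show (2 * √(b : ℝ) * (C * ρ ^ m)) ^ 4 = 16 * √(b : ℝ) ^ 4 * (C * ρ ^ m) ^ 4 by ring, this]

/-- Rosenthal type bound: centred sums of `b` terms have `L₄` norm of order `√b`. -/
theorem lpBdd_sum_sub_integral {g : ℕ → (ℕ → ℝ) → ℝ} {b : ℕ} (s : ℤ)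
    (hg : ∀ i < b, GeomDep P ε ε' ρ C (g i)) (hρ0 : 0 < ρ) (hρ1 : ρ < 1) (hC : 0 ≤ C) :
    LpBdd P 4 (fun ω => ∑ i ∈ Finset.range b,
      (g i (past ε (s + i) ω) - ∫ ω, g i (past ε 0 ω) ∂P)) (2 * √b * (C / (1 - ρ))) := by
  have hρ' : 0 < 1 - ρ := sub_pos.2 hρ1
  -- Cut the projections at M: the remainders cost b C ρ^M / (1 − ρ), and each level m < M costs 2
  -- √b C ρ^m by martingale moments. Letting M → ∞ with b fixed removes the remainders.
  have hM : ∀ M : ℕ, LpBdd P 4 (fun ω => ∑ i ∈ Finset.range b,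
      (g i (past ε (s + i) ω) - ∫ ω, g i (past ε 0 ω) ∂P))
      (b * (C * ρ ^ M / (1 - ρ)) + 2 * √b * (C / (1 - ρ))) := fun M => by
    have h1 := LpBdd.sum (P := P) (r := 4) (s := Finset.range b) (by norm_num)
      (fun i hi => (hg i (Finset.mem_range.1 hi)).lpBdd_appr_sub h hρ0 hρ1 hC (s + i) M)
      (fun i _ => by positivity)
    have h2 := LpBdd.sum (P := P) (r := 4) (s := Finset.range M) (by norm_num)
      (fun m _ => lpBdd_sum_appr_succ_sub h s hg hρ0 hC m) (fun i _ => by positivity)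
    have h12 := h1.add (by norm_num) h2 (Finset.sum_nonneg fun _ _ => by positivity)
      (Finset.sum_nonneg fun _ _ => by positivity)
    refine (h12.congr (ae_of_all _ fun ω => ?_)).mono ?_
    · dsimp only
      rw [Finset.sum_comm, ← Finset.sum_add_distrib]
      refine Finset.sum_congr rfl fun i hi => ?_
      rw [Finset.sum_range_sub (fun m => appr P ε ε' (g i) (s + i) m ω),
        appr_zero h _ (hg i (Finset.mem_range.1 hi))]
      ring
    · rw [Finset.sum_const, Finset.card_range, nsmul_eq_mul, ← Finset.mul_sum, ← Finset.mul_sum,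
        geom_sum_eq hρ1.ne]
      gcongr
      rw [div_eq_mul_inv C]
      gcongr
      rw [← neg_div_neg_eq, neg_sub, neg_sub, div_eq_mul_inv]
      exact mul_le_of_le_one_left (by positivity) (by have := pow_pos hρ0 M; linarith)
  refine LpBdd.of_tendsto_const hM ?_
  have ht := (tendsto_pow_atTop_nhds_zero_of_lt_one hρ0.le hρ1).const_mul (b * C / (1 - ρ))
  rw [mul_zero] at ht
  have := ht.add_const (2 * √b * (C / (1 - ρ)))
  rw [zero_add] at this
  refine this.congr fun M => ?_
  ring

/-- The projection of `g'` on the last k innovations uses times t + 1, …, t + k only, hence is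
independent of the past of t; only the projection error, of order ρ^k, contributes. -/
theorem abs_covariance_past_le {g' : (ℕ → ℝ) → ℝ} {C' : ℝ} (hg : GeomDep P ε ε' ρ C g)
    (hg' : GeomDep P ε ε' ρ C' g') (hρ0 : 0 < ρ) (hρ1 : ρ < 1) (hC : 0 ≤ C) (hC' : 0 ≤ C')
    (t : ℤ) (k : ℕ) :
    |cov[fun ω => g (past ε t ω), fun ω => g' (past ε (t + k) ω); P]| ≤
      2 * (C * (C' / (1 - ρ))) * ρ ^ k := by
  have hρ' : 0 < 1 - ρ := sub_pos.2 hρ1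
  have b1 := (hg.lpBdd h t).exponent_mono (r' := 2) (by norm_num)
  have b2 := (hg'.lpBdd h (t + k)).exponent_mono (r' := 2) (by norm_num)
  have b3 := (hg'.lpBdd_appr_sub h hρ0 hρ1 hC' (t + k) k).exponent_mono (r' := 2) (by norm_num)
  have m4 : MemLp (appr P ε ε' g' (t + k) k) 2 P := by
    refine (b2.memLp.sub b3.memLp).congr_norm integrable_condExp.1 (ae_of_all _ fun ω => ?_)
    simp
  have hind : IndepFun (fun ω => g (past ε t ω)) (appr P ε ε' g' (t + k) k) P := by
    rw [IndepFun_iff_Indep]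
    refine indep_of_indep_of_le (indep_sig h.meas h.indep
      (A := Sum.inl '' Set.Iic t) (A' := Sum.inl '' Set.Ioc (t + k - k) (t + k)) ?_)
      (hg.meas.comp (measurable_past_timeSig t)).comap_le
      (stronglyMeasurable_appr g' (t + k) k).measurable.comap_le
    refine (Set.disjoint_image_iff Sum.inl_injective).2 (Set.disjoint_left.2 fun x hx hx' => ?_)
    have := hx'.1
    have := Set.mem_Iic.1 hx
    omega
  have e := covariance_fun_sub_right b1.memLp b2.memLp m4
  rw [hind.covariance_eq_zero b1.memLp m4, sub_zero] at e
  rw [← e]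
  refine (b1.abs_covariance_le b3 hC (by positivity)).trans (le_of_eq ?_)
  ring

end

end Innovations

/-! ### Blocks of observations -/

section Blocks

variable {Ω : Type*} {ε ε' : ℤ → Ω → ℝ} [mΩ : MeasurableSpace Ω] {P : Measure Ω}

/-- The centred sum of `g i (past ε (s + i))` over a block of length `b` starting at `s`. -/
def blockSum (P : Measure Ω) (ε : ℤ → Ω → ℝ) (g : ℕ → (ℕ → ℝ) → ℝ) (s : ℤ) (b : ℕ) (ω : Ω) : ℝ :=
  ∑ i ∈ Finset.range b, (g i (past ε (s + i) ω) - ∫ ω, g i (past ε 0 ω) ∂P)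

variable [IsProbabilityMeasure P] {ρ C : ℝ} {g g' : ℕ → (ℕ → ℝ) → ℝ} {b : ℕ}

/-- Each index has at most 2m near partners, charged `A` each; all other covariances are charged
`κ`. -/
theorem variance_sum_le {W : ℕ → Ω → ℝ} {S : Finset ℕ} {N m : ℕ} {A κ : ℝ}
    (hW : ∀ t ∈ S, MemLp (W t) 2 P) (hS : S.card ≤ N) (hA : 0 ≤ A) (hκ : 0 ≤ κ)
    (hnear : ∀ t ∈ S, ∀ t' ∈ S, |cov[W t, W t'; P]| ≤ A)
    (hfar : ∀ t ∈ S, ∀ t' ∈ S, t + m ≤ t' → |cov[W t, W t'; P]| ≤ κ) :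
    Var[fun ω => ∑ t ∈ S, W t ω; P] ≤ N * (2 * m * A + N * κ) := by
  rw [variance_fun_sum' hW]
  have key : ∀ t ∈ S, ∑ t' ∈ S, cov[W t, W t'; P] ≤ 2 * m * A + N * κ := fun t ht => by
    have h1 : ∀ t' ∈ S, cov[W t, W t'; P] ≤
        (if t' ∈ Finset.Ico (t - m) (t + m) then A else 0) + κ := by
      intro t' ht'
      split_ifs with hc
      · have := (abs_le.1 (hnear t ht t' ht')).2
        linarith
      · rw [zero_add]
        rw [Finset.mem_Ico] at hc
        by_cases hlt : t + m ≤ t'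
        · exact (abs_le.1 (hfar t ht t' ht' hlt)).2
        · rw [covariance_comm]
          exact (abs_le.1 (hfar t' ht' t ht (by omega))).2
    refine (Finset.sum_le_sum h1).trans ?_
    rw [Finset.sum_add_distrib, Finset.sum_const, nsmul_eq_mul, ← Finset.sum_filter,
      Finset.sum_const, nsmul_eq_mul]
    have hcard : (S.filter fun t' => t' ∈ Finset.Ico (t - m) (t + m)).card ≤ 2 * m := by
      refine (Finset.card_le_card fun x hx => (Finset.mem_filter.1 hx).2).trans ?_
      rw [Nat.card_Ico]
      omega
    gcongr
    exact_mod_cast hcard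
  refine (Finset.sum_le_sum key).trans ?_
  rw [Finset.sum_const, nsmul_eq_mul]
  gcongr

section

variable (h : Innovations P ε ε')

include h

/-- Projecting each term of the later block on its last b innovations gives Z'', which uses times
after s' − b only and so is independent of the earlier block: this is why a gap of 2b is required.
The covariance reduces to that of Z² with (Z' − Z'')(Z' + Z''), and the first factor has size b ρ^b.
-/
theorem abs_covariance_sq_blockSum_le (hρ0 : 0 < ρ) (hρ1 : ρ < 1) (hC : 0 ≤ C)
    (hg : ∀ i < b, GeomDep P ε ε' ρ C (g i)) (hg' : ∀ i < b, GeomDep P ε ε' ρ C (g' i))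
    {s s' : ℤ} (hs : s + 2 * b ≤ s') :
    |cov[fun ω => blockSum P ε g s b ω ^ 2, fun ω => blockSum P ε g' s' b ω ^ 2; P]| ≤
      40 * (C / (1 - ρ)) ^ 4 * b ^ 3 * ρ ^ b := by
  have hρ' : 0 < 1 - ρ := sub_pos.2 hρ1
  set K := C / (1 - ρ) with hK
  have hK0 : 0 ≤ K := by positivity
  let Z := blockSum P ε g s b
  let Z' := blockSum P ε g' s' b
  let Z'' : Ω → ℝ := fun ω => ∑ i ∈ Finset.range b,
    (appr P ε ε' (g' i) (s' + i) b ω - ∫ ω, g' i (past ε 0 ω) ∂P)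
  have bZ : LpBdd P 4 Z (2 * √b * K) := lpBdd_sum_sub_integral h s hg hρ0 hρ1 hC
  have bZ' : LpBdd P 4 Z' (2 * √b * K) := lpBdd_sum_sub_integral h s' hg' hρ0 hρ1 hC
  have bD : LpBdd P 4 (fun ω => Z' ω - Z'' ω) (b * (K * ρ ^ b)) := by
    have := LpBdd.sum (P := P) (r := 4) (s := Finset.range b) (by norm_num)
      (fun i hi => (hg' i (Finset.mem_range.1 hi)).lpBdd_appr_sub h hρ0 hρ1 hC (s' + i) b)
      (fun i _ => by positivity)
    refine (this.congr (ae_of_all _ fun ω => ?_)).mono (le_of_eq ?_)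
    · simp only [Z', Z'', blockSum, ← Finset.sum_sub_distrib]
      exact Finset.sum_congr rfl fun i _ => by ring
    · rw [Finset.sum_const, Finset.card_range, nsmul_eq_mul, hK]; ring
  -- Write Z' + Z'' = 2Z' − (Z' − Z'') and bound √b and bρ^b by b. The loss is harmless next to the
  -- factor ρ^b of the other term.
  have bS : LpBdd P 4 (fun ω => Z' ω + Z'' ω) (5 * b * K) := by
    have h1 := (bZ'.add (by norm_num) bZ' (by positivity) (by positivity)).sub (by norm_num) bD
      (by positivity) (by positivity)
    refine (h1.congr (ae_of_all _ fun ω => by ring)).mono ?_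
    have h2 : √(b : ℝ) ≤ b := by
      rcases Nat.eq_zero_or_pos b with hb | hb
      · simp [hb]
      · exact Real.sqrt_le_iff.2 ⟨by positivity, by
          have : (1 : ℝ) ≤ b := by exact_mod_cast hb
          nlinarith⟩
    have h3 : ρ ^ b ≤ 1 := pow_le_one₀ hρ0.le hρ1.le
    have h4 : (b : ℝ) * (K * ρ ^ b) ≤ b * (K * 1) := by gcongr
    have h5 : √(b : ℝ) * K ≤ b * K := by gcongr
    linarith
  have mZ'' : MemLp Z'' 4 P := (bZ'.memLp.sub bD.memLp).ae_eq (ae_of_all _ fun ω => by simp)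
  have e1 : MemLp (fun ω => Z ω ^ 2) 2 P :=
    ((bZ.mul_four bZ (by positivity)).congr (ae_of_all _ fun ω => (pow_two _).symm)).memLp
  have e2 : MemLp (fun ω => Z' ω ^ 2) 2 P :=
    ((bZ'.mul_four bZ' (by positivity)).congr (ae_of_all _ fun ω => (pow_two _).symm)).memLp
  have bP : LpBdd P 2 (fun ω => Z' ω ^ 2 - Z'' ω ^ 2) (b * (K * ρ ^ b) * (5 * b * K)) :=
    (bD.mul_four bS (by positivity)).congr (ae_of_all _ fun ω => by ring)
  have e3 : MemLp (fun ω => Z'' ω ^ 2) 2 P :=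
    (e2.sub bP.memLp).ae_eq (ae_of_all _ fun ω => by simp)
  have hmZ : Measurable[timeSig ε ε' (Set.Iic (s + b))] Z := by
    refine Finset.measurable_fun_sum _ fun i hi => Measurable.sub_const ?_ _
    refine ((hg i (Finset.mem_range.1 hi)).meas.comp (measurable_past_timeSig (s + i))).mono
      (timeSig_mono fun x hx => ?_) le_rfl
    have := Finset.mem_range.1 hi
    have := Set.mem_Iic.1 hx
    exact Set.mem_Iic.2 (by omega)
  have hmZ'' : Measurable[timeSig ε ε' (Set.Ioi (s' - b))] Z'' := by
    refine Finset.measurable_fun_sum _ fun i hi => Measurable.sub_const ?_ _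
    refine (stronglyMeasurable_appr (g' i) (s' + i) b).measurable.mono
      (timeSig_mono fun x hx => ?_) le_rfl
    have := Finset.mem_range.1 hi
    have := hx.1
    exact Set.mem_Ioi.2 (by omega)
  have hind : IndepFun (fun ω => Z ω ^ 2) (fun ω => Z'' ω ^ 2) P := by
    rw [IndepFun_iff_Indep]
    refine indep_of_indep_of_le (indep_sig h.meas h.indep
      (A := Sum.inl '' Set.Iic (s + b)) (A' := Sum.inl '' Set.Ioi (s' - b)) ?_)
      (hmZ.pow_const 2).comap_le (hmZ''.pow_const 2).comap_le
    refine (Set.disjoint_image_iff Sum.inl_injective).2 (Set.disjoint_left.2 fun x hx hx' => ?_)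
    have := Set.mem_Iic.1 hx
    have := Set.mem_Ioi.1 hx'
    omega
  have e := covariance_fun_sub_right e1 e2 e3
  rw [hind.covariance_eq_zero e1 e3, sub_zero] at e
  change |cov[fun ω => Z ω ^ 2, fun ω => Z' ω ^ 2; P]| ≤ _
  rw [← e]
  have bZ2 : LpBdd P 2 (fun ω => Z ω ^ 2) (4 * b * K ^ 2) :=
    ((bZ.mul_four bZ (by positivity)).congr (ae_of_all _ fun ω => (pow_two _).symm)).mono
      (le_of_eq (by
        rw [show 2 * √(b : ℝ) * K * (2 * √(b : ℝ) * K) = 4 * (√(b : ℝ) * √(b : ℝ)) * K ^ 2 by ring,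
          Real.mul_self_sqrt (Nat.cast_nonneg b)]))
  refine (bZ2.abs_covariance_le bP (by positivity) (by positivity)).trans (le_of_eq ?_)
  ring

theorem lpBdd_sq_blockSum (hρ0 : 0 < ρ) (hρ1 : ρ < 1) (hC : 0 ≤ C)
    (hg : ∀ i < b, GeomDep P ε ε' ρ C (g i)) (s : ℤ) :
    LpBdd P 2 (fun ω => 1 / (b : ℝ) * blockSum P ε g s b ω ^ 2) (4 * (C / (1 - ρ)) ^ 2) := by
  have hρ' : 0 < 1 - ρ := sub_pos.2 hρ1
  have bZ := lpBdd_sum_sub_integral h s hg hρ0 hρ1 hC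
  have := ((bZ.mul_four bZ (by positivity)).congr
    (ae_of_all _ fun ω => (pow_two _).symm)).const_mul (1 / (b : ℝ))
  refine this.mono ?_
  rw [abs_of_nonneg (by positivity), show 2 * √(b : ℝ) * (C / (1 - ρ)) * (2 * √(b : ℝ) * (C / (1 - ρ)))
    = 4 * (√(b : ℝ) * √(b : ℝ)) * (C / (1 - ρ)) ^ 2 by ring, Real.mul_self_sqrt (Nat.cast_nonneg b)]
  rcases Nat.eq_zero_or_pos b with rfl | hb
  · simp; positivity
  · have : (0 : ℝ) < b := by exact_mod_cast hb
    apply le_of_eq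
    field_simp

/-- With near range 2b and second moments of order one, the near pairs contribute O(N b) and the far
pairs O(N² b ρ^b). Dividing by N² leaves b/N + b ρ^b, which vanishes. -/
theorem variance_sum_sq_blockSum_le {G : ℕ → ℕ → (ℕ → ℝ) → ℝ} {S : Finset ℕ} {N : ℕ}
    (hρ0 : 0 < ρ) (hρ1 : ρ < 1) (hC : 0 ≤ C)
    (hg : ∀ t ∈ S, ∀ i < b, GeomDep P ε ε' ρ C (G t i)) (hS : S.card ≤ N) (hb : 0 < b) :
    Var[fun ω => ∑ t ∈ S, 1 / (b : ℝ) * blockSum P ε (G t) (t + 1) b ω ^ 2; P] ≤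
      N * (128 * (C / (1 - ρ)) ^ 4 * b + N * (40 * (C / (1 - ρ)) ^ 4 * (b * ρ ^ b))) := by
  have hρ' : 0 < 1 - ρ := sub_pos.2 hρ1
  have hb' : (0 : ℝ) < b := by exact_mod_cast hb
  refine (variance_sum_le (m := 2 * b) (A := 32 * (C / (1 - ρ)) ^ 4)
    (κ := 40 * (C / (1 - ρ)) ^ 4 * (b * ρ ^ b))
    (fun t ht => (lpBdd_sq_blockSum h hρ0 hρ1 hC (hg t ht) (t + 1)).memLp) hS (by positivity)
    (by positivity) (fun t ht t' ht' => ?_) fun t ht t' ht' htt => ?_).trans (le_of_eq ?_)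
  · refine ((lpBdd_sq_blockSum h hρ0 hρ1 hC (hg t ht) (t + 1)).abs_covariance_le
      (lpBdd_sq_blockSum h hρ0 hρ1 hC (hg t' ht') (t' + 1)) (by positivity)
      (by positivity)).trans (le_of_eq (by ring))
  · rw [covariance_const_mul_left, covariance_const_mul_right, ← mul_assoc, abs_mul,
      abs_of_nonneg (by positivity)]
    have := abs_covariance_sq_blockSum_le h hρ0 hρ1 hC (hg t ht) (hg t' ht')
      (s := t + 1) (s' := t' + 1) (by omega)
    refine (mul_le_mul_of_nonneg_left this (by positivity)).trans (le_of_eq ?_)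
    field_simp
  · push_cast; ring

/-- Law of large numbers for the squared blocks. -/
theorem tendsto_measure_sum_sq_blockSum {G : ℕ → ℕ → ℕ → (ℕ → ℝ) → ℝ} {S : ℕ → Finset ℕ}
    {b : ℕ → ℕ} (hρ0 : 0 < ρ) (hρ1 : ρ < 1) (hC : 0 ≤ C)
    (hg : ∀ᶠ n in atTop, ∀ t ∈ S n, ∀ i < b n, GeomDep P ε ε' ρ C (G n t i))
    (hS : ∀ n, (S n).card ≤ n) (hb : Tendsto b atTop atTop)
    (hbn : Tendsto (fun n => (b n : ℝ) / n) atTop (𝓝 0)) {η : ℝ} (hη : 0 < η) :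
    Tendsto (fun n : ℕ => P {ω | η ≤ |1 / (n : ℝ) *
        ∑ t ∈ S n, 1 / (b n : ℝ) * blockSum P ε (G n t) (t + 1) (b n) ω ^ 2 -
      1 / (n : ℝ) * ∑ t ∈ S n, ∫ ω, 1 / (b n : ℝ) * blockSum P ε (G n t) (t + 1) (b n) ω ^ 2 ∂P|})
      atTop (𝓝 0) := by
  set K := C / (1 - ρ)
  -- The Chebyshev bound: the variance of the average over η².
  have hlim : Tendsto (fun n => ENNReal.ofReal
      ((128 * K ^ 4 * ((b n : ℝ) / n) + 40 * K ^ 4 * (b n * ρ ^ b n)) / η ^ 2)) atTop (𝓝 0) := by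
    have h1 : Tendsto (fun n => (b n : ℝ) * ρ ^ b n) atTop (𝓝 0) :=
      (tendsto_self_mul_const_pow_of_lt_one hρ0.le hρ1).comp hb
    have := (((hbn.const_mul (128 * K ^ 4)).add (h1.const_mul (40 * K ^ 4))).div_const (η ^ 2))
    simp only [mul_zero, add_zero, zero_div] at this
    simpa [Function.comp_def] using (ENNReal.continuous_ofReal.tendsto _).comp this
  refine tendsto_of_tendsto_of_tendsto_of_le_of_le' tendsto_const_nhds hlim
    (Eventually.of_forall fun n => zero_le) ?_
  filter_upwards [hg, hb.eventually_gt_atTop 0, eventually_gt_atTop 0] with n hgn hbn hn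
  have hn' : (0 : ℝ) < n := by exact_mod_cast hn
  have hm : ∀ t ∈ S n, MemLp (fun ω => 1 / (b n : ℝ) * blockSum P ε (G n t) (t + 1) (b n) ω ^ 2) 2 P :=
    fun t ht => (lpBdd_sq_blockSum h hρ0 hρ1 hC (hgn t ht) (t + 1)).memLp
  have hms : MemLp (fun ω => ∑ t ∈ S n, 1 / (b n : ℝ) * blockSum P ε (G n t) (t + 1) (b n) ω ^ 2)
      2 P := memLp_finsetSum _ hm
  have hch := meas_ge_le_variance_div_sq (hms.const_mul (1 / (n : ℝ))) hη
  rw [integral_const_mul, integral_finsetSum _ fun t ht => (hm t ht).integrable (by norm_num),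
    variance_const_mul] at hch
  refine hch.trans (ENNReal.ofReal_le_ofReal ?_)
  gcongr
  have hv := variance_sum_sq_blockSum_le h hρ0 hρ1 hC hgn (hS n) hbn
  change _ ≤ n * (128 * K ^ 4 * b n + n * (40 * K ^ 4 * (b n * ρ ^ b n))) at hv
  refine (mul_le_mul_of_nonneg_left hv (by positivity)).trans (le_of_eq ?_)
  field_simp

end

end Blocks

/-! ### Convergence of the block variances -/

section BlockVariance

variable {Ω : Type*} {ε ε' : ℤ → Ω → ℝ} [mΩ : MeasurableSpace Ω] {P : Measure Ω}
  [IsProbabilityMeasure P] {ρ C : ℝ}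

theorem LpBdd.abs_covariance_sub_le {X X' Y Y' : Ω → ℝ} {r r' c c' : ℝ}
    (hX : LpBdd P 2 (fun ω => X ω - X' ω) r) (hY : LpBdd P 2 (fun ω => Y ω - Y' ω) r')
    (hYc : LpBdd P 2 Y c) (hXc : LpBdd P 2 X' c') (hr : 0 ≤ r) (hr' : 0 ≤ r') (hc : 0 ≤ c)
    (hc' : 0 ≤ c') : |cov[X, Y; P] - cov[X', Y'; P]| ≤ 2 * (r * c) + 2 * (c' * r') := by
  have mX : MemLp X 2 P := (hX.memLp.add hXc.memLp).ae_eq (ae_of_all _ fun ω => by simp)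
  have mY' : MemLp Y' 2 P := (hYc.memLp.sub hY.memLp).ae_eq (ae_of_all _ fun ω => by simp)
  have e1 := covariance_fun_sub_left mX hXc.memLp hYc.memLp
  have e2 := covariance_fun_sub_right hXc.memLp hYc.memLp mY'
  have b1 := hX.abs_covariance_le hYc hr hc
  have b2 := hXc.abs_covariance_le hY hc' hr'
  calc |cov[X, Y; P] - cov[X', Y'; P]|
      = |cov[fun ω => X ω - X' ω, Y; P] + cov[X', fun ω => Y ω - Y' ω; P]| := by
        rw [e1, e2]; congr 1; ring
    _ ≤ _ := (abs_add_le _ _).trans (add_le_add b1 b2)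

theorem summable_pow_natAbs (hρ0 : 0 < ρ) (hρ1 : ρ < 1) :
    Summable fun h : ℤ => ρ ^ h.natAbs := by
  refine Summable.of_nat_of_neg ?_ ?_ <;> simpa using summable_geometric_of_lt_one hρ0.le hρ1

/-- Reindexing by the lag j − i gives a sum over all of ℤ whatever the block length, the form needed
for dominated convergence. -/
theorem sum_range_eq_tsum_int (F : ℕ → ℝ) (b : ℕ) (i : ℕ) :
    ∑ k ∈ Finset.range b, F k =
      ∑' h : ℤ, if 0 ≤ (i : ℤ) + h ∧ (i : ℤ) + h < b then F ((i : ℤ) + h).toNat else 0 := by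
  have e := (Equiv.addLeft (i : ℤ)).tsum_eq fun k : ℤ =>
    if 0 ≤ k ∧ k < b then F k.toNat else 0
  simp only [Equiv.coe_addLeft] at e
  refine Eq.trans ?_ (e.symm.trans (tsum_congr fun k => by congr))
  rw [← (Nat.cast_injective (R := ℤ)).tsum_eq, tsum_eq_sum (s := Finset.range b)]
  · refine Finset.sum_congr rfl fun k hk => ?_
    have := Finset.mem_range.1 hk
    rw [if_pos ⟨by omega, by omega⟩, Int.toNat_natCast]
  · intro k hk
    rw [if_neg]
    rintro ⟨_, h2⟩
    exact hk (Finset.mem_range.2 (by omega))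
  · intro k hk
    simp only [Function.mem_support, ne_eq, ite_eq_right_iff, Classical.not_imp] at hk
    exact ⟨k.toNat, by simpa using hk.1.1⟩

section

variable (h : Innovations P ε ε')

include h

theorem abs_covariance_past_int_le {g g' : (ℕ → ℝ) → ℝ} (hg : GeomDep P ε ε' ρ C g)
    (hg' : GeomDep P ε ε' ρ C g') (hρ0 : 0 < ρ) (hρ1 : ρ < 1) (hC : 0 ≤ C) (t k : ℤ) :
    |cov[fun ω => g (past ε t ω), fun ω => g' (past ε (t + k) ω); P]| ≤
      2 * (C * (C / (1 - ρ))) * ρ ^ k.natAbs := by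
  rcases le_total 0 k with hk | hk
  · have := abs_covariance_past_le h hg hg' hρ0 hρ1 hC hC t k.natAbs
    rwa [Int.natAbs_of_nonneg hk] at this
  · have := abs_covariance_past_le h hg' hg hρ0 hρ1 hC hC (t + k) k.natAbs
    rwa [Int.ofNat_natAbs_of_nonpos hk, add_neg_cancel_right, covariance_comm] at this

/-- The dependence condition bears on the approximating kernels, not on their limit. The covariance
decay passes to the limit through L₂ convergence. -/
theorem abs_covariance_past_limit_le {γ γ' : ℕ → (ℕ → ℝ) → ℝ} {g g' : (ℕ → ℝ) → ℝ}
    (hγ : ∀ᶠ n in atTop, GeomDep P ε ε' ρ C (γ n)) (hγ' : ∀ᶠ n in atTop, GeomDep P ε ε' ρ C (γ' n))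
    (hρ0 : 0 < ρ) (hρ1 : ρ < 1) (hC : 0 ≤ C) (hgm' : Measurable g')
    {C' : ℝ} (hC' : 0 ≤ C') (hg : LpBdd P 2 (fun ω => g (past ε 0 ω)) C') {r : ℕ → ℝ}
    (hr : Tendsto r atTop (𝓝 0)) (hr0 : ∀ n, 0 ≤ r n)
    (hgr : ∀ᶠ n in atTop, LpBdd P 2 (fun ω => γ n (past ε 0 ω) - g (past ε 0 ω)) (r n))
    (hgr' : ∀ᶠ n in atTop, LpBdd P 2 (fun ω => γ' n (past ε 0 ω) - g' (past ε 0 ω)) (r n)) (k : ℤ) :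
    |cov[fun ω => g (past ε 0 ω), fun ω => g' (past ε k ω); P]| ≤
      2 * (C * (C / (1 - ρ))) * ρ ^ k.natAbs := by
  have hlim : Tendsto (fun n => 2 * (C * (C / (1 - ρ))) * ρ ^ k.natAbs +
      (2 * (r n * C) + 2 * (C' * r n))) atTop (𝓝 (2 * (C * (C / (1 - ρ))) * ρ ^ k.natAbs)) := by
    have := ((hr.mul_const C).const_mul 2).add ((hr.const_mul C').const_mul 2)
    simpa using this.const_add (2 * (C * (C / (1 - ρ))) * ρ ^ k.natAbs)
  refine ge_of_tendsto hlim ?_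
  filter_upwards [hγ, hγ', hgr, hgr'] with n h1 h2 h3 h4
  have b1 := abs_covariance_past_int_le h h1 h2 hρ0 hρ1 hC 0 k
  rw [zero_add] at b1
  have b2 := h3.abs_covariance_sub_le (h.lpBdd_past (h2.meas.sub hgm') h4 k)
    ((h2.lpBdd h k).exponent_mono (by norm_num)) hg (hr0 n) (hr0 n) hC hC'
  have := abs_sub_abs_le_abs_sub (cov[fun ω => g (past ε 0 ω), fun ω => g' (past ε k ω); P])
    (cov[fun ω => γ n (past ε 0 ω), fun ω => γ' n (past ε k ω); P])
  rw [abs_sub_comm] at this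
  linarith

/-- The variance of a block sum is the double sum of covariances; it is grouped by lag, and
stationarity moves each pair of times to 0 and k. -/
theorem integral_sq_blockSum {g : ℕ → (ℕ → ℝ) → ℝ} {b : ℕ} (s : ℤ)
    (hg : ∀ i < b, GeomDep P ε ε' ρ C (g i)) :
    ∫ ω, 1 / (b : ℝ) * blockSum P ε g s b ω ^ 2 ∂P =
      ∑' k : ℤ, 1 / (b : ℝ) * ∑ i ∈ Finset.range b,
        if 0 ≤ (i : ℤ) + k ∧ (i : ℤ) + k < b then
          cov[fun ω => g i (past ε 0 ω), fun ω => g ((i : ℤ) + k).toNat (past ε k ω); P] else 0 := by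
  rw [integral_const_mul, tsum_mul_left]
  congr 1
  have hm : ∀ i ∈ Finset.range b, MemLp (fun ω => g i (past ε (s + i) ω)) 2 P := fun i hi =>
    (((hg i (Finset.mem_range.1 hi)).lpBdd h (s + i)).exponent_mono (by norm_num)).memLp
  have hv : ∫ ω, blockSum P ε g s b ω ^ 2 ∂P =
      Var[fun ω => ∑ i ∈ Finset.range b, g i (past ε (s + i) ω); P] := by
    rw [variance_eq_integral (memLp_finsetSum _ hm).aestronglyMeasurable.aemeasurable]
    congr with ω
    rw [integral_finsetSum _ fun i hi => (hm i hi).integrable (by norm_num)]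
    rw [blockSum, Finset.sum_sub_distrib]
    congr 2
    exact Finset.sum_congr rfl fun i hi =>
      (h.integral_past (hg i (Finset.mem_range.1 hi)).meas _).symm
  rw [hv, variance_fun_sum' hm, Summable.tsum_finsetSum]
  · refine Finset.sum_congr rfl fun i hi => ?_
    rw [sum_range_eq_tsum_int (fun k => cov[fun ω => g i (past ε (s + i) ω),
      fun ω => g k (past ε (s + k) ω); P]) b i]
    refine tsum_congr fun k => ?_
    split_ifs with hk
    · rw [← h.covariance_past (hg i (Finset.mem_range.1 hi)).meas (hg _ (by omega)).meas (s + i) k,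
        Int.toNat_of_nonneg hk.1, add_assoc]
    · rfl
  · intro i hi
    refine summable_of_hasFiniteSupport ((Set.finite_Icc (-(b : ℤ)) b).subset fun k hk => ?_)
    simp only [Function.mem_support, ne_eq, ite_eq_right_iff, Classical.not_imp] at hk
    have := Finset.mem_range.1 hi
    exact ⟨by omega, by omega⟩

/-- The block variances converge to the long-run variance of the limiting kernel. -/
theorem tendsto_integral_sq_blockSum {γ : ℕ → ℕ → (ℕ → ℝ) → ℝ} {g : (ℕ → ℝ) → ℝ} {b : ℕ → ℕ}
    (s : ℕ → ℤ) (hγ : ∀ᶠ n in atTop, ∀ i < b n, GeomDep P ε ε' ρ C (γ n i))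
    (hρ0 : 0 < ρ) (hρ1 : ρ < 1) (hC : 0 ≤ C) (hb : Tendsto b atTop atTop) (hgm : Measurable g)
    {C' : ℝ} (hC' : 0 ≤ C') (hg : LpBdd P 2 (fun ω => g (past ε 0 ω)) C') {r : ℕ → ℝ}
    (hr : Tendsto r atTop (𝓝 0)) (hr0 : ∀ n, 0 ≤ r n)
    (hgr : ∀ᶠ n in atTop, ∀ i < b n,
      LpBdd P 2 (fun ω => γ n i (past ε 0 ω) - g (past ε 0 ω)) (r n)) :
    Tendsto (fun n => ∫ ω, 1 / (b n : ℝ) * blockSum P ε (γ n) (s n) (b n) ω ^ 2 ∂P) atTop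
      (𝓝 (∑' k : ℤ, cov[fun ω => g (past ε 0 ω), fun ω => g (past ε k ω); P])) := by
  have hρ' : 0 < 1 - ρ := sub_pos.2 hρ1
  have hF : Tendsto (fun n => ∑' k : ℤ, 1 / (b n : ℝ) * ∑ i ∈ Finset.range (b n),
      if 0 ≤ (i : ℤ) + k ∧ (i : ℤ) + k < b n then cov[fun ω => γ n i (past ε 0 ω),
        fun ω => γ n ((i : ℤ) + k).toNat (past ε k ω); P] else 0) atTop
      (𝓝 (∑' k : ℤ, cov[fun ω => g (past ε 0 ω), fun ω => g (past ε k ω); P])) := by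
    refine tendsto_tsum_of_dominated_convergence
      ((summable_pow_natAbs hρ0 hρ1).mul_left (2 * (C * (C / (1 - ρ))))) (fun k => ?_) ?_
    · set c := cov[fun ω => g (past ε 0 ω), fun ω => g (past ε k ω); P]
      -- For fixed lag k the average over i differs from the limiting covariance by the kernel
      -- error, plus |k||c|/b from the at most |k| positions whose partner i + k lies outside the
      -- block.
      have hlim : Tendsto (fun n => (2 * (r n * C) + 2 * (C' * r n)) + k.natAbs * |c| / b n) atTop
          (𝓝 0) := by
        have h1 := ((hr.mul_const C).const_mul 2).add ((hr.const_mul C').const_mul 2)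
        have h2 := (tendsto_natCast_atTop_atTop (R := ℝ)).comp hb
        have h3 := h1.add (h2.const_div_atTop (k.natAbs * |c|))
        simpa [Function.comp_def] using h3
      rw [tendsto_iff_dist_tendsto_zero]
      refine tendsto_of_tendsto_of_tendsto_of_le_of_le' tendsto_const_nhds hlim
        (Eventually.of_forall fun n => dist_nonneg) ?_
      filter_upwards [hγ, hgr, hb.eventually_gt_atTop 0] with n h1 h2 hbn
      have hbn' : (0 : ℝ) < b n := by exact_mod_cast hbn
      set e := 2 * (r n * C) + 2 * (C' * r n)
      have he : 0 ≤ e := by have := hr0 n; positivity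
      have hterm : ∀ i ∈ Finset.range (b n),
          |(if 0 ≤ (i : ℤ) + k ∧ (i : ℤ) + k < b n then cov[fun ω => γ n i (past ε 0 ω),
            fun ω => γ n ((i : ℤ) + k).toNat (past ε k ω); P] else 0) - c| ≤
          e + if ¬(0 ≤ (i : ℤ) + k ∧ (i : ℤ) + k < b n) then |c| else 0 := by
        intro i hi
        by_cases hk : 0 ≤ (i : ℤ) + k ∧ (i : ℤ) + k < b n
        · rw [if_pos hk, if_neg (not_not.2 hk), add_zero]
          have hi' := Finset.mem_range.1 hi
          have hj : ((i : ℤ) + k).toNat < b n := by omega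
          have hs := h.lpBdd_past ((h1 _ hj).meas.sub hgm) (h2 _ hj) k
          exact (h2 i hi').abs_covariance_sub_le hs
            (((h1 _ hj).lpBdd h k).exponent_mono (by norm_num)) hg (hr0 n) (hr0 n) hC hC'
        · rw [if_neg hk, if_pos hk, zero_sub, abs_neg]
          linarith
      have hcard : ((Finset.range (b n)).filter
          fun i : ℕ => ¬(0 ≤ (i : ℤ) + k ∧ (i : ℤ) + k < b n)).card ≤ k.natAbs := by
        rcases le_total 0 k with hk | hk
        · refine (Finset.card_le_card (t := Finset.Ico (b n - k.natAbs) (b n))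
            fun x hx => ?_).trans ?_
          · rw [Finset.mem_filter, Finset.mem_range] at hx
            rw [Finset.mem_Ico]
            omega
          · rw [Nat.card_Ico]; omega
        · refine (Finset.card_le_card (t := Finset.range k.natAbs)
            fun x hx => ?_).trans (Finset.card_range _).le
          rw [Finset.mem_filter, Finset.mem_range] at hx
          rw [Finset.mem_range]
          omega
      have hsum := (Finset.abs_sum_le_sum_abs _ _).trans (Finset.sum_le_sum hterm)
      have hconst : ∀ x : ℝ, ∑ _i ∈ Finset.range (b n), x = b n * x := fun x => by
        rw [Finset.sum_const, Finset.card_range, nsmul_eq_mul]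
      have hneg : (∑ i ∈ Finset.range (b n),
          if ¬(0 ≤ (i : ℤ) + k ∧ (i : ℤ) + k < b n) then |c| else 0) ≤ k.natAbs * |c| := by
        rw [← Finset.sum_filter, Finset.sum_const, nsmul_eq_mul]
        gcongr
      rw [Finset.sum_sub_distrib, Finset.sum_add_distrib, hconst, hconst] at hsum
      rw [Real.dist_eq]
      calc _ = 1 / (b n : ℝ) * |(∑ i ∈ Finset.range (b n),
          if 0 ≤ (i : ℤ) + k ∧ (i : ℤ) + k < b n then cov[fun ω => γ n i (past ε 0 ω),
            fun ω => γ n ((i : ℤ) + k).toNat (past ε k ω); P] else 0) - b n * c| := by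
            rw [← abs_of_nonneg (show 0 ≤ 1 / (b n : ℝ) by positivity), ← abs_mul, mul_sub,
              abs_of_nonneg (show 0 ≤ 1 / (b n : ℝ) by positivity)]
            congr 2
            field_simp
        _ ≤ 1 / (b n : ℝ) * (b n * e + k.natAbs * |c|) := by
            gcongr
            exact hsum.trans (add_le_add_right hneg _)
        _ = _ := by field_simp
    · filter_upwards [hγ, hb.eventually_gt_atTop 0] with n h1 hbn k
      have hbn' : (0 : ℝ) < b n := by exact_mod_cast hbn
      rw [Real.norm_eq_abs, abs_mul, abs_of_nonneg (by positivity)]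
      have : ∀ i ∈ Finset.range (b n), |if 0 ≤ (i : ℤ) + k ∧ (i : ℤ) + k < b n then
          cov[fun ω => γ n i (past ε 0 ω), fun ω => γ n ((i : ℤ) + k).toNat (past ε k ω); P]
            else 0| ≤ 2 * (C * (C / (1 - ρ))) * ρ ^ k.natAbs := fun i hi => by
        split_ifs with hk
        · have := abs_covariance_past_int_le h (h1 i (Finset.mem_range.1 hi))
            (h1 ((i : ℤ) + k).toNat (by omega)) hρ0 hρ1 hC 0 k
          rwa [zero_add] at this
        · rw [abs_zero]; positivity
      have := (Finset.abs_sum_le_sum_abs _ _).trans (Finset.sum_le_sum this)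
      rw [Finset.sum_const, Finset.card_range, nsmul_eq_mul] at this
      calc _ ≤ 1 / (b n : ℝ) * (b n * (2 * (C * (C / (1 - ρ))) * ρ ^ k.natAbs)) := by gcongr
        _ = _ := by field_simp
  refine hF.congr' ?_
  filter_upwards [hγ] with n hn
  exact (integral_sq_blockSum h (s n) hn).symm

end

end BlockVariance

/-! ### Control of the `p`-variation -/

section Variation

/-- The sum `∑ N(u_{i-1}, u_i)^p` over partitions of `[0, x]`, maximised. -/
def variationUpTo (p : ℝ) (N : ℝ → ℝ → ℝ≥0∞) (x : ℝ) : ℝ≥0∞ :=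
  ⨆ (m : ℕ) (u : Fin (m + 1) → ℝ) (_ : StrictMono u ∧ u 0 = 0 ∧ u (Fin.last m) = x),
    ∑ i : Fin m, N (u i.castSucc) (u i.succ) ^ p

variable {p : ℝ} {N : ℝ → ℝ → ℝ≥0∞} {x y : ℝ}

theorem sum_add_le_variationUpTo (hxy : x < y) {m : ℕ} {u : Fin (m + 1) → ℝ}
    (hu : StrictMono u ∧ u 0 = 0 ∧ u (Fin.last m) = x) :
    ∑ i : Fin m, N (u i.castSucc) (u i.succ) ^ p + N x y ^ p ≤ variationUpTo p N y := by
  let u' : Fin (m + 1 + 1) → ℝ := Fin.snoc u y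
  have h1 : ∀ i : Fin (m + 1), u' i.castSucc = u i := fun i => Fin.snoc_castSucc _ _ _
  have h2 : u' (Fin.last (m + 1)) = y := Fin.snoc_last _ _
  have h3 : ∀ i : Fin m, u' i.castSucc.succ = u i.succ := fun i => by
    rw [← Fin.castSucc_succ, h1]
  have hu' : StrictMono u' ∧ u' 0 = 0 ∧ u' (Fin.last (m + 1)) = y := by
    refine ⟨Fin.strictMono_iff_lt_succ.2 fun i => ?_, ?_, h2⟩
    · induction i using Fin.lastCases with
      | last => rw [h1, hu.2.2, Fin.succ_last, h2]; exact hxy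
      | cast i => rw [h1, h3]; exact hu.1 Fin.castSucc_lt_succ
    · rw [← Fin.castSucc_zero, h1, hu.2.1]
  refine le_trans (le_of_eq ?_) (le_iSup_of_le (m + 1) (le_iSup_of_le u' (le_iSup_of_le hu' le_rfl)))
  rw [Fin.sum_univ_castSucc]
  congr 1
  · exact Finset.sum_congr rfl fun i _ => by rw [h1, h3]
  · rw [h1, hu.2.2, Fin.succ_last, h2]

/-- Superadditivity: appending `y` to any partition of [0, x] gives a partition of [0, y]. -/
theorem variationUpTo_add_le (hx : 0 ≤ x) (hxy : x < y) :
    variationUpTo p N x + N x y ^ p ≤ variationUpTo p N y := by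
  rcases eq_or_ne (variationUpTo p N y) ⊤ with htop | htop
  · rw [htop]; exact le_top
  -- At least one partition of [0, x] must exist for the single term `N x y ^ p` to be bounded,
  -- which makes the truncated subtraction below exact.
  obtain ⟨m, u, hu⟩ : ∃ (m : ℕ) (u : Fin (m + 1) → ℝ),
      StrictMono u ∧ u 0 = 0 ∧ u (Fin.last m) = x := by
    rcases hx.eq_or_lt with rfl | hx
    · exact ⟨0, fun _ => 0, Fin.strictMono_iff_lt_succ.2 fun i => i.elim0, rfl, rfl⟩
    · refine ⟨1, ![0, x], Fin.strictMono_iff_lt_succ.2 fun i => ?_, rfl, rfl⟩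
      fin_cases i
      simpa using hx
  have hc : N x y ^ p ≤ variationUpTo p N y :=
    le_add_self.trans (sum_add_le_variationUpTo hxy hu)
  have : variationUpTo p N x ≤ variationUpTo p N y - N x y ^ p :=
    iSup_le fun m => iSup_le fun u => iSup_le fun hu =>
      ENNReal.le_sub_of_add_le_right (ne_top_of_le_ne_top htop hc) (sum_add_le_variationUpTo hxy hu)
  calc _ ≤ variationUpTo p N y - N x y ^ p + N x y ^ p := by gcongr
    _ = _ := tsub_add_cancel_of_le hc

theorem variationUpTo_one_le (hp : 0 < p) {C : ℝ≥0∞} (h : pVar p N ≤ C) :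
    variationUpTo p N 1 ≤ C ^ p :=
  iSup_le fun m => iSup_le fun u => iSup_le fun hu =>
    (ENNReal.rpow_inv_le_iff hp).1 (by
      rw [← one_div]
      refine le_trans ?_ h
      exact le_iSup_of_le m (le_iSup_of_le u (le_iSup_of_le hu le_rfl)))

/-- A monotone function controlling the increments of a family of finite `p`-variation. -/
theorem exists_monotone_control (hp : 0 < p) {p' : ℝ} (hpp' : p ≤ p') (hN : ∀ x, N x x = 0)
    {C : ℝ≥0} (h : pVar p N ≤ C) :
    ∃ w : ℝ → ℝ, Monotone w ∧ (∀ x, 0 ≤ w x ∧ w x ≤ (C : ℝ) ^ p') ∧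
      ∀ x y, 0 ≤ x → x ≤ y → y ≤ 1 → N x y ≤ ENNReal.ofReal ((w y - w x) ^ (1 / p')) := by
  have hp' : 0 < p' := hp.trans_le hpp'
  have hneg : ∀ x < 0, variationUpTo p N x = 0 := fun x hx => by
    refine le_antisymm (iSup_le fun m => iSup_le fun u => iSup_le fun hu => ?_) zero_le
    have := hu.1.monotone (Fin.zero_le (Fin.last m))
    rw [hu.2.1, hu.2.2] at this
    exact absurd this (not_le.2 hx)
  have hmono : Monotone (variationUpTo p N) := fun x y hxy => by
    rcases lt_or_ge x 0 with hx | hx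
    · rw [hneg x hx]; exact zero_le
    · rcases hxy.eq_or_lt with rfl | hxy
      · rfl
      · exact le_self_add.trans (variationUpTo_add_le hx hxy)
  have h1 := variationUpTo_one_le hp h
  have htop : (C : ℝ≥0∞) ^ p ≠ ⊤ := ENNReal.rpow_ne_top_of_nonneg hp.le ENNReal.coe_ne_top
  have hfin : ∀ x, variationUpTo p N (min x 1) ≤ (C : ℝ≥0∞) ^ p :=
    fun x => (hmono (min_le_right _ _)).trans h1
  have hfin' : ∀ x, variationUpTo p N (min x 1) ≠ ⊤ := fun x => ne_top_of_le_ne_top htop (hfin x)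
  have hC : (C : ℝ) ^ (p' - p) * (C : ℝ) ^ p = (C : ℝ) ^ p' := by
    rw [← Real.rpow_add_of_nonneg C.coe_nonneg (sub_nonneg.2 hpp') hp.le, sub_add_cancel]
  -- Each distance ν is at most C, so ν^p' ≤ C^(p' − p) ν^p: the prefactor raises the exponent from
  -- p to p'. Stopping at `min x 1` makes the control bounded on the whole line.
  refine ⟨fun x => (C : ℝ) ^ (p' - p) * (variationUpTo p N (min x 1)).toReal, fun x y hxy => ?_,
    fun x => ⟨by positivity, ?_⟩, fun x y hx hxy hy => ?_⟩
  · dsimp only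
    gcongr
    exacts [hfin' y, hmono (min_le_min_right 1 hxy)]
  · dsimp only
    rw [← hC]
    gcongr
    have := ENNReal.toReal_mono htop (hfin x)
    rwa [← ENNReal.toReal_rpow, ENNReal.coe_toReal] at this
  · rcases hxy.eq_or_lt with rfl | hxy
    · rw [hN]; exact zero_le
    dsimp only
    rw [min_eq_left hy, min_eq_left (hxy.le.trans hy)]
    have h2 := variationUpTo_add_le (p := p) (N := N) hx hxy
    have h3 := hfin' y
    have h4 := hfin y
    rw [min_eq_left hy] at h3 h4
    have hNt : N x y ^ p ≠ ⊤ := ne_top_of_le_ne_top h3 (le_add_self.trans h2)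
    have hxt : variationUpTo p N x ≠ ⊤ := ne_top_of_le_ne_top h3 (le_self_add.trans h2)
    have hNt' : N x y ≠ ⊤ := fun ht => hNt (by rw [ht, ENNReal.top_rpow_of_pos hp])
    have h5 := ENNReal.toReal_mono h3 h2
    rw [ENNReal.toReal_add hxt hNt, ← ENNReal.toReal_rpow] at h5
    have h6 : N x y ≤ C := by
      have : N x y ^ p ≤ (C : ℝ≥0∞) ^ p := (le_add_self.trans h2).trans h4
      exact (ENNReal.rpow_le_rpow_iff hp).1 this
    have h7 : (N x y).toReal ≤ C := by
      simpa using ENNReal.toReal_mono ENNReal.coe_ne_top h6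
    rw [← ENNReal.ofReal_toReal hNt']
    refine ENNReal.ofReal_le_ofReal ?_
    set ν := (N x y).toReal
    have hν : 0 ≤ ν := ENNReal.toReal_nonneg
    rw [← mul_sub]
    calc ν = (ν ^ p') ^ (1 / p') := by
          rw [← Real.rpow_mul hν, mul_one_div_cancel hp'.ne', Real.rpow_one]
      _ ≤ _ := by
          gcongr
          calc ν ^ p' = ν ^ (p' - p) * ν ^ p := by
                rw [← Real.rpow_add_of_nonneg hν (sub_nonneg.2 hpp') hp.le, sub_add_cancel]
            _ ≤ _ := by
                gcongr
                linarith

/-- After cancellation only the last `h` values minus the first `h` values survive. -/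
theorem sum_range_sub_shift_le {w : ℕ → ℝ} {K : ℝ} (hw : ∀ k, 0 ≤ w k ∧ w k ≤ K) (M h : ℕ) :
    ∑ r ∈ Finset.range M, (w (r + h) - w r) ≤ h * K := by
  have e1 := Finset.sum_range_add w M h
  have e2 := Finset.sum_range_add w h M
  rw [add_comm h M, e1] at e2
  have h1 : ∑ x ∈ Finset.range h, w (M + x) ≤ h * K := by
    refine (Finset.sum_le_sum fun x _ => (hw (M + x)).2).trans ?_
    rw [Finset.sum_const, Finset.card_range, nsmul_eq_mul]
  have h2 : 0 ≤ ∑ x ∈ Finset.range h, w x := Finset.sum_nonneg fun x _ => (hw x).1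
  have h3 : ∑ r ∈ Finset.range M, w (r + h) = ∑ x ∈ Finset.range M, w (h + x) :=
    Finset.sum_congr rfl fun r _ => by rw [add_comm]
  rw [Finset.sum_sub_distrib, h3]
  linarith

end Variation

/-! ### Locally stationary kernels -/

section Kernels

variable {Ω : Type*} {ε ε' : ℤ → Ω → ℝ} [mΩ : MeasurableSpace Ω] {P : Measure Ω} {d : ℕ}
  {ρ C p : ℝ}

/-- Moment bounds, geometric dependence and `p`-variation control of a locally stationary
kernel. -/
structure LocalKernel (P : Measure Ω) (ε ε' : ℤ → Ω → ℝ) (ρ C p : ℝ)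
    (H : ℝ → (ℕ → ℝ) → EuclideanSpace ℝ (Fin d)) : Prop where
  meas : ∀ u, Measurable (H u)
  bdd : ∀ u ∈ Set.Icc (0 : ℝ) 1, LpBdd P 4 (fun ω => H u (past ε 0 ω)) C
  dep : ∀ u ∈ Set.Icc (0 : ℝ) 1, ∀ (t : ℤ) (j : ℕ),
    LpBdd P 4 (fun ω => H u (past ε t ω) - H u (pastReplaced ε ε' t j ω)) (C * ρ ^ j)
  control : ∃ w : ℝ → ℝ, Monotone w ∧ (∀ x, 0 ≤ w x ∧ w x ≤ C ^ p) ∧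
    ∀ x y, 0 ≤ x → x ≤ y → y ≤ 1 →
      LpBdd P 4 (fun ω => H y (past ε 0 ω) - H x (past ε 0 ω)) ((w y - w x) ^ (1 / p))

theorem measurable_pastReplaced (h : Innovations P ε ε') (t : ℤ) (j : ℕ) :
    Measurable (pastReplaced ε ε' t j) := by
  refine measurable_pi_lambda _ fun i => ?_
  by_cases hi : i = j
  · simpa [pastReplaced, hi] using h.meas (Sum.inr (t - j))
  · simpa [pastReplaced, hi] using h.meas (Sum.inl (t - i))

theorem four_le_ofReal {q : ℝ} (hq : 4 < q) : (4 : ℝ≥0∞) ≤ ENNReal.ofReal q := by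
  rw [show (4 : ℝ≥0∞) = ENNReal.ofReal 4 by norm_num]
  exact ENNReal.ofReal_le_ofReal hq.le

variable [IsProbabilityMeasure P]

theorem LpBdd.norm_integral_le {E : Type*} [NormedAddCommGroup E] [NormedSpace ℝ E] {f : Ω → E}
    {r : ℝ≥0∞} {c : ℝ} (hr : 1 ≤ r) (hf : LpBdd P r f c) (hc : 0 ≤ c) : ‖∫ ω, f ω ∂P‖ ≤ c := by
  have := ((hf.exponent_mono hr).norm.integral_abs_le hc).2
  simp only [abs_norm] at this
  exact (norm_integral_le_integral_norm _).trans this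

theorem localKernel_of_bounds (h : Innovations P ε ε')
    {H : ℝ → (ℕ → ℝ) → EuclideanSpace ℝ (Fin d)} (hm : Measurable (Function.uncurry H))
    {q : ℝ} (hq : 4 < q) {C : ℝ≥0} {p' : ℝ} (hp : 0 < p) (hpp' : p ≤ p')
    (hbdd : ∀ u ∈ Set.Icc (0 : ℝ) 1,
      eLpNorm (fun ω => H u (past ε 0 ω)) (ENNReal.ofReal q) P ≤ C)
    (hvar : kernelPVar P ε q p H ≤ C)
    (hdep : ∀ u ∈ Set.Icc (0 : ℝ) 1, ∀ (t : ℤ) (j : ℕ),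
      eLpNorm (fun ω => H u (past ε t ω) - H u (pastReplaced ε ε' t j ω))
        (ENNReal.ofReal q) P ≤ (C : ℝ≥0∞) * ENNReal.ofReal (ρ ^ j)) :
    LocalKernel P ε ε' ρ C p' H := by
  have hmu : ∀ u, Measurable (H u) := fun u => hm.comp measurable_prodMk_left
  have hq4 := four_le_ofReal hq
  have hpast := fun u t => ((hmu u).comp (h.measurable_past t)).aestronglyMeasurable (μ := P)
  refine ⟨hmu, fun u hu => ?_, fun u hu t j => ?_, ?_⟩
  · exact LpBdd.exponent_mono ⟨hpast u 0, by simpa using hbdd u hu⟩ hq4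
  · refine LpBdd.exponent_mono ⟨(hpast u t).sub
      ((hmu u).comp (measurable_pastReplaced h t j)).aestronglyMeasurable, ?_⟩ hq4
    rw [ENNReal.ofReal_mul C.coe_nonneg, ENNReal.ofReal_coe_nnreal]
    exact hdep u hu t j
  · obtain ⟨w, hw, hwC, hN⟩ := exists_monotone_control hp hpp' (fun x => by simp) hvar
    exact ⟨w, hw, hwC, fun x y hx hxy hy =>
      LpBdd.exponent_mono ⟨(hpast y 0).sub (hpast x 0), hN x y hx hxy hy⟩ hq4⟩

omit [IsProbabilityMeasure P] in
-- Converts smallness for every η, uniformly in the index, into one null sequence of bounds: the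
-- supremum of the norms, as a real number.
theorem exists_lpBdd_rate {ι E : Type*} [NormedAddCommGroup E] {f : ℕ → ι → Ω → E}
    {s : ℕ → Set ι} {r : ℝ≥0∞} (h : ∀ η > 0, ∀ᶠ n in atTop, ∀ i ∈ s n, LpBdd P r (f n i) η) :
    ∃ c : ℕ → ℝ, Tendsto c atTop (𝓝 0) ∧ (∀ n, 0 ≤ c n) ∧
      ∀ᶠ n in atTop, ∀ i ∈ s n, LpBdd P r (f n i) (c n) := by
  have hev : ∀ η > 0, ∀ᶠ n in atTop,
      (⨆ i ∈ s n, eLpNorm (f n i) r P) ≤ ENNReal.ofReal η := fun η hη => by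
    filter_upwards [h η hη] with n hn
    exact iSup₂_le fun i hi => (hn i hi).le
  refine ⟨fun n => (⨆ i ∈ s n, eLpNorm (f n i) r P).toReal, ?_, fun n => ENNReal.toReal_nonneg, ?_⟩
  · refine Metric.tendsto_atTop.2 fun η hη => ?_
    obtain ⟨N, hN⟩ := eventually_atTop.1 (hev (η / 2) (by positivity))
    refine ⟨N, fun n hn => ?_⟩
    rw [Real.dist_eq, sub_zero, abs_of_nonneg ENNReal.toReal_nonneg]
    have := ENNReal.toReal_mono ENNReal.ofReal_ne_top (hN n hn)
    rw [ENNReal.toReal_ofReal (by positivity)] at this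
    linarith
  · filter_upwards [h 1 one_pos, hev 1 one_pos] with n h1 h2 i hi
    refine ⟨(h1 i hi).aesm, ?_⟩
    rw [ENNReal.ofReal_toReal (ne_top_of_le_ne_top ENNReal.ofReal_ne_top h2)]
    exact le_iSup₂ (f := fun i (_ : i ∈ s n) => eLpNorm (f n i) r P) i hi

/-- A sequence of locally stationary kernels converging uniformly in `L₄`. -/
structure LocalModel (P : Measure Ω) (ε ε' : ℤ → Ω → ℝ) (ρ C p : ℝ)
    (Gn : ℕ → ℝ → (ℕ → ℝ) → EuclideanSpace ℝ (Fin d))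
    (G : ℝ → (ℕ → ℝ) → EuclideanSpace ℝ (Fin d)) (r : ℕ → ℝ) : Prop where
  innov : Innovations P ε ε'
  kernel : ∀ n, 1 ≤ n → LocalKernel P ε ε' ρ C p (Gn n)
  meas : Measurable (Function.uncurry G)
  rate : Tendsto r atTop (𝓝 0)
  rate_nonneg : ∀ n, 0 ≤ r n
  approx : ∀ᶠ n in atTop, ∀ u ∈ Set.Icc (0 : ℝ) 1,
    LpBdd P 4 (fun ω => Gn n u (past ε 0 ω) - G u (past ε 0 ω)) (r n)
  rho_pos : 0 < ρ
  rho_lt : ρ < 1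
  bound_nonneg : 0 ≤ C
  two_le : 2 ≤ p

/-- From here on only fourth moments are used, and the variation exponent is raised to max(p, 2) so
that squared increments can be handled by a power mean inequality. -/
theorem exists_localModel (h : Innovations P ε ε')
    {Gn : ℕ → ℝ → (ℕ → ℝ) → EuclideanSpace ℝ (Fin d)}
    {G : ℝ → (ℕ → ℝ) → EuclideanSpace ℝ (Fin d)}
    (hGn_meas : ∀ n, Measurable (Function.uncurry (Gn n)))
    (hG_meas : Measurable (Function.uncurry G)) {q : ℝ} (hq : 4 < q) (hp1 : 1 ≤ p)
    (hA1 : Tendsto (fun n : ℕ => ⨆ u ∈ Set.Icc (0 : ℝ) 1,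
        eLpNorm (fun ω => Gn n u (past ε 0 ω) - G u (past ε 0 ω)) (ENNReal.ofReal q) P)
      atTop (𝓝 0))
    {CG : ℝ≥0}
    (hA2 : (⨆ (n : ℕ) (_ : 1 ≤ n), ⨆ u ∈ Set.Icc (0 : ℝ) 1,
          eLpNorm (fun ω => Gn n u (past ε 0 ω)) (ENNReal.ofReal q) P) +
        (⨆ (n : ℕ) (_ : 1 ≤ n), kernelPVar P ε q p (Gn n)) ≤ (CG : ℝ≥0∞))
    (hρ0 : 0 < ρ) (hρ1 : ρ < 1)
    (hA3 : ∀ (n : ℕ), 1 ≤ n → ∀ u ∈ Set.Icc (0 : ℝ) 1, ∀ (t : ℤ) (j : ℕ),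
      eLpNorm (fun ω => Gn n u (past ε t ω) - Gn n u (pastReplaced ε ε' t j ω))
        (ENNReal.ofReal q) P ≤ (CG : ℝ≥0∞) * ENNReal.ofReal (ρ ^ j)) :
    ∃ r, LocalModel P ε ε' ρ CG (max p 2) Gn G r := by
  obtain ⟨r, hr, hr0, hrb⟩ := exists_lpBdd_rate (P := P) (r := 4) (s := fun _ => Set.Icc (0 : ℝ) 1)
    (f := fun n u ω => Gn n u (past ε 0 ω) - G u (past ε 0 ω)) fun η hη => by
      filter_upwards [hA1.eventually_le_const (ENNReal.ofReal_pos.2 hη)] with n hn u hu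
      refine LpBdd.exponent_mono ⟨?_, ?_⟩ (four_le_ofReal hq)
      · exact ((((hGn_meas n).comp measurable_prodMk_left).comp (h.measurable_past 0)).sub
          ((hG_meas.comp measurable_prodMk_left).comp (h.measurable_past 0))).aestronglyMeasurable
      · exact (le_iSup₂ (f := fun u (_ : u ∈ Set.Icc (0 : ℝ) 1) =>
          eLpNorm (fun ω => Gn n u (past ε 0 ω) - G u (past ε 0 ω)) (ENNReal.ofReal q) P)
          u hu).trans hn
  refine ⟨r, h, fun n hn => localKernel_of_bounds h (hGn_meas n) hq (by linarith)
    (le_max_left _ _) (fun u hu => ?_) ?_ (hA3 n hn), hG_meas, hr, hr0, hrb, hρ0, hρ1,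
    CG.coe_nonneg, le_max_right _ _⟩
  · refine le_trans ?_ (le_self_add.trans hA2)
    exact (le_iSup₂ (f := fun u (_ : u ∈ Set.Icc (0 : ℝ) 1) =>
      eLpNorm (fun ω => Gn n u (past ε 0 ω)) (ENNReal.ofReal q) P) u hu).trans
      (le_iSup₂ (f := fun n (_ : 1 ≤ n) => ⨆ u ∈ Set.Icc (0 : ℝ) 1,
        eLpNorm (fun ω => Gn n u (past ε 0 ω)) (ENNReal.ofReal q) P) n hn)
  · refine le_trans ?_ (le_add_self.trans hA2)
    exact le_iSup₂ (f := fun n (_ : 1 ≤ n) => kernelPVar P ε q p (Gn n)) n hn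

omit [IsProbabilityMeasure P] in
theorem LocalKernel.geomDep {H : ℝ → (ℕ → ℝ) → EuclideanSpace ℝ (Fin d)}
    (hH : LocalKernel P ε ε' ρ C p H) {u : ℝ} (hu : u ∈ Set.Icc (0 : ℝ) 1)
    (ℓ : EuclideanSpace ℝ (Fin d) →L[ℝ] ℝ) {K : ℝ} (hℓ : ‖ℓ‖ ≤ K) :
    GeomDep P ε ε' ρ (K * C) (fun x => ℓ (H u x)) := by
  have hK : 0 ≤ K := (norm_nonneg _).trans hℓ
  refine ⟨ℓ.measurable.comp (hH.meas u), ?_, fun t j => ?_⟩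
  · exact (hH.bdd u hu).of_norm_le (ℓ.continuous.comp_aestronglyMeasurable (hH.bdd u hu).aesm) hK
      fun ω => ℓ.le_of_opNorm_le hℓ _
  · rw [mul_assoc]
    refine (hH.dep u hu t j).of_norm_le ?_ hK fun ω => ?_
    · simpa using ℓ.continuous.comp_aestronglyMeasurable (hH.dep u hu t j).aesm
    · rw [← map_sub]
      exact ℓ.le_of_opNorm_le hℓ _

namespace LocalModel

variable {Gn : ℕ → ℝ → (ℕ → ℝ) → EuclideanSpace ℝ (Fin d)}
  {G : ℝ → (ℕ → ℝ) → EuclideanSpace ℝ (Fin d)} {r : ℕ → ℝ}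

section

variable (hm : LocalModel P ε ε' ρ C p Gn G r)

include hm

omit [IsProbabilityMeasure P] in
theorem measurable_limit (u : ℝ) : Measurable (G u) := hm.meas.comp measurable_prodMk_left

theorem lpBdd_limit {u : ℝ} (hu : u ∈ Set.Icc (0 : ℝ) 1) :
    LpBdd P 4 (fun ω => G u (past ε 0 ω)) C := by
  have hlim : Tendsto (fun n => C + r n) atTop (𝓝 C) := by simpa using hm.rate.const_add C
  refine ⟨((hm.measurable_limit u).comp (hm.innov.measurable_past 0)).aestronglyMeasurable,
    ge_of_tendsto ((ENNReal.continuous_ofReal.tendsto _).comp hlim) ?_⟩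
  filter_upwards [hm.approx, eventually_ge_atTop 1] with n h1 h2
  have := ((hm.kernel n h2).bdd u hu).sub (by norm_num) (h1 u hu) hm.bound_nonneg (hm.rate_nonneg n)
  simpa using this.le

theorem norm_localMean_sub_le : ∀ᶠ n in atTop, ∀ u ∈ Set.Icc (0 : ℝ) 1,
    ‖localMean P ε (Gn n) u - localMean P ε G u‖ ≤ r n := by
  filter_upwards [hm.approx, eventually_ge_atTop 1] with n h1 h2 u hu
  rw [localMean, localMean, ← integral_sub
    (((hm.kernel n h2).bdd u hu).memLp.integrable (by norm_num))
    ((hm.lpBdd_limit hu).memLp.integrable (by norm_num))]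
  exact (h1 u hu).norm_integral_le (by norm_num) (hm.rate_nonneg n)

omit [IsProbabilityMeasure P] in
/-- Off a countable set of times, the kernels converge along convergent sequences of times. -/
theorem exists_countable_limit : ∃ D : Set ℝ, D.Countable ∧ ∀ v ∈ Set.Icc (0 : ℝ) 1, v ∉ D →
    ∀ η > 0, ∃ δ > 0, ∀ᶠ n in atTop, ∀ u ∈ Set.Icc (0 : ℝ) 1, |u - v| < δ →
      LpBdd P 4 (fun ω => Gn n u (past ε 0 ω) - G v (past ε 0 ω)) η := by
  have hp : 0 < p := by linarith [hm.two_le]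
  -- Each monotone control has countably many discontinuities; the exceptional set collects those of
  -- all `n`.
  choose! w hw hwC hwb using fun n hn => (hm.kernel n hn).control
  refine ⟨⋃ n ∈ Set.Ici 1, {x | ¬ContinuousAt (w n) x},
    (Set.to_countable _).biUnion fun n hn => (hw n hn).countable_not_continuousAt,
    fun v hv hvD η hη => ?_⟩
  have hsmall := hm.rate.eventually_le_const (show (0 : ℝ) < η / 6 by positivity)
  -- One fixed index `m` transfers continuity at v to all large n, along the chain Gn(u), G(u),
  -- Gm(u), Gm(v), G(v), with steps η/6, η/6, η/3, η/6.
  obtain ⟨m, ⟨hm1, hm2⟩, hm3⟩ := ((hm.approx.and hsmall).and (eventually_ge_atTop 1)).exists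
  have hcont : ContinuousAt (w m) v := by
    by_contra hc
    exact hvD (Set.mem_biUnion (x := m) hm3 hc)
  obtain ⟨δ, hδ, hδw⟩ := Metric.continuousAt_iff.1 hcont ((η / 3) ^ p) (by positivity)
  refine ⟨δ, hδ, ?_⟩
  filter_upwards [hm.approx, hsmall] with n h1 h2 u hu huv
  have hb : LpBdd P 4 (fun ω => Gn m u (past ε 0 ω) - Gn m v (past ε 0 ω)) (η / 3) := by
    have hd := hδw (x := u) (by rwa [Real.dist_eq])
    rw [Real.dist_eq] at hd
    have hroot : ∀ x, 0 ≤ x → x ≤ |w m u - w m v| → x ^ (1 / p) ≤ η / 3 := fun x hx hx' => by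
      calc x ^ (1 / p) ≤ ((η / 3) ^ p) ^ (1 / p) := by gcongr; linarith
        _ = η / 3 := by
          rw [← Real.rpow_mul (by positivity), mul_one_div_cancel hp.ne', Real.rpow_one]
    rcases le_total u v with huv' | huv'
    · have := ((hwb m hm3 u v hu.1 huv' hv.2).mono (hroot _ (sub_nonneg.2 (hw m hm3 huv'))
        (by rw [abs_sub_comm]; exact le_abs_self _))).neg
      simpa using this
    · exact (hwb m hm3 v u hv.1 huv' hu.2).mono (hroot _ (sub_nonneg.2 (hw m hm3 huv'))
        (le_abs_self _))
  have h6 : 0 ≤ η / 6 := by positivity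
  have a1 := ((h1 u hu).mono h2).sub (by norm_num) ((hm1 u hu).mono hm2) h6 h6
  have a2 := hb.add (by norm_num) ((hm1 v hv).mono hm2) (by positivity) h6
  refine ((a1.add (by norm_num) a2 (by positivity) (by positivity)).congr
    (ae_of_all _ fun ω => ?_)).mono (by linarith)
  dsimp only
  abel

end

end LocalModel

end Kernels

/-! ### The long-run variance -/

section LongRun

variable {Ω : Type*} {ε ε' : ℤ → Ω → ℝ} [mΩ : MeasurableSpace Ω] {P : Measure Ω} {d : ℕ}
  {ρ C p : ℝ}

/-- The long-run variance of the stationary sequence `g (past ε t)`. -/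
def longRunVar (P : Measure Ω) (ε : ℤ → Ω → ℝ) (g : (ℕ → ℝ) → ℝ) : ℝ :=
  ∑' k : ℤ, cov[fun ω => g (past ε 0 ω), fun ω => g (past ε k ω); P]

theorem apply_eq_sum (ℓ : EuclideanSpace ℝ (Fin d) →L[ℝ] ℝ) (x : EuclideanSpace ℝ (Fin d)) :
    ℓ x = ∑ i, ℓ (EuclideanSpace.single i 1) * x i := by
  conv_lhs => rw [← (EuclideanSpace.basisFun (Fin d) ℝ).sum_repr x, map_sum]
  refine Finset.sum_congr rfl fun i _ => ?_
  simp [mul_comm]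

variable [IsProbabilityMeasure P]

namespace LocalModel

variable {Gn : ℕ → ℝ → (ℕ → ℝ) → EuclideanSpace ℝ (Fin d)}
  {G : ℝ → (ℕ → ℝ) → EuclideanSpace ℝ (Fin d)} {r : ℕ → ℝ}

section

variable (hm : LocalModel P ε ε' ρ C p Gn G r)

include hm

theorem lpBdd_limit_apply {u : ℝ} (hu : u ∈ Set.Icc (0 : ℝ) 1)
    (ℓ : EuclideanSpace ℝ (Fin d) →L[ℝ] ℝ) {K : ℝ} (hℓ : ‖ℓ‖ ≤ K) :
    LpBdd P 2 (fun ω => ℓ (G u (past ε 0 ω))) (K * C) :=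
  ((hm.lpBdd_limit hu).of_norm_le
    (ℓ.continuous.comp_aestronglyMeasurable (hm.lpBdd_limit hu).aesm)
    ((norm_nonneg _).trans hℓ) fun _ => ℓ.le_of_opNorm_le hℓ _).exponent_mono (by norm_num)

theorem lpBdd_apply_sub (ℓ : EuclideanSpace ℝ (Fin d) →L[ℝ] ℝ) {K : ℝ} (hℓ : ‖ℓ‖ ≤ K) :
    ∀ᶠ n in atTop, ∀ u ∈ Set.Icc (0 : ℝ) 1,
      LpBdd P 2 (fun ω => ℓ (Gn n u (past ε 0 ω)) - ℓ (G u (past ε 0 ω))) (K * r n) := by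
  filter_upwards [hm.approx] with n hn u hu
  refine LpBdd.exponent_mono (r := 4) ?_ (by norm_num)
  refine (hn u hu).of_norm_le ?_ ((norm_nonneg _).trans hℓ) fun ω => ?_
  · simpa using ℓ.continuous.comp_aestronglyMeasurable (hn u hu).aesm
  · rw [← map_sub]
    exact ℓ.le_of_opNorm_le hℓ _

theorem summable_covariance_apply {v : ℝ} (hv : v ∈ Set.Icc (0 : ℝ) 1)
    (ℓ ℓ' : EuclideanSpace ℝ (Fin d) →L[ℝ] ℝ) :
    Summable fun k : ℤ =>
      cov[fun ω => ℓ (G v (past ε 0 ω)), fun ω => ℓ' (G v (past ε k ω)); P] := by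
  set K := max ‖ℓ‖ ‖ℓ'‖
  have hK : 0 ≤ K := (norm_nonneg _).trans (le_max_left _ _)
  have hC := hm.bound_nonneg
  refine Summable.of_norm_bounded ((summable_pow_natAbs hm.rho_pos hm.rho_lt).mul_left
    (2 * (K * C * (K * C / (1 - ρ))))) fun k => ?_
  rw [Real.norm_eq_abs]
  refine abs_covariance_past_limit_le hm.innov (γ := fun n x => ℓ (Gn n v x))
    (γ' := fun n x => ℓ' (Gn n v x)) (g := fun x => ℓ (G v x)) (g' := fun x => ℓ' (G v x))
    (r := fun n => K * r n) ?_ ?_ hm.rho_pos hm.rho_lt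
    (by positivity) (ℓ'.measurable.comp (hm.measurable_limit v)) (by positivity)
    (hm.lpBdd_limit_apply hv ℓ (le_max_left _ _)) (by simpa using hm.rate.const_mul K)
    (fun n => mul_nonneg hK (hm.rate_nonneg n)) ?_ ?_ k
  · filter_upwards [eventually_ge_atTop 1] with n hn
    exact (hm.kernel n hn).geomDep hv ℓ (le_max_left _ _)
  · filter_upwards [eventually_ge_atTop 1] with n hn
    exact (hm.kernel n hn).geomDep hv ℓ' (le_max_right _ _)
  · filter_upwards [hm.lpBdd_apply_sub ℓ (le_max_left _ _)] with n hn using hn v hv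
  · filter_upwards [hm.lpBdd_apply_sub ℓ' (le_max_right _ _)] with n hn using hn v hv

theorem summable_autoCov {v : ℝ} (hv : v ∈ Set.Icc (0 : ℝ) 1) (i j : Fin d) :
    Summable (autoCov P ε G v i j) :=
  hm.summable_covariance_apply hv (EuclideanSpace.proj i) (EuclideanSpace.proj j)

theorem longRunVar_apply {v : ℝ} (hv : v ∈ Set.Icc (0 : ℝ) 1)
    (ℓ : EuclideanSpace ℝ (Fin d) →L[ℝ] ℝ) :
    longRunVar P ε (fun x => ℓ (G v x)) = (fun i => ℓ (EuclideanSpace.single i 1)) ⬝ᵥ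
      (longRunCov P ε G v *ᵥ fun i => ℓ (EuclideanSpace.single i 1)) := by
  have hb : ∀ (k : ℤ) (i : Fin d), MemLp (fun ω => G v (past ε k ω) i) 2 P := fun k i =>
    (hm.innov.lpBdd_past ((EuclideanSpace.proj (𝕜 := ℝ) i).measurable.comp (hm.measurable_limit v))
      (hm.lpBdd_limit_apply hv (EuclideanSpace.proj i) le_rfl) k).memLp
  set a : Fin d → ℝ := fun i => ℓ (EuclideanSpace.single i 1)
  have hcov : ∀ k : ℤ, cov[fun ω => ℓ (G v (past ε 0 ω)), fun ω => ℓ (G v (past ε k ω)); P] =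
      ∑ i, ∑ j, a i * a j * autoCov P ε G v i j k := fun k => by
    rw [funext fun ω => apply_eq_sum ℓ (G v (past ε 0 ω)),
      funext fun ω => apply_eq_sum ℓ (G v (past ε k ω))]
    rw [covariance_fun_sum_fun_sum (fun i => (hb 0 i).const_mul _)
      (fun i => (hb k i).const_mul _)]
    refine Finset.sum_congr rfl fun i _ => Finset.sum_congr rfl fun j _ => ?_
    rw [covariance_const_mul_left, covariance_const_mul_right, autoCov, mul_assoc]
  simp only [longRunVar, hcov]
  have hs := fun i j => (hm.summable_autoCov hv i j).mul_left (a i * a j)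
  rw [Summable.tsum_finsetSum fun i _ => summable_sum fun j _ => hs i j]
  simp only [dotProduct, Matrix.mulVec, longRunCov, Matrix.of_apply, Finset.mul_sum]
  refine Finset.sum_congr rfl fun i _ => ?_
  rw [Summable.tsum_finsetSum fun j _ => hs i j]
  refine Finset.sum_congr rfl fun j _ => ?_
  rw [tsum_mul_left]
  ring

/-- The long-run variance is a limit of normalised second moments of block sums, here with block
length n. -/
theorem longRunVar_apply_nonneg {v : ℝ} (hv : v ∈ Set.Icc (0 : ℝ) 1)
    (ℓ : EuclideanSpace ℝ (Fin d) →L[ℝ] ℝ) : 0 ≤ longRunVar P ε (fun x => ℓ (G v x)) := by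
  have hC := hm.bound_nonneg
  refine ge_of_tendsto' (tendsto_integral_sq_blockSum hm.innov (C := ‖ℓ‖ * C) (γ := fun n _ x => ℓ (Gn n v x))
    (g := fun x => ℓ (G v x)) (b := id) (r := fun n => ‖ℓ‖ * r n) (fun _ => 0) ?_ hm.rho_pos
    hm.rho_lt (by positivity) tendsto_id (ℓ.measurable.comp (hm.measurable_limit v)) (by positivity)
    (hm.lpBdd_limit_apply hv ℓ le_rfl) (by simpa using hm.rate.const_mul ‖ℓ‖)
    (fun n => mul_nonneg (norm_nonneg _) (hm.rate_nonneg n)) ?_)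
    fun n => integral_nonneg fun ω => by positivity
  · filter_upwards [eventually_ge_atTop 1] with n hn i _
    exact (hm.kernel n hn).geomDep hv ℓ le_rfl
  · filter_upwards [hm.lpBdd_apply_sub ℓ le_rfl] with n hn i _ using hn v hv

theorem varDensity_eq (f : EuclideanSpace ℝ (Fin d) → ℝ) {v : ℝ} (hv : v ∈ Set.Icc (0 : ℝ) 1) :
    varDensity P ε G f v =
      longRunVar P ε (fun x => fderiv ℝ f (localMean P ε G v) (G v x)) :=
  (hm.longRunVar_apply hv _).symm

theorem varDensity_nonneg (f : EuclideanSpace ℝ (Fin d) → ℝ) {v : ℝ}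
    (hv : v ∈ Set.Icc (0 : ℝ) 1) : 0 ≤ varDensity P ε G f v := by
  rw [hm.varDensity_eq f hv]
  exact hm.longRunVar_apply_nonneg hv _

end

end LocalModel

/-! ### The gradient near the path of local means -/

/-- The derivative of `f` is bounded by `K` and `K`-Lipschitz on `M`. -/
structure GradBound (f : EuclideanSpace ℝ (Fin d) → ℝ) (M : Set (EuclideanSpace ℝ (Fin d)))
    (K : ℝ) : Prop where
  nonneg : 0 ≤ K
  norm_le : ∀ x ∈ M, ‖fderiv ℝ f x‖ ≤ K
  lipschitz : ∀ x ∈ M, ∀ y ∈ M, ‖fderiv ℝ f x - fderiv ℝ f y‖ ≤ K * ‖x - y‖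

/-- Convexity lets the bound on the second derivative become a Lipschitz bound on the gradient, by
the mean value inequality. -/
theorem convex_meanNhd (μ : ℝ → EuclideanSpace ℝ (Fin d)) (δ : ℝ≥0∞) : Convex ℝ (meanNhd μ δ) := by
  rintro x ⟨x', hx', hx⟩ y ⟨y', hy', hy⟩ a b ha hb hab
  refine ⟨a • x' + b • y', convex_convexHull ℝ _ hx' hy' ha hb hab, ?_⟩
  have h1 : (a • x + b • y) - (a • x' + b • y') = a • (x - x') + b • (y - y') := by module
  have h2 : ‖(a • x + b • y) - (a • x' + b • y')‖ ≤ max ‖x - x'‖ ‖y - y'‖ := by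
    rw [h1]
    have := (convex_closedBall (0 : EuclideanSpace ℝ (Fin d)) (max ‖x - x'‖ ‖y - y'‖))
      (x := x - x') (by simp) (y := y - y') (by simp) ha hb hab
    simpa using this
  rw [edist_dist, dist_eq_norm] at hx hy ⊢
  refine (ENNReal.ofReal_le_ofReal h2).trans_lt ?_
  rcases max_choice ‖x - x'‖ ‖y - y'‖ with h | h <;> rw [h] <;> assumption

theorem mem_meanNhd_of_norm_sub_lt {μ : ℝ → EuclideanSpace ℝ (Fin d)} {δ : ℝ≥0∞} {u : ℝ}
    (hu : u ∈ Set.Icc (0 : ℝ) 1) {x : EuclideanSpace ℝ (Fin d)}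
    (h : ENNReal.ofReal ‖x - μ u‖ < δ) : x ∈ meanNhd μ δ :=
  ⟨μ u, subset_convexHull ℝ _ ⟨u, hu, rfl⟩, by rwa [edist_dist, dist_eq_norm]⟩

theorem gradBound_meanNhd {μ : ℝ → EuclideanSpace ℝ (Fin d)} {δ : ℝ≥0∞} (hδ : 0 < δ)
    {f : EuclideanSpace ℝ (Fin d) → ℝ} {K : ℝ}
    (hf : ∀ x ∈ meanNhd μ δ, DifferentiableAt ℝ f x ∧ DifferentiableAt ℝ (fderiv ℝ f) x ∧
      |f x| + ‖fderiv ℝ f x‖ + ‖fderiv ℝ (fderiv ℝ f) x‖ ≤ K) : GradBound f (meanNhd μ δ) K := by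
  have h0 : μ 0 ∈ meanNhd μ δ := mem_meanNhd_of_norm_sub_lt (u := 0) (by simp) (by simpa)
  have hb : ∀ x ∈ meanNhd μ δ, 0 ≤ K ∧ ‖fderiv ℝ f x‖ ≤ K ∧ ‖fderiv ℝ (fderiv ℝ f) x‖ ≤ K :=
    fun x hx => by
      have h1 := (hf x hx).2.2
      have h2 := abs_nonneg (f x)
      have h3 := norm_nonneg (fderiv ℝ f x)
      have h4 := norm_nonneg (fderiv ℝ (fderiv ℝ f) x)
      exact ⟨by linarith, by linarith, by linarith⟩
  exact ⟨(hb _ h0).1, fun x hx => (hb x hx).2.1, fun x hx y hy =>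
    (convex_meanNhd μ δ).norm_image_sub_le_of_norm_fderiv_le (fun z hz => (hf z hz).2.1)
      (fun z hz => (hb z hz).2.2) hy hx⟩

theorem LocalModel.localMean_mem {Gn : ℕ → ℝ → (ℕ → ℝ) → EuclideanSpace ℝ (Fin d)}
    {G : ℝ → (ℕ → ℝ) → EuclideanSpace ℝ (Fin d)} {r : ℕ → ℝ}
    (hm : LocalModel P ε ε' ρ C p Gn G r) {δ : ℝ≥0∞} (hδ : 0 < δ) :
    ∀ᶠ n in atTop, ∀ u ∈ Set.Icc (0 : ℝ) 1,
      localMean P ε (Gn n) u ∈ meanNhd (localMean P ε G) δ := by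
  have h1 : Tendsto (fun n => ENNReal.ofReal (r n)) atTop (𝓝 0) := by
    simpa [Function.comp_def] using (ENNReal.continuous_ofReal.tendsto _).comp hm.rate
  filter_upwards [hm.norm_localMean_sub_le, h1.eventually_lt_const hδ] with n hn hδn u hu
  exact mem_meanNhd_of_norm_sub_lt hu ((ENNReal.ofReal_le_ofReal (hn u hu)).trans_lt hδn)

end LongRun

/-! ### The limit of the averaged block variances -/

section Average

variable {Ω : Type*} {ε ε' : ℤ → Ω → ℝ} [mΩ : MeasurableSpace Ω] {P : Measure Ω} {d : ℕ}
  {ρ C p : ℝ}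

/-- Averages over t become integrals of step functions of v, so dominated convergence can replace a
Riemann sum argument, which would need regularity of the limiting density. -/
theorem integral_floor_eq_sum {n : ℕ} (hn : 0 < n) (φ : ℕ → ℝ) :
    ∫ v in (0 : ℝ)..1, φ ⌊(n : ℝ) * v⌋₊ = 1 / (n : ℝ) * ∑ t ∈ Finset.range n, φ t := by
  have hn' : (0 : ℝ) < n := by exact_mod_cast hn
  have hstep : ∀ t : ℕ, Set.EqOn (fun v : ℝ => φ ⌊(n : ℝ) * v⌋₊) (fun _ => φ t)
      (Set.Ioo ((t : ℝ) / n) (((t + 1 : ℕ) : ℝ) / n)) := fun t v hv => by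
    have h1 := (div_lt_iff₀ hn').1 hv.1
    have h2 := (lt_div_iff₀ hn').1 hv.2
    push_cast at h2
    have : ⌊(n : ℝ) * v⌋₊ = t :=
      (Nat.floor_eq_iff (by nlinarith [Nat.cast_nonneg (α := ℝ) t])).2 ⟨by linarith, by linarith⟩
    simp only [this]
  have hle : ∀ t : ℕ, (t : ℝ) / n ≤ ((t + 1 : ℕ) : ℝ) / n := fun t => by
    gcongr; exact Nat.le_succ t
  have hval : ∀ t : ℕ, ∫ v in ((t : ℝ) / n)..(((t + 1 : ℕ) : ℝ) / n), φ ⌊(n : ℝ) * v⌋₊ =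
      1 / (n : ℝ) * φ t := fun t => by
    rw [intervalIntegral.integral_of_le (hle t), integral_Ioc_eq_integral_Ioo,
      setIntegral_congr_fun measurableSet_Ioo (hstep t), ← integral_Ioc_eq_integral_Ioo,
      ← intervalIntegral.integral_of_le (hle t), intervalIntegral.integral_const, smul_eq_mul]
    congr 1
    push_cast
    field_simp
    ring
  have hint : ∀ t < n, IntervalIntegrable (fun v : ℝ => φ ⌊(n : ℝ) * v⌋₊) volume ((t : ℝ) / n)
      (((t + 1 : ℕ) : ℝ) / n) := fun t _ => by
    rw [intervalIntegrable_iff_integrableOn_Ioo_of_le (hle t)]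
    exact (integrableOn_const (by simp)).congr_fun (hstep t).symm measurableSet_Ioo
  have := intervalIntegral.sum_integral_adjacent_intervals (a := fun t : ℕ => (t : ℝ) / n) hint
  rw [Nat.cast_zero, zero_div, div_self hn'.ne'] at this
  rw [← this, Finset.mul_sum]
  exact Finset.sum_congr rfl fun t _ => hval t

/-- The kernels of the block starting after time `t`, with the gradient taken at the local mean
at time `t - L n`. -/
def blockKernel (P : Measure Ω) (ε : ℤ → Ω → ℝ)
    (Gn : ℕ → ℝ → (ℕ → ℝ) → EuclideanSpace ℝ (Fin d)) (f : EuclideanSpace ℝ (Fin d) → ℝ)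
    (L : ℕ → ℕ) (n t i : ℕ) (x : ℕ → ℝ) : ℝ :=
  fderiv ℝ f (localMean P ε (Gn n) (((t - L n : ℕ) : ℝ) / n)) (Gn n (((t + 1 + i : ℕ) : ℝ) / n) x)

/-- The second moment of the normalised block sum after time `t`. -/
def blockVar (P : Measure Ω) (ε : ℤ → Ω → ℝ)
    (Gn : ℕ → ℝ → (ℕ → ℝ) → EuclideanSpace ℝ (Fin d)) (f : EuclideanSpace ℝ (Fin d) → ℝ)
    (L b : ℕ → ℕ) (n t : ℕ) : ℝ :=
  ∫ ω, 1 / (b n : ℝ) * blockSum P ε (blockKernel P ε Gn f L n t) (t + 1) (b n) ω ^ 2 ∂P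

theorem div_mem_Icc {k n : ℕ} (h : k ≤ n) : (k : ℝ) / n ∈ Set.Icc (0 : ℝ) 1 :=
  ⟨by positivity, div_le_one_of_le₀ (by exact_mod_cast h) (by positivity)⟩

/-- Offsets, lags and block lengths that are negligible with respect to the sample size. -/
structure Negligible (τ L b : ℕ → ℕ) : Prop where
  one_le : ∀ n, 1 ≤ τ n
  offset : Tendsto (fun n => (τ n : ℝ) / n) atTop (𝓝 0)
  lag : Tendsto (fun n => (L n : ℝ) / n) atTop (𝓝 0)
  block : Tendsto (fun n => (b n : ℝ) / n) atTop (𝓝 0)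
  block_atTop : Tendsto b atTop atTop

variable [IsProbabilityMeasure P] {Gn : ℕ → ℝ → (ℕ → ℝ) → EuclideanSpace ℝ (Fin d)}
  {G : ℝ → (ℕ → ℝ) → EuclideanSpace ℝ (Fin d)} {r : ℕ → ℝ} {f : EuclideanSpace ℝ (Fin d) → ℝ}
  {M : Set (EuclideanSpace ℝ (Fin d))} {K : ℝ} {τ L b : ℕ → ℕ}

section

variable (hm : LocalModel P ε ε' ρ C p Gn G r) (hf : GradBound f M K)
  (hM : ∀ᶠ n in atTop, ∀ u ∈ Set.Icc (0 : ℝ) 1, localMean P ε (Gn n) u ∈ M)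

include hm hf hM

theorem geomDep_blockKernel : ∀ᶠ n in atTop, ∀ t, t + b n ≤ n → ∀ i < b n,
    GeomDep P ε ε' ρ (K * C) (blockKernel P ε Gn f L n t i) := by
  filter_upwards [hM, eventually_ge_atTop 1] with n h1 hn t ht i hi
  exact (hm.kernel n hn).geomDep (div_mem_Icc (by omega)) _
    (hf.norm_le _ (h1 _ (div_mem_Icc (by omega))))

/-- All times entering the block after ⌊nv⌋, including the lagged time of the gradient, are within
o(1) of v. At such a v every kernel of the block therefore converges to that of G at v with gradient
Df(μ_v), and the block variance converges. -/
theorem tendsto_blockVar (hs : Negligible τ L b) (hM' : ∀ u ∈ Set.Icc (0 : ℝ) 1,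
      localMean P ε G u ∈ M) {v : ℝ} (hv : v ∈ Set.Ioo (0 : ℝ) 1)
    (hlim : ∀ η > 0, ∃ δ > 0, ∀ᶠ n in atTop, ∀ u ∈ Set.Icc (0 : ℝ) 1, |u - v| < δ →
      LpBdd P 4 (fun ω => Gn n u (past ε 0 ω) - G v (past ε 0 ω)) η) :
    Tendsto (fun n : ℕ => blockVar P ε Gn f L b n ⌊(n : ℝ) * v⌋₊) atTop
      (𝓝 (varDensity P ε G f v)) := by
  have hv' : v ∈ Set.Icc (0 : ℝ) 1 := ⟨hv.1.le, hv.2.le⟩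
  have hK := hf.nonneg
  have hC := hm.bound_nonneg
  rw [hm.varDensity_eq f hv']
  set t : ℕ → ℕ := fun n => ⌊(n : ℝ) * v⌋₊ with ht_def
  set ℓ := fderiv ℝ f (localMean P ε G v)
  have hℓ : ‖ℓ‖ ≤ K := hf.norm_le _ (hM' v hv')
  have hend : ∀ᶠ n : ℕ in atTop, t n + b n ≤ n := by
    filter_upwards [hs.block.eventually_le_const (sub_pos.2 hv.2), eventually_gt_atTop 0]
      with n hbn hn
    have hn' : (0 : ℝ) < n := by exact_mod_cast hn
    rw [div_le_iff₀ hn'] at hbn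
    have hfl := Nat.floor_le (show 0 ≤ (n : ℝ) * v from mul_nonneg hn'.le hv.1.le)
    have : ((t n + b n : ℕ) : ℝ) ≤ n := by
      push_cast
      change (⌊(n : ℝ) * v⌋₊ : ℝ) + _ ≤ _
      linarith
    exact_mod_cast this
  have hnear : ∀ δ > 0, ∀ᶠ n : ℕ in atTop, |((t n - L n : ℕ) : ℝ) / n - v| < δ ∧
      ∀ i < b n, |((t n + 1 + i : ℕ) : ℝ) / n - v| < δ := fun δ hδ => by
    filter_upwards [hs.block.eventually_lt_const (show (0 : ℝ) < δ / 2 by positivity),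
      hs.lag.eventually_lt_const (show (0 : ℝ) < δ / 2 by positivity), eventually_gt_atTop 0,
      tendsto_one_div_atTop_nhds_zero_nat.eventually_lt_const (show (0 : ℝ) < δ / 2 by positivity)]
      with n h1 h2 hn h3
    have hn' : (0 : ℝ) < n := by exact_mod_cast hn
    rw [div_lt_iff₀ hn'] at h1 h2 h3
    have hfl : (t n : ℝ) ≤ n * v := Nat.floor_le (mul_nonneg hn'.le hv.1.le)
    have hfl' : n * v < (t n : ℝ) + 1 := Nat.lt_floor_add_one _
    have key : ∀ k : ℕ, (t n : ℝ) ≤ k + L n → (k : ℝ) ≤ t n + b n → |(k : ℝ) / n - v| < δ := by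
      intro k hk hk'
      rw [show (k : ℝ) / n - v = (k - n * v) / n by field_simp, abs_div, abs_of_pos hn',
        div_lt_iff₀ hn', abs_lt]
      constructor <;> nlinarith
    refine ⟨key _ ?_ ?_, fun i hi => key _ ?_ ?_⟩
    · exact_mod_cast (by omega : t n ≤ t n - L n + L n)
    · exact_mod_cast (by omega : t n - L n ≤ t n + b n)
    · exact_mod_cast (by omega : t n ≤ t n + 1 + i + L n)
    · exact_mod_cast (by omega : t n + 1 + i ≤ t n + b n)
  obtain ⟨c, hc, hc0, hcb⟩ := exists_lpBdd_rate (P := P) (r := 2) (s := fun n => Set.Iio (b n))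
    (f := fun n i ω => blockKernel P ε Gn f L n (t n) i (past ε 0 ω) - ℓ (G v (past ε 0 ω)))
    fun η hη => by
      -- The error is K θ from the kernel plus K θ C from the gradient; the extra 1 keeps the
      -- denominator positive.
      set θ := η / (K * (1 + C) + 1)
      have hden : 0 < K * (1 + C) + 1 := by positivity
      have hθ : 0 < θ := by positivity
      obtain ⟨δ, hδ, hlimδ⟩ := hlim θ hθ
      filter_upwards [hlimδ, hnear δ hδ, hend, hM] with n h1 h2 h3 h4 i hi
      have hi' : i < b n := hi
      have m1 : ((t n - L n : ℕ) : ℝ) / n ∈ Set.Icc (0 : ℝ) 1 := div_mem_Icc (by omega)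
      have m2 : ((t n + 1 + i : ℕ) : ℝ) / n ∈ Set.Icc (0 : ℝ) 1 := div_mem_Icc (by omega)
      set ℓn := fderiv ℝ f (localMean P ε (Gn n) (((t n - L n : ℕ) : ℝ) / n)) with hℓn
      have g1 := h1 _ m2 (h2.2 i hi')
      have g2 := h1 _ m1 h2.1
      have gG := hm.lpBdd_limit hv'
      have d1 : LpBdd P 4 (fun ω => ℓn (Gn n (((t n + 1 + i : ℕ) : ℝ) / n) (past ε 0 ω) -
          G v (past ε 0 ω))) (K * θ) :=
        g1.of_norm_le (ℓn.continuous.comp_aestronglyMeasurable g1.aesm) hK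
          fun ω => ℓn.le_of_opNorm_le (hf.norm_le _ (h4 _ m1)) _
      have hμ : ‖localMean P ε (Gn n) (((t n - L n : ℕ) : ℝ) / n) - localMean P ε G v‖ ≤ θ := by
        have hi1 : Integrable (fun ω => G v (past ε 0 ω)) P := gG.memLp.integrable (by norm_num)
        have hi2 := (g2.memLp.integrable (by norm_num)).add hi1
        rw [localMean, localMean, ← integral_sub
          (hi2.congr (ae_of_all _ fun ω => by simp)) hi1]
        exact g2.norm_integral_le (by norm_num) hθ.le
      have hℓ' : ‖ℓn - ℓ‖ ≤ K * θ :=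
        (hf.lipschitz _ (h4 _ m1) _ (hM' v hv')).trans (by gcongr)
      have d2 : LpBdd P 4 (fun ω => (ℓn - ℓ) (G v (past ε 0 ω))) (K * θ * C) :=
        gG.of_norm_le ((ℓn - ℓ).continuous.comp_aestronglyMeasurable gG.aesm) (by positivity)
          fun ω => (ℓn - ℓ).le_of_opNorm_le hℓ' _
      refine LpBdd.exponent_mono (r := 4) ?_ (by norm_num)
      refine ((d1.add (by norm_num) d2 (by positivity) (by positivity)).congr
        (ae_of_all _ fun ω => ?_)).mono ?_
      · simp only [map_sub, sub_apply, blockKernel, ← hℓn]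
        ring
      · have : θ * (K * (1 + C) + 1) = η := div_mul_cancel₀ _ hden.ne'
        nlinarith
  refine tendsto_integral_sq_blockSum hm.innov (fun n => (t n : ℤ) + 1) ?_ hm.rho_pos hm.rho_lt
    (mul_nonneg hK hC) hs.block_atTop (ℓ.measurable.comp (hm.measurable_limit v))
    (mul_nonneg hK hC) (hm.lpBdd_limit_apply hv' ℓ hℓ) hc hc0 hcb
  filter_upwards [geomDep_blockKernel hm hf hM (b := b) (L := L), hend] with n h1 h2 i hi
  exact h1 _ h2 i hi

/-- The average is the integral over (0, 1] of a step function that is eventually bounded by a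
constant and converges off a countable set. Measurability of the limiting density, hence its
integrability, comes from being such a limit. -/
theorem integrable_indicator_varDensity_and_tendsto (hs : Negligible τ L b)
    (hM' : ∀ u ∈ Set.Icc (0 : ℝ) 1, localMean P ε G u ∈ M) {u : ℝ} (hu : u ∈ Set.Icc (0 : ℝ) 1) :
    IntegrableOn ((Set.Iio u).indicator (varDensity P ε G f)) (Set.Ioc 0 1) ∧
    Tendsto (fun n : ℕ => 1 / (n : ℝ) *
      ∑ t ∈ Finset.Icc (τ n + L n) (⌊(n : ℝ) * u⌋₊ - b n), blockVar P ε Gn f L b n t) atTop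
      (𝓝 (∫ v in Set.Ioc (0 : ℝ) 1, (Set.Iio u).indicator (varDensity P ε G f) v)) := by
  have hK := hf.nonneg
  have hC := hm.bound_nonneg
  have hρ' : 0 < 1 - ρ := sub_pos.2 hm.rho_lt
  obtain ⟨D, hD, hlim⟩ := hm.exists_countable_limit
  let S : ℕ → Finset ℕ := fun n => Finset.Icc (τ n + L n) (⌊(n : ℝ) * u⌋₊ - b n)
  let φ : ℕ → ℕ → ℝ := fun n t => if t ∈ S n then blockVar P ε Gn f L b n t else 0
  let ψ : ℕ → ℝ → ℝ := fun n v => φ n ⌊(n : ℝ) * v⌋₊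
  -- Since τ ≥ 1, a member of the range is positive, so the natural subtraction ⌊nu⌋ − b was not
  -- truncated.
  have hSle : ∀ n, ∀ t ∈ S n, t + b n ≤ ⌊(n : ℝ) * u⌋₊ ∧ ⌊(n : ℝ) * u⌋₊ ≤ n := fun n t ht => by
    have := Finset.mem_Icc.1 ht
    have h1 := hs.one_le n
    refine ⟨by omega, ?_⟩
    exact Nat.floor_le_of_le (mul_le_of_le_one_right (Nat.cast_nonneg n) hu.2)
  have hψm : ∀ n, Measurable (ψ n) := fun n =>
    (measurable_from_nat (f := φ n)).comp
      (Nat.measurable_floor.comp (measurable_const.mul measurable_id))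
  set B := 4 * (K * C / (1 - ρ)) ^ 2
  have hbound : ∀ᶠ n in atTop, ∀ᵐ v ∂volume.restrict (Set.Ioc (0 : ℝ) 1), ‖ψ n v‖ ≤ B := by
    filter_upwards [geomDep_blockKernel hm hf hM (b := b) (L := L)] with n hn
    refine ae_of_all _ fun v => ?_
    simp only [ψ, φ]
    split_ifs with hc
    · exact (lpBdd_sq_blockSum hm.innov hm.rho_pos hm.rho_lt (mul_nonneg hK hC)
        (hn _ ((hSle n _ hc).1.trans (hSle n _ hc).2)) _).abs_integral_le (by norm_num)
        (by positivity)
    · rw [norm_zero]; positivity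
  have hpt : ∀ᵐ v ∂volume.restrict (Set.Ioc (0 : ℝ) 1), Tendsto (fun n => ψ n v) atTop
      (𝓝 ((Set.Iio u).indicator (varDensity P ε G f) v)) := by
    -- Besides the exceptional times, v = u (the edge of the indicator) and v = 1 (where blocks
    -- would leave the sample) are discarded.
    have hcount := ((hD.union (Set.countable_singleton u)).union
      (Set.countable_singleton 1)).ae_notMem (volume.restrict (Set.Ioc (0 : ℝ) 1))
    filter_upwards [hcount, ae_restrict_mem measurableSet_Ioc] with v hv hv01
    simp only [Set.mem_union, Set.mem_singleton_iff, not_or] at hv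
    have hv' : v ∈ Set.Ioo (0 : ℝ) 1 := ⟨hv01.1, lt_of_le_of_ne hv01.2 hv.2⟩
    rcases lt_or_gt_of_ne hv.1.2 with hvu | hvu
    · rw [Set.indicator_of_mem (Set.mem_Iio.2 hvu)]
      refine (tendsto_blockVar hm hf hM hs hM' hv'
        (hlim v (Set.Ioo_subset_Icc_self hv') hv.1.1)).congr' ?_
      have h0 := hs.offset.add hs.lag
      rw [add_zero] at h0
      have h1 := hs.block.add tendsto_one_div_atTop_nhds_zero_nat
      rw [add_zero] at h1
      filter_upwards [h0.eventually_lt_const hv'.1, h1.eventually_lt_const (sub_pos.2 hvu),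
        eventually_gt_atTop 0] with n h2 h3 hn
      have hn' : (0 : ℝ) < n := by exact_mod_cast hn
      rw [← add_div, div_lt_iff₀ hn'] at h2 h3
      simp only [ψ, φ]
      rw [if_pos]
      refine Finset.mem_Icc.2 ⟨Nat.le_floor (by push_cast; linarith), ?_⟩
      have hfl := Nat.floor_le (show 0 ≤ (n : ℝ) * v from mul_nonneg hn'.le hv'.1.le)
      have hfl' := Nat.lt_floor_add_one ((n : ℝ) * u)
      have : ((⌊(n : ℝ) * v⌋₊ + b n : ℕ) : ℝ) < (⌊(n : ℝ) * u⌋₊ : ℕ) := by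
        push_cast
        linarith
      have : ⌊(n : ℝ) * v⌋₊ + b n < ⌊(n : ℝ) * u⌋₊ := by exact_mod_cast this
      omega
    · rw [Set.indicator_of_notMem (by simpa using hvu.le)]
      refine tendsto_const_nhds.congr' ?_
      filter_upwards [hs.block_atTop.eventually_gt_atTop 0] with n hbn
      simp only [ψ, φ]
      rw [if_neg]
      intro hc
      have h1 := (hSle n _ hc).1
      have h2 : ⌊(n : ℝ) * u⌋₊ ≤ ⌊(n : ℝ) * v⌋₊ := Nat.floor_mono (by gcongr)
      omega
  refine ⟨?_, ?_⟩
  · refine Integrable.of_bound (C := B)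
      (aestronglyMeasurable_of_tendsto_ae _ (fun n => (hψm n).aestronglyMeasurable) hpt) ?_
    obtain ⟨N, hN⟩ := eventually_atTop.1 hbound
    have hall : ∀ᵐ v ∂volume.restrict (Set.Ioc (0 : ℝ) 1), ∀ n, N ≤ n → ‖ψ n v‖ ≤ B :=
      ae_all_iff.2 fun n => by
        by_cases hn : N ≤ n
        · filter_upwards [hN n hn] with v hv _ using hv
        · exact ae_of_all _ fun v h => absurd h hn
    filter_upwards [hpt, hall] with v h1 h2
    exact le_of_tendsto h1.norm (eventually_atTop.2 ⟨N, h2⟩)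
  · have key := tendsto_integral_filter_of_dominated_convergence (fun _ => B)
      (Eventually.of_forall fun n => (hψm n).aestronglyMeasurable) hbound
      (integrable_const B) hpt
    refine key.congr' ?_
    filter_upwards [eventually_gt_atTop 0, hs.block_atTop.eventually_gt_atTop 0] with n hn hbn
    rw [← intervalIntegral.integral_of_le zero_le_one]
    refine (integral_floor_eq_sum hn (φ n)).trans ?_
    congr 1
    rw [← Finset.sum_filter]
    refine Finset.sum_congr (Finset.ext fun t => ?_) fun _ _ => rfl
    rw [Finset.mem_filter, Finset.mem_range]
    refine ⟨fun h => h.2, fun h => ⟨?_, h⟩⟩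
    have := hSle n t h
    omega

theorem integrableOn_varDensity (hs : Negligible τ L b)
    (hM' : ∀ u ∈ Set.Icc (0 : ℝ) 1, localMean P ε G u ∈ M) :
    IntegrableOn (varDensity P ε G f) (Set.Icc 0 1) := by
  have := (integrable_indicator_varDensity_and_tendsto hm hf hM hs hM'
    (u := 1) (by simp)).1
  rw [integrableOn_Icc_iff_integrableOn_Ioo]
  exact (this.mono_set Set.Ioo_subset_Ioc_self).congr_fun
    (fun v hv => Set.indicator_of_mem (Set.mem_Iio.2 hv.2) _) measurableSet_Ioo

theorem tendsto_sum_blockVar (hs : Negligible τ L b)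
    (hM' : ∀ u ∈ Set.Icc (0 : ℝ) 1, localMean P ε G u ∈ M) {u : ℝ} (hu : u ∈ Set.Icc (0 : ℝ) 1) :
    Tendsto (fun n : ℕ => 1 / (n : ℝ) *
      ∑ t ∈ Finset.Icc (τ n + L n) (⌊(n : ℝ) * u⌋₊ - b n), blockVar P ε Gn f L b n t) atTop
      (𝓝 (∫ v in (0 : ℝ)..u, varDensity P ε G f v)) := by
  have := (integrable_indicator_varDensity_and_tendsto hm hf hM hs hM' hu).2
  rwa [setIntegral_indicator measurableSet_Iio, show Set.Ioc (0 : ℝ) 1 ∩ Set.Iio u = Set.Ioo 0 u by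
      ext x; simp only [Set.mem_inter_iff, Set.mem_Ioc, Set.mem_Iio, Set.mem_Ioo]
      exact ⟨fun h => ⟨h.1.1, h.2⟩, fun h => ⟨⟨h.1, h.2.le.trans hu.2⟩, h.2⟩⟩,
    ← integral_Ioc_eq_integral_Ioo, ← intervalIntegral.integral_of_le hu.1] at this

end

end Average

/-! ### The error of the pilot estimator -/

section Pilot

variable {Ω : Type*} {ε ε' : ℤ → Ω → ℝ} [mΩ : MeasurableSpace Ω] {P : Measure Ω} {d : ℕ}
  {ρ C p : ℝ}

theorem abs_apply_le (ℓ : EuclideanSpace ℝ (Fin d) →L[ℝ] ℝ) (x : EuclideanSpace ℝ (Fin d)) :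
    |ℓ x| ≤ ‖ℓ‖ * ∑ j, |x j| := by
  rw [apply_eq_sum ℓ x, Finset.mul_sum]
  refine (Finset.abs_sum_le_sum_abs _ _).trans (Finset.sum_le_sum fun j _ => ?_)
  rw [abs_mul]
  gcongr
  simpa using ℓ.le_opNorm (EuclideanSpace.single j 1)

/-- Each term splits as A(x − m) − a(x − μ) = (A − a)(x − μ) + A(μ − μ0) − A(m − μ0): gradient
error, drift of the mean, pilot error. The drift sum is handled by Cauchy–Schwarz, and the last part
is constant in i, hence the factor b. -/
theorem sq_block_sub_le {b : ℕ} {A a : EuclideanSpace ℝ (Fin d) →L[ℝ] ℝ} {K : ℝ} (hA : ‖A‖ ≤ K)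
    (x μ : ℕ → EuclideanSpace ℝ (Fin d)) (m μ0 : EuclideanSpace ℝ (Fin d)) :
    (1 / √(b : ℝ) * ∑ i ∈ Finset.range b, A (x i - m) -
      1 / √(b : ℝ) * ∑ i ∈ Finset.range b, a (x i - μ i)) ^ 2 ≤
      3 * (‖A - a‖ ^ 2 * (1 / (b : ℝ) * (∑ j, |∑ i ∈ Finset.range b, (x i j - μ i j)|) ^ 2) +
        K ^ 2 * ∑ i ∈ Finset.range b, ‖μ i - μ0‖ ^ 2 + b * (K ^ 2 * ‖m - μ0‖ ^ 2)) := by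
  have hK : 0 ≤ K := (norm_nonneg _).trans hA
  rcases Nat.eq_zero_or_pos b with rfl | hb
  · simp
  have hb' : (0 : ℝ) < b := by exact_mod_cast hb
  have hsq : √(b : ℝ) ^ 2 = b := Real.sq_sqrt hb'.le
  have hs0 : √(b : ℝ) ≠ 0 := (Real.sqrt_pos.2 hb').ne'
  set U := ∑ j, |∑ i ∈ Finset.range b, (x i j - μ i j)|
  set e1 := (A - a) (∑ i ∈ Finset.range b, (x i - μ i))
  set e2 := ∑ i ∈ Finset.range b, A (μ i - μ0)
  have hdec : 1 / √(b : ℝ) * ∑ i ∈ Finset.range b, A (x i - m) -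
      1 / √(b : ℝ) * ∑ i ∈ Finset.range b, a (x i - μ i) =
      1 / √(b : ℝ) * e1 + 1 / √(b : ℝ) * e2 - √(b : ℝ) * A (m - μ0) := by
    have h1 : ∑ i ∈ Finset.range b, A (x i - m) - ∑ i ∈ Finset.range b, a (x i - μ i) =
        e1 + e2 - b * A (m - μ0) := by
      simp only [e1, e2, map_sum]
      rw [← nsmul_eq_mul, ← Finset.card_range b, ← Finset.sum_const, Finset.card_range,
        ← Finset.sum_add_distrib, ← Finset.sum_sub_distrib, ← Finset.sum_sub_distrib]
      refine Finset.sum_congr rfl fun i _ => ?_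
      simp only [map_sub, sub_apply]
      ring
    rw [← mul_sub, h1]
    field_simp
    rw [hsq]
  have hthree : ∀ y z w : ℝ, (y + z - w) ^ 2 ≤ 3 * (y ^ 2 + z ^ 2 + w ^ 2) := fun y z w => by
    nlinarith [sq_nonneg (y - z), sq_nonneg (y + w), sq_nonneg (z + w)]
  rw [hdec]
  refine (hthree _ _ _).trans ?_
  have b1 : (1 / √(b : ℝ) * e1) ^ 2 ≤ ‖A - a‖ ^ 2 * (1 / (b : ℝ) * U ^ 2) := by
    have h1 : |e1| ≤ ‖A - a‖ * U := by
      have hcoord : ∀ j, (∑ i ∈ Finset.range b, (x i - μ i)) j =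
          ∑ i ∈ Finset.range b, (x i j - μ i j) := fun j => by simp
      have := abs_apply_le (A - a) (∑ i ∈ Finset.range b, (x i - μ i))
      simp only [hcoord] at this
      exact this
    have h2 : e1 ^ 2 ≤ (‖A - a‖ * U) ^ 2 := sq_le_sq' (abs_le.1 h1).1 (abs_le.1 h1).2
    rw [mul_pow, div_pow, hsq, one_pow]
    calc 1 / (b : ℝ) * e1 ^ 2 ≤ 1 / (b : ℝ) * (‖A - a‖ * U) ^ 2 := by gcongr
      _ = _ := by ring
  have b2 : (1 / √(b : ℝ) * e2) ^ 2 ≤ K ^ 2 * ∑ i ∈ Finset.range b, ‖μ i - μ0‖ ^ 2 := by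
    have h1 : |e2| ≤ K * ∑ i ∈ Finset.range b, ‖μ i - μ0‖ := by
      rw [Finset.mul_sum]
      exact (Finset.abs_sum_le_sum_abs _ _).trans
        (Finset.sum_le_sum fun i _ => A.le_of_opNorm_le hA _)
    have h2 : e2 ^ 2 ≤ (K * ∑ i ∈ Finset.range b, ‖μ i - μ0‖) ^ 2 :=
      sq_le_sq' (abs_le.1 h1).1 (abs_le.1 h1).2
    have h3 := sq_sum_le_card_mul_sum_sq (s := Finset.range b) (f := fun i => ‖μ i - μ0‖)
    rw [Finset.card_range] at h3
    rw [mul_pow, div_pow, hsq, one_pow]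
    calc 1 / (b : ℝ) * e2 ^ 2 ≤ 1 / (b : ℝ) * (K ^ 2 * (b * ∑ i ∈ Finset.range b, ‖μ i - μ0‖ ^ 2)) := by
          gcongr
          rw [mul_pow] at h2
          exact h2.trans (by gcongr)
      _ = _ := by field_simp
  have b3 : (√(b : ℝ) * A (m - μ0)) ^ 2 ≤ b * (K ^ 2 * ‖m - μ0‖ ^ 2) := by
    have h1 : |A (m - μ0)| ≤ K * ‖m - μ0‖ := A.le_of_opNorm_le hA _
    rw [mul_pow, hsq, ← mul_pow]
    exact mul_le_mul_of_nonneg_left (sq_le_sq' (abs_le.1 h1).1 (abs_le.1 h1).2) hb'.le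
  linarith

variable [IsProbabilityMeasure P] {Gn : ℕ → ℝ → (ℕ → ℝ) → EuclideanSpace ℝ (Fin d)}
  {G : ℝ → (ℕ → ℝ) → EuclideanSpace ℝ (Fin d)} {r : ℕ → ℝ}

/-- Squared increments are at most the 2/p-th powers of increments of the control. As p ≥ 2, the
power mean inequality moves the exponent outside the average, where the increments telescope to at
most k C^p / n. -/
theorem LocalKernel.sum_norm_localMean_sub_sq_le {H : ℝ → (ℕ → ℝ) → EuclideanSpace ℝ (Fin d)}
    (hH : LocalKernel P ε ε' ρ C p H) (hp : 2 ≤ p) (hC : 0 ≤ C) {n k : ℕ} (hn : 0 < n) :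
    1 / (n : ℝ) * ∑ s ∈ Finset.range n, (if s + k ≤ n then
      ‖localMean P ε H (((s + k : ℕ) : ℝ) / n) - localMean P ε H ((s : ℝ) / n)‖ ^ 2 else 0) ≤
      C ^ 2 * ((k : ℝ) / n) ^ (2 / p) := by
  have hp0 : 0 < p := by linarith
  have hn' : (0 : ℝ) < n := by exact_mod_cast hn
  obtain ⟨w, hw, hwC, hwb⟩ := hH.control
  have hinc : ∀ s : ℕ, 0 ≤ w (((s + k : ℕ) : ℝ) / n) - w ((s : ℝ) / n) := fun s =>
    sub_nonneg.2 (hw (by gcongr; omega))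
  have hterm : ∀ s ∈ Finset.range n, 1 / (n : ℝ) * (if s + k ≤ n then
      ‖localMean P ε H (((s + k : ℕ) : ℝ) / n) - localMean P ε H ((s : ℝ) / n)‖ ^ 2 else 0) ≤
      1 / (n : ℝ) * (w (((s + k : ℕ) : ℝ) / n) - w ((s : ℝ) / n)) ^ (2 / p) := fun s _ => by
    gcongr
    split_ifs with hsk
    · have hle : (s : ℝ) / n ≤ ((s + k : ℕ) : ℝ) / n := by gcongr; omega
      have hb := hwb _ _ (div_mem_Icc (n := n) (k := s) (by omega)).1 hle (div_mem_Icc hsk).2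
      have h1 : ‖localMean P ε H (((s + k : ℕ) : ℝ) / n) - localMean P ε H ((s : ℝ) / n)‖ ≤
          (w (((s + k : ℕ) : ℝ) / n) - w ((s : ℝ) / n)) ^ (1 / p) := by
        rw [localMean, localMean, ← integral_sub
          ((hH.bdd _ (div_mem_Icc hsk)).memLp.integrable (by norm_num))
          ((hH.bdd _ (div_mem_Icc (by omega))).memLp.integrable (by norm_num))]
        exact hb.norm_integral_le (by norm_num) (by have := hinc s; positivity)
      calc _ ≤ ((w (((s + k : ℕ) : ℝ) / n) - w ((s : ℝ) / n)) ^ (1 / p)) ^ 2 := by gcongr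
        _ = _ := by
          rw [← Real.rpow_natCast, ← Real.rpow_mul (hinc s)]
          congr 1
          push_cast
          ring
    · exact Real.rpow_nonneg (hinc s) _
  rw [Finset.mul_sum]
  refine (Finset.sum_le_sum hterm).trans ?_
  have hmean := Real.arith_mean_le_rpow_mean (Finset.range n) (fun _ => 1 / (n : ℝ))
    (fun s => (w (((s + k : ℕ) : ℝ) / n) - w ((s : ℝ) / n)) ^ (2 / p)) (fun _ _ => by positivity)
    (by simp [hn'.ne']) (fun s _ => Real.rpow_nonneg (hinc s) _) (p := p / 2) (by linarith)
  refine hmean.trans ?_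
  have e : ∀ s : ℕ, ((w (((s + k : ℕ) : ℝ) / n) - w ((s : ℝ) / n)) ^ (2 / p)) ^ (p / 2) =
      w (((s + k : ℕ) : ℝ) / n) - w ((s : ℝ) / n) := fun s => by
    rw [← Real.rpow_mul (hinc s), show 2 / p * (p / 2) = 1 by field_simp, Real.rpow_one]
  simp only [e]
  rw [← Finset.mul_sum, one_div_div]
  have hsum := sum_range_sub_shift_le (w := fun s : ℕ => w ((s : ℝ) / n)) (fun s => hwC _) n k
  calc _ ≤ (1 / (n : ℝ) * (k * C ^ p)) ^ (2 / p) := by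
        gcongr
        exact mul_nonneg (by positivity) (Finset.sum_nonneg fun s _ => hinc s)
    _ = _ := by
      rw [show 1 / (n : ℝ) * (k * C ^ p) = C ^ p * (k / n) by ring,
        Real.mul_rpow (by positivity) (by positivity), ← Real.rpow_mul hC,
        show p * (2 / p) = ((2 : ℕ) : ℝ) by field_simp; norm_num, Real.rpow_natCast]

/-- For each position i in the block the two times differ by L + 1 + i ≤ L + b steps, and the lagged
increment bound is summed over the b positions. -/
theorem LocalModel.tendsto_drift (hm : LocalModel P ε ε' ρ C p Gn G r) {τ L b : ℕ → ℕ}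
    (hs : Negligible τ L b)
    (hrate : Tendsto (fun n => (b n : ℝ) * (((L n + b n : ℕ) : ℝ) / n) ^ (2 / p)) atTop (𝓝 0)) :
    Tendsto (fun n : ℕ => 1 / (n : ℝ) * ∑ t ∈ Finset.Icc (τ n + L n) (n - b n),
      ∑ i ∈ Finset.range (b n), ‖localMean P ε (Gn n) (((t + 1 + i : ℕ) : ℝ) / n) -
        localMean P ε (Gn n) (((t - L n : ℕ) : ℝ) / n)‖ ^ 2) atTop (𝓝 0) := by
  have hp0 : 0 < p := by linarith [hm.two_le]
  have hlim := hrate.const_mul (C ^ 2)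
  rw [mul_zero] at hlim
  refine tendsto_of_tendsto_of_tendsto_of_le_of_le' tendsto_const_nhds hlim
    (Eventually.of_forall fun n => by positivity) ?_
  filter_upwards [eventually_gt_atTop 0] with n hn
  have hn' : (0 : ℝ) < n := by exact_mod_cast hn
  rw [Finset.sum_comm, Finset.mul_sum]
  have key : ∀ i ∈ Finset.range (b n), 1 / (n : ℝ) * ∑ t ∈ Finset.Icc (τ n + L n) (n - b n),
      ‖localMean P ε (Gn n) (((t + 1 + i : ℕ) : ℝ) / n) -
        localMean P ε (Gn n) (((t - L n : ℕ) : ℝ) / n)‖ ^ 2 ≤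
      C ^ 2 * (((L n + b n : ℕ) : ℝ) / n) ^ (2 / p) := fun i hi => by
    have hi' := Finset.mem_range.1 hi
    have h1 := (hm.kernel n hn).sum_norm_localMean_sub_sq_le hm.two_le hm.bound_nonneg
      (k := L n + 1 + i) hn
    refine (le_trans ?_ h1).trans ?_
    · gcongr
      let F : ℕ → ℝ := fun s => if s + (L n + 1 + i) ≤ n then
        ‖localMean P ε (Gn n) (((s + (L n + 1 + i) : ℕ) : ℝ) / n) -
          localMean P ε (Gn n) ((s : ℝ) / n)‖ ^ 2 else 0
      have hF : ∀ s, 0 ≤ F s := fun s => by simp only [F]; split_ifs <;> positivity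
      have hone := hs.one_le n
      calc _ = ∑ t ∈ Finset.Icc (τ n + L n) (n - b n), F (t - L n) := by
            refine Finset.sum_congr rfl fun t ht => ?_
            have := Finset.mem_Icc.1 ht
            simp only [F]
            rw [if_pos (by omega), show t - L n + (L n + 1 + i) = t + 1 + i by omega]
        _ = ∑ s ∈ (Finset.Icc (τ n + L n) (n - b n)).image (fun t => t - L n), F s := by
            rw [Finset.sum_image]
            intro x hx y hy hxy
            have h1 := Finset.mem_Icc.1 hx
            have h2 := Finset.mem_Icc.1 hy
            dsimp only at hxy
            omega
        _ ≤ ∑ s ∈ Finset.range n, F s := by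
            refine Finset.sum_le_sum_of_subset_of_nonneg (fun s hs' => ?_) fun s _ _ => hF s
            obtain ⟨t, ht, rfl⟩ := Finset.mem_image.1 hs'
            have := Finset.mem_Icc.1 ht
            exact Finset.mem_range.2 (by omega)
    · have : ((L n + 1 + i : ℕ) : ℝ) ≤ ((L n + b n : ℕ) : ℝ) := by exact_mod_cast (by omega)
      gcongr C ^ 2 * (?_ / _) ^ _
  refine (Finset.sum_le_sum key).trans (le_of_eq ?_)
  rw [Finset.sum_const, Finset.card_range, nsmul_eq_mul]
  ring

end Pilot

/-! ### Comparison of the pilot blocks with blocks centred at the local means. -/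

section PilotError

variable {Ω : Type*} {ε ε' : ℤ → Ω → ℝ} [mΩ : MeasurableSpace Ω] {P : Measure Ω} {d : ℕ}
  {ρ C p : ℝ}

/-- The block of the bootstrap process after time `t`. -/
def pilotBlock (f : EuclideanSpace ℝ (Fin d) → ℝ) (b : ℕ) (X m : ℕ → EuclideanSpace ℝ (Fin d))
    (L t : ℕ) : ℝ :=
  1 / √(b : ℝ) * ∑ i ∈ Finset.Icc 1 b, fderiv ℝ f (m (t - L)) (X (t + i) - m (t - L))

theorem sum_Icc_one_eq_sum_range (F : ℕ → ℝ) (b : ℕ) :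
    ∑ i ∈ Finset.Icc 1 b, F i = ∑ i ∈ Finset.range b, F (1 + i) := by
  rw [Finset.range_eq_Ico, Finset.sum_Ico_add F 0 b 1]
  refine Finset.sum_congr (Finset.ext fun x => ?_) fun _ _ => rfl
  simp only [Finset.mem_Icc, Finset.mem_Ico]
  omega

/-- The `ℓ¹` norm of the centred sum of the observations in the block after time `t`. -/
def blockNorm (P : Measure Ω) (ε : ℤ → Ω → ℝ)
    (Gn : ℕ → ℝ → (ℕ → ℝ) → EuclideanSpace ℝ (Fin d)) (b : ℕ → ℕ) (n t : ℕ) (ω : Ω) : ℝ :=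
  ∑ j, |∑ i ∈ Finset.range (b n),
    (obs Gn ε n (t + 1 + i) ω j - localMean P ε (Gn n) (((t + 1 + i : ℕ) : ℝ) / n) j)|

variable [IsProbabilityMeasure P] {Gn : ℕ → ℝ → (ℕ → ℝ) → EuclideanSpace ℝ (Fin d)}
  {G : ℝ → (ℕ → ℝ) → EuclideanSpace ℝ (Fin d)} {r : ℕ → ℝ} {f : EuclideanSpace ℝ (Fin d) → ℝ}
  {M : Set (EuclideanSpace ℝ (Fin d))} {K : ℝ} {τ L b : ℕ → ℕ}

theorem LocalKernel.integral_apply {H : ℝ → (ℕ → ℝ) → EuclideanSpace ℝ (Fin d)}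
    (hH : LocalKernel P ε ε' ρ C p H) {u : ℝ} (hu : u ∈ Set.Icc (0 : ℝ) 1)
    (ℓ : EuclideanSpace ℝ (Fin d) →L[ℝ] ℝ) :
    ∫ ω, ℓ (H u (past ε 0 ω)) ∂P = ℓ (localMean P ε H u) :=
  ℓ.integral_comp_comm ((hH.bdd u hu).memLp.integrable (by norm_num))

section

variable (hm : LocalModel P ε ε' ρ C p Gn G r)

include hm

theorem lpBdd_blockNorm {n t : ℕ} (hn : 1 ≤ n) (ht : t + b n ≤ n) :
    LpBdd P 4 (blockNorm P ε Gn b n t) (d * (2 * √(b n : ℝ) * (C / (1 - ρ)))) := by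
  have hρ' : 0 < 1 - ρ := sub_pos.2 hm.rho_lt
  have hC := hm.bound_nonneg
  have h1 : ∀ j : Fin d, LpBdd P 4 (fun ω => |∑ i ∈ Finset.range (b n),
      (obs Gn ε n (t + 1 + i) ω j - localMean P ε (Gn n) (((t + 1 + i : ℕ) : ℝ) / n) j)|)
      (2 * √(b n : ℝ) * (C / (1 - ρ))) := fun j => by
    let pr : EuclideanSpace ℝ (Fin d) →L[ℝ] ℝ := EuclideanSpace.proj j
    have hpr : ‖pr‖ ≤ 1 := ContinuousLinearMap.opNorm_le_bound _ zero_le_one fun x => by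
      rw [one_mul]; exact PiLp.norm_apply_le x j
    have hg : ∀ i < b n, GeomDep P ε ε' ρ C
        (fun x => pr (Gn n (((t + 1 + i : ℕ) : ℝ) / n) x)) := fun i hi => by
      have := (hm.kernel n hn).geomDep (div_mem_Icc (n := n) (k := t + 1 + i) (by omega)) pr hpr
      rwa [one_mul] at this
    refine (lpBdd_sum_sub_integral hm.innov (t + 1) hg hm.rho_pos hm.rho_lt hC).norm.congr
      (ae_of_all _ fun ω => ?_)
    dsimp only
    rw [Real.norm_eq_abs]
    congr 1
    refine Finset.sum_congr rfl fun i hi => ?_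
    have hi' := Finset.mem_range.1 hi
    rw [(hm.kernel n hn).integral_apply (div_mem_Icc (n := n) (k := t + 1 + i) (by omega))]
    simp [pr, obs]
  have := LpBdd.sum (P := P) (r := 4) (s := Finset.univ) (by norm_num) (fun j _ => h1 j)
    fun j _ => by positivity
  refine this.mono (le_of_eq ?_)
  simp

theorem integral_sum_blockNorm_le {n : ℕ} (hn : 1 ≤ n) (hb : 0 < b n) {S : Finset ℕ}
    (hS : ∀ t ∈ S, t + b n ≤ n) (hcard : S.card ≤ n) :
    Integrable (fun ω => 1 / (n : ℝ) * ∑ t ∈ S, (1 / (b n : ℝ) * blockNorm P ε Gn b n t ω ^ 2) ^ 2) P ∧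
    ∫ ω, 1 / (n : ℝ) * ∑ t ∈ S, (1 / (b n : ℝ) * blockNorm P ε Gn b n t ω ^ 2) ^ 2 ∂P ≤
      (d * 2 * (C / (1 - ρ))) ^ 4 := by
  have hρ' : 0 < 1 - ρ := sub_pos.2 hm.rho_lt
  have hC := hm.bound_nonneg
  have hb' : (0 : ℝ) < b n := by exact_mod_cast hb
  have hn' : (0 : ℝ) < n := by exact_mod_cast hn
  have h2 : ∀ t ∈ S, LpBdd P 2 (fun ω => 1 / (b n : ℝ) * blockNorm P ε Gn b n t ω ^ 2)
      ((d * 2 * (C / (1 - ρ))) ^ 2) := fun t ht => by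
    have h1 := lpBdd_blockNorm hm hn (hS t ht)
    have := ((h1.mul_four h1 (by positivity)).const_mul (1 / (b n : ℝ)))
    refine (this.congr (ae_of_all _ fun ω => by ring)).mono (le_of_eq ?_)
    rw [abs_of_nonneg (by positivity)]
    calc _ = 1 / (b n : ℝ) * (√(b n : ℝ) * √(b n : ℝ)) * (d * 2 * (C / (1 - ρ))) ^ 2 := by ring
      _ = _ := by rw [Real.mul_self_sqrt hb'.le]; field_simp
  have hi : ∀ t ∈ S, Integrable (fun ω => (1 / (b n : ℝ) * blockNorm P ε Gn b n t ω ^ 2) ^ 2) P :=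
    fun t ht => (h2 t ht).memLp.integrable_sq
  refine ⟨(integrable_finsetSum _ hi).const_mul _, ?_⟩
  rw [integral_const_mul, integral_finsetSum _ hi]
  have h3 : ∀ t ∈ S, ∫ ω, (1 / (b n : ℝ) * blockNorm P ε Gn b n t ω ^ 2) ^ 2 ∂P ≤
      (d * 2 * (C / (1 - ρ))) ^ 4 := fun t ht =>
    ((h2 t ht).integral_sq_le (by positivity)).trans (le_of_eq (by ring))
  calc _ ≤ 1 / (n : ℝ) * (n * (d * 2 * (C / (1 - ρ))) ^ 4) := by
        gcongr
        refine (Finset.sum_le_sum h3).trans ?_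
        rw [Finset.sum_const, nsmul_eq_mul]
        gcongr
    _ = _ := by field_simp

variable (hf : GradBound f M K)

include hf

/-- The error of replacing the pilot estimator by the local mean, along a path. -/
theorem sum_sq_pilotBlock_sub_le {n : ℕ} (hn : 1 ≤ n) (hτ1 : 1 ≤ τ n)
    (hM : ∀ u ∈ Set.Icc (0 : ℝ) 1, localMean P ε (Gn n) u ∈ M)
    {m : ℕ → EuclideanSpace ℝ (Fin d)} (hmM : ∀ t, τ n ≤ t → t ≤ n → m t ∈ M) (ω : Ω) {s : ℝ}
    (hs : 0 < s) :
    1 / (n : ℝ) * ∑ t ∈ Finset.Icc (τ n + L n) (n - b n),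
      (pilotBlock f (b n) (fun t => obs Gn ε n t ω) m (L n) t -
        1 / √(b n : ℝ) * blockSum P ε (blockKernel P ε Gn f L n t) (t + 1) (b n) ω) ^ 2 ≤
    3 * ((4 * K ^ 4 * (s / n) + K ^ 2 * (b n / n)) * ∑ t ∈ Finset.Icc (τ n) n,
        ‖m t - localMean P ε (Gn n) ((t : ℝ) / n)‖ ^ 2 +
      1 / s * (1 / (n : ℝ) * ∑ t ∈ Finset.Icc (τ n + L n) (n - b n),
        (1 / (b n : ℝ) * blockNorm P ε Gn b n t ω ^ 2) ^ 2) +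
      K ^ 2 * (1 / (n : ℝ) * ∑ t ∈ Finset.Icc (τ n + L n) (n - b n), ∑ i ∈ Finset.range (b n),
        ‖localMean P ε (Gn n) (((t + 1 + i : ℕ) : ℝ) / n) -
          localMean P ε (Gn n) (((t - L n : ℕ) : ℝ) / n)‖ ^ 2)) := by
  have hn' : (0 : ℝ) < n := by exact_mod_cast hn
  have hK := hf.nonneg
  set S := Finset.Icc (τ n + L n) (n - b n)
  let e : ℕ → ℝ := fun t => ‖m t - localMean P ε (Gn n) ((t : ℝ) / n)‖ ^ 2
  have hterm : ∀ t ∈ S, (pilotBlock f (b n) (fun t => obs Gn ε n t ω) m (L n) t -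
        1 / √(b n : ℝ) * blockSum P ε (blockKernel P ε Gn f L n t) (t + 1) (b n) ω) ^ 2 ≤
      3 * ((4 * K ^ 4 * s + K ^ 2 * b n) * e (t - L n) +
        1 / s * (1 / (b n : ℝ) * blockNorm P ε Gn b n t ω ^ 2) ^ 2 +
        K ^ 2 * ∑ i ∈ Finset.range (b n), ‖localMean P ε (Gn n) (((t + 1 + i : ℕ) : ℝ) / n) -
          localMean P ε (Gn n) (((t - L n : ℕ) : ℝ) / n)‖ ^ 2) := fun t ht => by
    have ht' := Finset.mem_Icc.1 ht
    have mt : m (t - L n) ∈ M := hmM _ (by omega) (by omega)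
    have mu : localMean P ε (Gn n) (((t - L n : ℕ) : ℝ) / n) ∈ M :=
      hM _ (div_mem_Icc (by omega))
    set A := fderiv ℝ f (m (t - L n))
    set a := fderiv ℝ f (localMean P ε (Gn n) (((t - L n : ℕ) : ℝ) / n)) with ha
    have h1 := sq_block_sub_le (b := b n) (a := a) (hf.norm_le _ mt)
      (fun i => obs Gn ε n (t + 1 + i) ω)
      (fun i => localMean P ε (Gn n) (((t + 1 + i : ℕ) : ℝ) / n)) (m (t - L n))
      (localMean P ε (Gn n) (((t - L n : ℕ) : ℝ) / n))
    have e1 : pilotBlock f (b n) (fun t => obs Gn ε n t ω) m (L n) t = 1 / √(b n : ℝ) *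
        ∑ i ∈ Finset.range (b n), A (obs Gn ε n (t + 1 + i) ω - m (t - L n)) := by
      rw [pilotBlock, sum_Icc_one_eq_sum_range]
      simp only [add_assoc]
      rfl
    have e2 : blockSum P ε (blockKernel P ε Gn f L n t) (t + 1) (b n) ω =
        ∑ i ∈ Finset.range (b n), a (obs Gn ε n (t + 1 + i) ω -
          localMean P ε (Gn n) (((t + 1 + i : ℕ) : ℝ) / n)) := by
      refine Finset.sum_congr rfl fun i hi => ?_
      have hi' := Finset.mem_range.1 hi
      simp only [blockKernel, ← ha]
      rw [(hm.kernel n hn).integral_apply (div_mem_Icc (n := n) (k := t + 1 + i) (by omega)),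
        ← map_sub]
      simp [obs]
    rw [e1, e2]
    refine h1.trans ?_
    have hAa : ‖A - a‖ ≤ K * ‖m (t - L n) - localMean P ε (Gn n) (((t - L n : ℕ) : ℝ) / n)‖ :=
      hf.lipschitz _ mt _ mu
    have hAa2 : ‖A - a‖ ≤ 2 * K := by
      have h2 := hf.norm_le _ mt
      have h3 := hf.norm_le _ mu
      exact (norm_sub_le _ _).trans (by linarith)
    -- One square is bounded by the uniform bound 2K, the other by the Lipschitz bound, so the
    -- squared pilot error enters linearly.
    have h4 : ‖A - a‖ ^ 4 ≤ 4 * K ^ 4 * e (t - L n) := by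
      calc ‖A - a‖ ^ 4 = ‖A - a‖ ^ 2 * ‖A - a‖ ^ 2 := by ring
        _ ≤ (2 * K) ^ 2 *
            (K * ‖m (t - L n) - localMean P ε (Gn n) (((t - L n : ℕ) : ℝ) / n)‖) ^ 2 := by gcongr
        _ = _ := by simp only [e]; ring
    set y := 1 / (b n : ℝ) * blockNorm P ε Gn b n t ω ^ 2
    -- Young's inequality separates the gradient error from the size of the block, so no
    -- independence between pilot and block is required; `s` is chosen later to balance the two
    -- terms.
    have hy : ‖A - a‖ ^ 2 * y ≤ s * ‖A - a‖ ^ 4 + 1 / s * y ^ 2 := by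
      have h5 : 0 ≤ 1 / s * (s * ‖A - a‖ ^ 2 - y) ^ 2 := by positivity
      have h6 : 1 / s * (s * ‖A - a‖ ^ 2 - y) ^ 2 =
          s * ‖A - a‖ ^ 4 - 2 * (‖A - a‖ ^ 2 * y) + 1 / s * y ^ 2 := by field_simp; ring
      have h7 : 0 ≤ ‖A - a‖ ^ 2 * y := by positivity
      linarith
    have h8 : s * ‖A - a‖ ^ 4 ≤ s * (4 * K ^ 4 * e (t - L n)) := by gcongr
    change 3 * (‖A - a‖ ^ 2 * y + _ + b n * (K ^ 2 * e (t - L n))) ≤ _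
    linarith
  -- On this range t ≥ τ + L, so the shift by L is injective and lands in [τ, n].
  have he : ∑ t ∈ S, e (t - L n) ≤ ∑ t ∈ Finset.Icc (τ n) n, e t := by
    calc _ = ∑ x ∈ S.image (fun t => t - L n), e x := by
          rw [Finset.sum_image]
          intro x hx y hy hxy
          have h1 := Finset.mem_Icc.1 hx
          have h2 := Finset.mem_Icc.1 hy
          dsimp only at hxy
          omega
      _ ≤ _ := by
          refine Finset.sum_le_sum_of_subset_of_nonneg (fun x hx => ?_)
            fun x _ _ => by positivity
          obtain ⟨t, ht, rfl⟩ := Finset.mem_image.1 hx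
          have := Finset.mem_Icc.1 ht
          exact Finset.mem_Icc.2 ⟨by omega, by omega⟩
  calc _ ≤ 1 / (n : ℝ) * ∑ t ∈ S, 3 * ((4 * K ^ 4 * s + K ^ 2 * b n) * e (t - L n) +
        1 / s * (1 / (b n : ℝ) * blockNorm P ε Gn b n t ω ^ 2) ^ 2 +
        K ^ 2 * ∑ i ∈ Finset.range (b n), ‖localMean P ε (Gn n) (((t + 1 + i : ℕ) : ℝ) / n) -
          localMean P ε (Gn n) (((t - L n : ℕ) : ℝ) / n)‖ ^ 2) := by
        gcongr with t ht
        exact hterm t ht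
    _ ≤ 1 / (n : ℝ) * (3 * ((4 * K ^ 4 * s + K ^ 2 * b n) * ∑ t ∈ Finset.Icc (τ n) n, e t +
        1 / s * ∑ t ∈ S, (1 / (b n : ℝ) * blockNorm P ε Gn b n t ω ^ 2) ^ 2 +
        K ^ 2 * ∑ t ∈ S, ∑ i ∈ Finset.range (b n),
          ‖localMean P ε (Gn n) (((t + 1 + i : ℕ) : ℝ) / n) -
          localMean P ε (Gn n) (((t - L n : ℕ) : ℝ) / n)‖ ^ 2)) := by
        rw [← Finset.mul_sum, Finset.sum_add_distrib, Finset.sum_add_distrib, ← Finset.mul_sum,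
          ← Finset.mul_sum, ← Finset.mul_sum]
        gcongr
    _ = _ := by simp only [e]; ring

end

end PilotError

/-! ### Convergence of the conditional variance in probability. -/

section BootstrapVariance

variable {Ω : Type*} {ε ε' : ℤ → Ω → ℝ} [mΩ : MeasurableSpace Ω] {P : Measure Ω} {d : ℕ}
  {ρ C p : ℝ} [IsProbabilityMeasure P] {Gn : ℕ → ℝ → (ℕ → ℝ) → EuclideanSpace ℝ (Fin d)}
  {G : ℝ → (ℕ → ℝ) → EuclideanSpace ℝ (Fin d)} {r : ℕ → ℝ} {f : EuclideanSpace ℝ (Fin d) → ℝ}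
  {M : Set (EuclideanSpace ℝ (Fin d))} {K : ℝ} {τ L b : ℕ → ℕ}
  {μhat : ℕ → ℕ → Ω → EuclideanSpace ℝ (Fin d)}

theorem tendsto_measure_le_integral_div {W : ℕ → Ω → ℝ} {sc : ℕ → ℝ} {B : ℝ}
    (hW : ∀ᶠ n in atTop, Integrable (W n) P ∧ ∫ ω, W n ω ∂P ≤ B) (hW0 : ∀ n ω, 0 ≤ W n ω)
    (hsc : Tendsto sc atTop atTop) : Tendsto (fun n => P {ω | sc n ≤ W n ω}) atTop (𝓝 0) := by
  have hlim : Tendsto (fun n => ENNReal.ofReal (B / sc n)) atTop (𝓝 0) := by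
    simpa [Function.comp_def] using
      (ENNReal.continuous_ofReal.tendsto _).comp (hsc.const_div_atTop B)
  refine tendsto_of_tendsto_of_tendsto_of_le_of_le' tendsto_const_nhds hlim
    (Eventually.of_forall fun n => zero_le) ?_
  filter_upwards [hW, hsc.eventually_gt_atTop 0] with n hn hscn
  have := mul_meas_ge_le_integral_of_nonneg (ae_of_all _ (hW0 n)) hn.1 (sc n)
  rw [← ofReal_measureReal]
  refine ENNReal.ofReal_le_ofReal ?_
  rw [le_div_iff₀ hscn, mul_comm]
  exact this.trans hn.2

section

variable (hm : LocalModel P ε ε' ρ C p Gn G r) (hf : GradBound f M K)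
  (hM : ∀ᶠ n in atTop, ∀ u ∈ Set.Icc (0 : ℝ) 1, localMean P ε (Gn n) u ∈ M)
  (hs : Negligible τ L b)
  (hdrift : Tendsto (fun n => (b n : ℝ) * (((L n + b n : ℕ) : ℝ) / n) ^ (2 / p)) atTop (𝓝 0))
  (hsqrt : Tendsto (fun n : ℕ => (b n : ℝ) / √(n : ℝ)) atTop (𝓝 0))
  (hrate : Tendsto (fun n : ℕ => P {ω | 1 ≤ (∑ t ∈ Finset.Icc (τ n) n,
    ‖μhat n t ω - localMean P ε (Gn n) ((t : ℝ) / (n : ℝ))‖ ^ 2) / √(n : ℝ)}) atTop (𝓝 0))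
  (hmem : Tendsto (fun n => P {ω | ∀ t, τ n ≤ t → t ≤ n → μhat n t ω ∈ M}ᶜ) atTop (𝓝 0))

include hm hf hM hs hdrift hsqrt hrate hmem

/-- The effect of the pilot estimation on the blocks is negligible in mean square. -/
theorem tendsto_measure_sum_sq_pilotBlock_sub {κ : ℝ} (hκ : 0 < κ) :
    Tendsto (fun n : ℕ => P {ω | κ ≤ 1 / (n : ℝ) * ∑ t ∈ Finset.Icc (τ n + L n) (n - b n),
      (pilotBlock f (b n) (fun t => obs Gn ε n t ω) (fun t => μhat n t ω) (L n) t -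
        1 / √(b n : ℝ) * blockSum P ε (blockKernel P ε Gn f L n t) (t + 1) (b n) ω) ^ 2})
      atTop (𝓝 0) := by
  -- Young's parameter will be sc² = n^(1/4). The gradient term is then of order n^(1/4 − 1) √n =
  -- n^(−1/4), and the fourth moment average W, below sc with high probability by Markov,
  -- contributes at most W / sc² ≤ 1 / sc.
  let sc : ℕ → ℝ := fun n => (n : ℝ) ^ (1 / 8 : ℝ)
  have hsc : Tendsto sc atTop atTop :=
    (tendsto_rpow_atTop (by norm_num)).comp tendsto_natCast_atTop_atTop
  let D : ℕ → ℝ := fun n => 1 / (n : ℝ) * ∑ t ∈ Finset.Icc (τ n + L n) (n - b n),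
    ∑ i ∈ Finset.range (b n), ‖localMean P ε (Gn n) (((t + 1 + i : ℕ) : ℝ) / n) -
      localMean P ε (Gn n) (((t - L n : ℕ) : ℝ) / n)‖ ^ 2
  have hD : Tendsto D atTop (𝓝 0) := hm.tendsto_drift hs hdrift
  let W : ℕ → Ω → ℝ := fun n ω => 1 / (n : ℝ) * ∑ t ∈ Finset.Icc (τ n + L n) (n - b n),
    (1 / (b n : ℝ) * blockNorm P ε Gn b n t ω ^ 2) ^ 2
  have hWt : Tendsto (fun n => P {ω | sc n ≤ W n ω}) atTop (𝓝 0) := by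
    refine tendsto_measure_le_integral_div (B := (d * 2 * (C / (1 - ρ))) ^ 4) ?_
      (fun n ω => by positivity) hsc
    filter_upwards [eventually_ge_atTop 1, hs.block_atTop.eventually_gt_atTop 0] with n hn hb
    refine integral_sum_blockNorm_le hm hn hb (fun t ht => ?_) ?_
    · have := Finset.mem_Icc.1 ht
      have := hs.one_le n
      omega
    · rw [Nat.card_Icc]
      have := hs.one_le n
      omega
  have hsc2 : Tendsto (fun n : ℕ => sc n ^ 2 / n * √(n : ℝ)) atTop (𝓝 0) := by
    have h1 := (tendsto_rpow_neg_atTop (show (0 : ℝ) < 1 / 4 by norm_num)).comp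
      (tendsto_natCast_atTop_atTop (R := ℝ))
    refine h1.congr' ?_
    filter_upwards [eventually_gt_atTop 0] with n hn
    have hn' : (0 : ℝ) < n := by exact_mod_cast hn
    simp only [Function.comp, sc]
    rw [Real.sqrt_eq_rpow, ← Real.rpow_natCast, ← Real.rpow_mul hn'.le, div_mul_eq_mul_div,
      ← Real.rpow_add hn', ← Real.rpow_sub_one hn'.ne']
    norm_num
  have hb2 : Tendsto (fun n : ℕ => (b n : ℝ) / n * √(n : ℝ)) atTop (𝓝 0) := by
    refine hsqrt.congr' ?_
    filter_upwards [eventually_gt_atTop 0] with n hn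
    have hn' : (0 : ℝ) < n := by exact_mod_cast hn
    have : √(n : ℝ) ≠ 0 := (Real.sqrt_pos.2 hn').ne'
    field_simp
    rw [Real.sq_sqrt hn'.le]
  have hβ : Tendsto (fun n : ℕ => 3 * (4 * K ^ 4 * (sc n ^ 2 / n * √(n : ℝ)) +
      K ^ 2 * ((b n : ℝ) / n * √(n : ℝ)) + 1 / sc n + K ^ 2 * D n)) atTop (𝓝 0) := by
    have h1 := ((((hsc2.const_mul (4 * K ^ 4)).add (hb2.const_mul (K ^ 2))).add
      (hsc.const_div_atTop 1)).add (hD.const_mul (K ^ 2))).const_mul 3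
    simpa using h1
  -- Three bad events: the pilot leaves M, its total squared error reaches √n, or W reaches sc. Off
  -- them the error is bounded by the deterministic null sequence of `hβ`.
  have hsum := (hmem.add hrate).add hWt
  rw [add_zero, add_zero] at hsum
  refine tendsto_of_tendsto_of_tendsto_of_le_of_le' tendsto_const_nhds hsum
    (Eventually.of_forall fun n => zero_le) ?_
  filter_upwards [hM, eventually_ge_atTop 1, hβ.eventually_lt_const hκ,
    hsc.eventually_gt_atTop 0] with n hMn hn hβn hscn
  refine (measure_mono fun ω hω => ?_).trans ((measure_union_le _ _).trans
    (add_le_add_left (measure_union_le _ _) _))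
  by_contra hc
  simp only [Set.mem_union, Set.mem_compl_iff, Set.mem_ofPred_eq, not_or, not_not, not_le] at hc
  obtain ⟨⟨h1, h2⟩, h3⟩ := hc
  have hn' : (0 : ℝ) < n := by exact_mod_cast hn
  have hK := hf.nonneg
  rw [div_lt_one (Real.sqrt_pos.2 hn')] at h2
  have h4 := sum_sq_pilotBlock_sub_le hm hf hn (hs.one_le n) hMn (L := L) (b := b)
    (m := fun t => μhat n t ω) h1 ω (s := sc n ^ 2) (by positivity)
  have hω' : κ ≤ _ := hω
  have h5 : (4 * K ^ 4 * (sc n ^ 2 / n) + K ^ 2 * (b n / n)) * ∑ t ∈ Finset.Icc (τ n) n,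
      ‖μhat n t ω - localMean P ε (Gn n) ((t : ℝ) / n)‖ ^ 2 ≤
      (4 * K ^ 4 * (sc n ^ 2 / n) + K ^ 2 * (b n / n)) * √(n : ℝ) := by gcongr
  have h6 : 1 / sc n ^ 2 * W n ω ≤ 1 / sc n := by
    calc 1 / sc n ^ 2 * W n ω ≤ 1 / sc n ^ 2 * sc n := by gcongr
      _ = 1 / sc n := by field_simp
  have h7 := hω'.trans h4
  change κ ≤ 3 * (_ + 1 / sc n ^ 2 * W n ω + K ^ 2 * D n) at h7
  linarith

/-- The conditional variance of the bootstrap process converges in probability. -/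
theorem tendsto_measure_sum_sq_pilotBlock (hM' : ∀ u ∈ Set.Icc (0 : ℝ) 1, localMean P ε G u ∈ M)
    {u : ℝ} (hu : u ∈ Set.Icc (0 : ℝ) 1) {η : ℝ} (hη : 0 < η) :
    Tendsto (fun n : ℕ => P {ω | η ≤ |1 / (n : ℝ) *
      ∑ t ∈ Finset.Icc (τ n + L n) (⌊(n : ℝ) * u⌋₊ - b n),
        pilotBlock f (b n) (fun t => obs Gn ε n t ω) (fun t => μhat n t ω) (L n) t ^ 2 -
      ∫ v in (0 : ℝ)..u, varDensity P ε G f v|}) atTop (𝓝 0) := by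
  set V := ∫ v in (0 : ℝ)..u, varDensity P ε G f v
  have hfloor : ∀ n : ℕ, ⌊(n : ℝ) * u⌋₊ ≤ n := fun n =>
    Nat.floor_le_of_le (mul_le_of_le_one_right (Nat.cast_nonneg n) hu.2)
  have hK := hf.nonneg
  -- To be used in |Q² − T²| ≤ θ T² + (1 + 1/θ)(Q − T)². On the good event the average of T² is
  -- below |V| + η + 1, and κ makes the second term at most η/4. With η/8 each for the law of large
  -- numbers and for the expectations, the total stays below η.
  set θ := η / 4 / (|V| + η + 1)
  have hden : 0 < |V| + η + 1 := by positivity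
  have hθ : 0 < θ := by positivity
  have hθV : θ * (|V| + η + 1) = η / 4 := div_mul_cancel₀ _ hden.ne'
  have hθ1 : 0 < 1 + 1 / θ := by positivity
  set κ := η / 4 / (1 + 1 / θ)
  have hκ : 0 < κ := by positivity
  have hκθ : κ * (1 + 1 / θ) = η / 4 := div_mul_cancel₀ _ hθ1.ne'
  have hlln := tendsto_measure_sum_sq_blockSum hm.innov
    (S := fun n => Finset.Icc (τ n + L n) (⌊(n : ℝ) * u⌋₊ - b n)) (b := b)
    (G := fun n t => blockKernel P ε Gn f L n t) hm.rho_pos hm.rho_lt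
    (mul_nonneg hK hm.bound_nonneg) (by
      filter_upwards [geomDep_blockKernel hm hf hM (b := b) (L := L)] with n hn t ht i hi
      have h1 := Finset.mem_Icc.1 ht
      have h2 := hs.one_le n
      have h3 := hfloor n
      exact hn t (by omega) i hi)
    (fun n => by
      rw [Nat.card_Icc]
      have h2 := hs.one_le n
      have h3 := hfloor n
      omega) hs.block_atTop hs.block (show (0 : ℝ) < η / 8 by positivity)
  have hpilot := tendsto_measure_sum_sq_pilotBlock_sub hm hf hM hs hdrift hsqrt hrate hmem hκ
  have hsum := hlln.add hpilot
  rw [add_zero] at hsum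
  refine tendsto_of_tendsto_of_tendsto_of_le_of_le' tendsto_const_nhds hsum
    (Eventually.of_forall fun n => zero_le) ?_
  have hlimE := tendsto_sum_blockVar hm hf hM hs hM' hu
  filter_upwards [eventually_ge_atTop 1,
    Metric.tendsto_nhds.1 hlimE (η / 8) (by positivity)] with n hn hE
  refine (measure_mono fun ω hω => ?_).trans (measure_union_le _ _)
  by_contra hc
  simp only [Set.mem_union, Set.mem_ofPred_eq, not_or, not_le] at hc hω
  obtain ⟨h1, h2⟩ := hc
  rw [Real.dist_eq] at hE
  have hn' : (0 : ℝ) < n := by exact_mod_cast hn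
  set S := Finset.Icc (τ n + L n) (⌊(n : ℝ) * u⌋₊ - b n)
  set S₁ := Finset.Icc (τ n + L n) (n - b n)
  have hSS : S ⊆ S₁ := Finset.Icc_subset_Icc_right (Nat.sub_le_sub_right (hfloor n) _)
  let Q : ℕ → ℝ := fun t =>
    pilotBlock f (b n) (fun t => obs Gn ε n t ω) (fun t => μhat n t ω) (L n) t
  let T : ℕ → ℝ := fun t =>
    1 / √(b n : ℝ) * blockSum P ε (blockKernel P ε Gn f L n t) (t + 1) (b n) ω
  have hT : ∀ t, T t ^ 2 =
      1 / (b n : ℝ) * blockSum P ε (blockKernel P ε Gn f L n t) (t + 1) (b n) ω ^ 2 := fun t => by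
    simp only [T]
    rw [mul_pow, div_pow, one_pow, Real.sq_sqrt (Nat.cast_nonneg _)]
  set E := 1 / (n : ℝ) * ∑ t ∈ S, blockVar P ε Gn f L b n t
  have h1' : |1 / (n : ℝ) * ∑ t ∈ S, T t ^ 2 - E| < η / 8 := by
    simp only [hT]
    exact h1
  have h2' : 1 / (n : ℝ) * ∑ t ∈ S, (Q t - T t) ^ 2 < κ := by
    refine lt_of_le_of_lt ?_ h2
    gcongr 1 / (n : ℝ) * ?_
    exact Finset.sum_le_sum_of_subset_of_nonneg hSS fun _ _ _ => by positivity
  have h3 : |1 / (n : ℝ) * ∑ t ∈ S, Q t ^ 2 - 1 / (n : ℝ) * ∑ t ∈ S, T t ^ 2| ≤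
      θ * (1 / (n : ℝ) * ∑ t ∈ S, T t ^ 2) +
        (1 + 1 / θ) * (1 / (n : ℝ) * ∑ t ∈ S, (Q t - T t) ^ 2) := by
    rw [← mul_sub, ← Finset.sum_sub_distrib, abs_mul, abs_of_pos (by positivity : 0 < 1 / (n : ℝ))]
    calc _ ≤ 1 / (n : ℝ) * ∑ t ∈ S, (θ * T t ^ 2 + (1 + 1 / θ) * (Q t - T t) ^ 2) := by
          gcongr
          refine (Finset.abs_sum_le_sum_abs _ _).trans (Finset.sum_le_sum fun t _ => ?_)
          have h4 : 0 ≤ 1 / θ * (θ * T t - (Q t - T t)) ^ 2 := by positivity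
          have h5 : 0 ≤ 1 / θ * (θ * T t + (Q t - T t)) ^ 2 := by positivity
          have h6 : 1 / θ * (θ * T t - (Q t - T t)) ^ 2 =
              θ * T t ^ 2 - 2 * (T t * (Q t - T t)) + 1 / θ * (Q t - T t) ^ 2 := by
            field_simp
            ring
          have h7 : 1 / θ * (θ * T t + (Q t - T t)) ^ 2 =
              θ * T t ^ 2 + 2 * (T t * (Q t - T t)) + 1 / θ * (Q t - T t) ^ 2 := by
            field_simp
            ring
          have h8 : 0 ≤ (Q t - T t) ^ 2 := by positivity
          have h9 : 0 ≤ θ * T t ^ 2 := by positivity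
          rw [h6] at h4
          rw [h7] at h5
          rw [abs_le]
          constructor <;> linarith
      _ = _ := by
        rw [Finset.sum_add_distrib, ← Finset.mul_sum, ← Finset.mul_sum]
        ring
  have hV := le_abs_self V
  have h1a := abs_lt.1 h1'
  have hEa := abs_lt.1 hE
  have h3a := abs_le.1 h3
  have h10 : θ * (1 / (n : ℝ) * ∑ t ∈ S, T t ^ 2) ≤ η / 4 := by
    rw [← hθV]
    gcongr
    linarith
  have h11 : (1 + 1 / θ) * (1 / (n : ℝ) * ∑ t ∈ S, (Q t - T t) ^ 2) ≤ η / 4 := by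
    rw [← hκθ, mul_comm κ]
    gcongr
  have hω' : η ≤ |1 / (n : ℝ) * ∑ t ∈ S, Q t ^ 2 - V| := hω
  have : |1 / (n : ℝ) * ∑ t ∈ S, Q t ^ 2 - V| < η := by
    rw [abs_lt]
    constructor <;> linarith
  linarith

end

end BootstrapVariance

/-! ### The bootstrap process as a multiplier process -/

section Bootstrap

variable {d : ℕ}

/-- The coefficients of the multipliers in the bootstrap process. -/
def bootstrapCoeff (f : EuclideanSpace ℝ (Fin d) → ℝ) (n τ L b : ℕ)
    (X m : ℕ → EuclideanSpace ℝ (Fin d)) (t : ℕ) : ℝ :=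
  if t ∈ Finset.Icc (τ + L) (n - b) then 1 / √(n : ℝ) * pilotBlock f b X m L t else 0

/-- The coefficients do not depend on k, so one sequence serves the whole path. The general `F`
covers both the process and its clock. When k < b the range is {0}, and its only coefficient
vanishes because τ ≥ 1. -/
theorem sum_range_bootstrapCoeff (f : EuclideanSpace ℝ (Fin d) → ℝ) {n τ L b k : ℕ} (hτ : 1 ≤ τ)
    (hk : k ≤ n) (X m : ℕ → EuclideanSpace ℝ (Fin d)) (F : ℕ → ℝ → ℝ) (hF : ∀ t, F t 0 = 0) :
    ∑ t ∈ Finset.range (k - b + 1), F t (bootstrapCoeff f n τ L b X m t) =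
      ∑ t ∈ Finset.Icc (τ + L) (k - b), F t (1 / √(n : ℝ) * pilotBlock f b X m L t) := by
  have e : Finset.Icc (τ + L) (k - b) =
      (Finset.range (k - b + 1)).filter fun t => t ∈ Finset.Icc (τ + L) (n - b) := by
    ext t
    simp only [Finset.mem_Icc, Finset.mem_filter, Finset.mem_range]
    omega
  rw [e, Finset.sum_filter]
  refine Finset.sum_congr rfl fun t _ => ?_
  rw [bootstrapCoeff]
  split_ifs <;> simp [hF]

theorem bootstrapPath_eq_multiplierPath (f : EuclideanSpace ℝ (Fin d) → ℝ) {n τ L b : ℕ}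
    (hτ : 1 ≤ τ) (X m : ℕ → EuclideanSpace ℝ (Fin d)) (Y : ℕ → ℝ) :
    bootstrapPath f n τ L b X m Y =
      multiplierPath n (fun k => k - b + 1) (bootstrapCoeff f n τ L b X m) Y := by
  refine SkorokhodSpace.ofFloor_congr fun k hk => ?_
  rw [sum_range_bootstrapCoeff f hτ hk X m (fun t c => c * Y t) fun t => zero_mul _,
    Finset.mul_sum]
  refine Finset.sum_congr rfl fun t _ => ?_
  rw [pilotBlock]
  ring

theorem coe_sqSum_bootstrapCoeff (f : EuclideanSpace ℝ (Fin d) → ℝ) {n τ L b k : ℕ} (hτ : 1 ≤ τ)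
    (hk : k ≤ n) (X m : ℕ → EuclideanSpace ℝ (Fin d)) :
    (sqSum (bootstrapCoeff f n τ L b X m) (k - b + 1) : ℝ) =
      1 / (n : ℝ) * ∑ t ∈ Finset.Icc (τ + L) (k - b), pilotBlock f b X m L t ^ 2 := by
  rw [coe_sqSum, sum_range_bootstrapCoeff f hτ hk X m (fun _ c => c ^ 2) fun t => by simp,
    Finset.mul_sum]
  refine Finset.sum_congr rfl fun t _ => ?_
  rw [mul_pow, div_pow, Real.sq_sqrt (Nat.cast_nonneg n), one_pow]

theorem measurable_bootstrapCoeff {Ω : Type*} [MeasurableSpace Ω]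
    (f : EuclideanSpace ℝ (Fin d) → ℝ) {n τ L b : ℕ} {X m : ℕ → Ω → EuclideanSpace ℝ (Fin d)}
    (hX : ∀ t, Measurable (X t)) (hm : ∀ t, τ ≤ t → t ≤ n → Measurable (m t)) :
    Measurable fun ω => bootstrapCoeff f n τ L b (fun t => X t ω) fun t => m t ω := by
  refine measurable_pi_lambda _ fun t => ?_
  simp only [bootstrapCoeff]
  split_ifs with ht
  · have hmt : Measurable (m (t - L)) := by
      have := Finset.mem_Icc.1 ht
      exact hm _ (by omega) (by omega)
    refine Measurable.const_mul (Measurable.const_mul (Finset.measurable_fun_sum _ fun i _ => ?_) _) _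
    have hdiff : Measurable fun ω => X (t + i) ω - m (t - L) ω := (hX _).sub hmt
    -- Expanding in coordinates reduces measurability to derivatives of `f` in fixed directions,
    -- which are measurable functions of the point.
    have e : (fun ω => fderiv ℝ f (m (t - L) ω) (X (t + i) ω - m (t - L) ω)) = fun ω =>
        ∑ j, fderiv ℝ f (m (t - L) ω) (EuclideanSpace.single j 1) *
          (X (t + i) ω - m (t - L) ω) j := funext fun ω => apply_eq_sum _ _
    rw [e]
    refine Finset.measurable_fun_sum _ fun j _ => Measurable.mul ?_ ?_
    · exact (measurable_fderiv_apply_const ℝ f _).comp hmt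
    · exact (EuclideanSpace.proj (𝕜 := ℝ) j).measurable.comp hdiff
  · exact measurable_const

end Bootstrap

/-! ### Rates -/

section Rates

theorem tendsto_div_rpow_of_isLittleO {x : ℕ → ℝ} {a c : ℝ}
    (h : x =o[atTop] fun n : ℕ => (n : ℝ) ^ a) (hac : a ≤ c) :
    Tendsto (fun n => x n / (n : ℝ) ^ c) atTop (𝓝 0) := by
  refine (h.trans_isBigO (IsBigO.of_bound 1 ?_)).tendsto_div_nhds_zero
  filter_upwards [eventually_ge_atTop 1] with n hn
  have hn' : (1 : ℝ) ≤ n := by exact_mod_cast hn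
  rw [one_mul, Real.norm_of_nonneg (by positivity), Real.norm_of_nonneg (by positivity)]
  exact Real.rpow_le_rpow_of_exponent_le hn' hac

variable {p : ℝ} {τ L b : ℕ → ℕ}

theorem negligible_of_isLittleO (hτ1 : ∀ n, 1 ≤ τ n)
    (hτ : (fun n => (τ n : ℝ)) =o[atTop] fun n : ℕ => (n : ℝ))
    (hL : (fun n => (L n : ℝ)) =o[atTop] fun n : ℕ => (n : ℝ) ^ (1 / 2 : ℝ))
    (hb : Tendsto b atTop atTop)
    (hb' : (fun n => (b n : ℝ)) =o[atTop] fun n : ℕ => (n : ℝ) ^ (1 / 2 : ℝ)) :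
    Negligible τ L b :=
  ⟨hτ1, hτ.tendsto_div_nhds_zero,
    by simpa using tendsto_div_rpow_of_isLittleO hL (show (1 / 2 : ℝ) ≤ 1 by norm_num),
    by simpa using tendsto_div_rpow_of_isLittleO hb' (show (1 / 2 : ℝ) ≤ 1 by norm_num), hb⟩

/-- With L and b at most √n, the exponent of n is 2/(3p) − (1/2)(2/p) = −1/(3p). -/
theorem tendsto_block_mul_rpow (hp : 0 < p)
    (hL : (fun n => (L n : ℝ)) =o[atTop] fun n : ℕ => (n : ℝ) ^ (1 / 2 : ℝ))
    (hb' : (fun n => (b n : ℝ)) =o[atTop] fun n : ℕ => (n : ℝ) ^ (1 / 2 : ℝ))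
    (hb : (fun n => (b n : ℝ)) =o[atTop] fun n : ℕ => (n : ℝ) ^ (2 / (3 * p))) :
    Tendsto (fun n => (b n : ℝ) * (((L n + b n : ℕ) : ℝ) / n) ^ (2 / p)) atTop (𝓝 0) := by
  have hlim : Tendsto (fun n : ℕ => (2 : ℝ) ^ (2 / p) * (n : ℝ) ^ (-(1 / (3 * p)))) atTop (𝓝 0) := by
    have := ((tendsto_rpow_neg_atTop (show 0 < 1 / (3 * p) by positivity)).comp
      (tendsto_natCast_atTop_atTop (R := ℝ))).const_mul ((2 : ℝ) ^ (2 / p))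
    simpa [Function.comp_def] using this
  refine tendsto_of_tendsto_of_tendsto_of_le_of_le' tendsto_const_nhds hlim
    (Eventually.of_forall fun n => by positivity) ?_
  filter_upwards [hL.bound one_pos, hb'.bound one_pos, hb.bound one_pos, eventually_gt_atTop 0]
    with n h1 h2 h3 hn
  have hn' : (0 : ℝ) < n := by exact_mod_cast hn
  rw [one_mul, Real.norm_of_nonneg (by positivity), Real.norm_of_nonneg (by positivity)] at h1 h2 h3
  have h4 : ((L n + b n : ℕ) : ℝ) / n ≤ 2 * (n : ℝ) ^ (-(1 / 2) : ℝ) := by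
    have : (n : ℝ) ^ (-(1 / 2) : ℝ) = (n : ℝ) ^ (1 / 2 : ℝ) / n := by
      rw [← Real.rpow_sub_one hn'.ne']
      norm_num
    rw [this, ← mul_div_assoc]
    gcongr
    push_cast
    linarith
  calc (b n : ℝ) * (((L n + b n : ℕ) : ℝ) / n) ^ (2 / p)
      ≤ (n : ℝ) ^ (2 / (3 * p)) * (2 * (n : ℝ) ^ (-(1 / 2) : ℝ)) ^ (2 / p) := by gcongr
    _ = (2 : ℝ) ^ (2 / p) * ((n : ℝ) ^ (2 / (3 * p)) * (n : ℝ) ^ (-(1 / 2) * (2 / p) : ℝ)) := by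
      rw [Real.mul_rpow (by norm_num) (by positivity), ← Real.rpow_mul hn'.le]
      ring
    _ = _ := by
      rw [← Real.rpow_add hn']
      congr 2
      field_simp
      norm_num

end Rates

/-! ### Measurability with respect to the innovations, and the limiting variance function. -/

theorem measurable_comap_of_measurable_past {Ω E : Type*} [MeasurableSpace E] {ε : ℤ → Ω → ℝ}
    {t : ℤ} {g : Ω → E} (hg : Measurable[MeasurableSpace.comap (past ε t) inferInstance] g) :
    Measurable[MeasurableSpace.comap (fun ω i => ε i ω) inferInstance] g := by
  refine hg.mono ?_ le_rfl
  have : past ε t = (fun (x : ℤ → ℝ) (i : ℕ) => x (t - i)) ∘ fun ω i => ε i ω := rfl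
  rw [this, ← MeasurableSpace.comap_comp]
  exact MeasurableSpace.comap_mono
    (measurable_pi_lambda _ fun i => measurable_pi_apply _).comap_le

section Assembly

variable {Ω : Type*} [mΩ : MeasurableSpace Ω] {P : Measure Ω} [IsProbabilityMeasure P] {d : ℕ}

theorem isOpen_meanNhd (μ : ℝ → EuclideanSpace ℝ (Fin d)) (δ : ℝ≥0∞) : IsOpen (meanNhd μ δ) := by
  have : meanNhd μ δ = ⋃ y ∈ convexHull ℝ (μ '' Set.Icc 0 1), Metric.eball y δ := by
    ext x
    simp [meanNhd]
  rw [this]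
  exact isOpen_biUnion fun y _ => Metric.isOpen_eball

theorem tendsto_measure_compl_of_tendsto_one {A : ℕ → Set Ω} (hA : ∀ n, MeasurableSet (A n))
    (h : Tendsto (fun n => P (A n)) atTop (𝓝 1)) : Tendsto (fun n => P (A n)ᶜ) atTop (𝓝 0) := by
  have := ENNReal.Tendsto.sub (tendsto_const_nhds (x := (1 : ℝ≥0∞))) h (Or.inl ENNReal.one_ne_top)
  rw [tsub_self] at this
  exact this.congr fun n => (prob_compl_eq_one_sub (hA n)).symm

/-- The variance function of the limit process, as a continuous function on `[0,1]`. -/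
def varianceFunction (g : ℝ → ℝ) (hg : IntegrableOn g (Set.Icc 0 1)) : C(I, ℝ≥0) where
  toFun u := (∫ v in (0 : ℝ)..(u : ℝ), g v).toNNReal
  continuous_toFun := by
    have h := intervalIntegral.continuousOn_primitive_interval (f := g) (a := 0) (b := 1)
      (μ := volume) (by rwa [Set.uIcc_of_le zero_le_one])
    rw [Set.uIcc_of_le zero_le_one] at h
    exact continuous_real_toNNReal.comp
      (h.comp_continuous continuous_subtype_val fun u => u.2)

theorem coe_varianceFunction {g : ℝ → ℝ} (hg : IntegrableOn g (Set.Icc 0 1))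
    (h0 : ∀ v ∈ Set.Icc (0 : ℝ) 1, 0 ≤ g v) (u : I) :
    (varianceFunction g hg u : ℝ) = ∫ v in (0 : ℝ)..(u : ℝ), g v :=
  Real.coe_toNNReal _ (intervalIntegral.integral_nonneg u.2.1 fun v hv =>
    h0 v ⟨hv.1, hv.2.trans u.2.2⟩)

theorem measurable_obs {ε : ℤ → Ω → ℝ} (hε : ∀ i, Measurable (ε i))
    {Gn : ℕ → ℝ → (ℕ → ℝ) → EuclideanSpace ℝ (Fin d)}
    (hGn : ∀ n, Measurable (Function.uncurry (Gn n))) (n t : ℕ) : Measurable (obs Gn ε n t) :=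
  ((hGn n).comp measurable_prodMk_left).comp (measurable_pi_lambda _ fun _ => hε _)

/-- Valid for any σ-algebra on Ω, it is applied to the one generated by the innovations: the data
and the coefficients are functions of them, hence independent of the multipliers. -/
theorem measurable_data_bootstrapCoeff {ε : ℤ → Ω → ℝ} (hε : ∀ i, Measurable (ε i))
    {Gn : ℕ → ℝ → (ℕ → ℝ) → EuclideanSpace ℝ (Fin d)}
    (hGn : ∀ n, Measurable (Function.uncurry (Gn n))) (f : EuclideanSpace ℝ (Fin d) → ℝ)
    {n τ L b : ℕ} {m : ℕ → Ω → EuclideanSpace ℝ (Fin d)}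
    (hm : ∀ t, τ ≤ t → t ≤ n → Measurable (m t)) :
    Measurable fun ω => (data Gn ε n ω,
      bootstrapCoeff f n τ L b (fun t => obs Gn ε n t ω) fun t => m t ω) :=
  (measurable_pi_lambda _ fun _ => measurable_obs hε hGn n _).prodMk
    (measurable_bootstrapCoeff f (measurable_obs hε hGn n) hm)

end Assembly

end LocStat

end

/-! ### Proof of the theorem from the preceding parts. -/

theorem theorem4 {Ω : Type*} [MeasurableSpace Ω] (P : Measure Ω) [IsProbabilityMeasure P]
    (d : ℕ)
    -- iid innovations, an iid copy of them, and independent iid standard normal multipliers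
    (ε ε' : ℤ → Ω → ℝ) (Y : ℕ → Ω → ℝ)
    (hε_meas : ∀ i, Measurable (Sum.elim ε ε' i))
    (hε_indep : iIndepFun (Sum.elim ε ε') P)
    (hε_ident : ∀ i, IdentDistrib (Sum.elim ε ε' i) (ε 0) P P)
    (hY_meas : ∀ t, Measurable (Y t))
    (hY_indep : iIndepFun Y P)
    (hY_law : ∀ t, HasLaw (Y t) (gaussianReal 0 1) P)
    (hYε : IndepFun (fun ω t => Y t ω) (fun ω i => ε i ω) P)
    -- the kernels `G_n`, with limit `G`
    (Gn : ℕ → ℝ → (ℕ → ℝ) → EuclideanSpace ℝ (Fin d))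
    (G : ℝ → (ℕ → ℝ) → EuclideanSpace ℝ (Fin d))
    (hGn_meas : ∀ n, Measurable (Function.uncurry (Gn n)))
    (hG_meas : Measurable (Function.uncurry G))
    (q p : ℝ) (hq : 4 < q) (hp1 : 1 ≤ p) (hp4 : p < 4)
    -- uniform convergence of the kernels in `L_q`
    (hA1 : Tendsto (fun n : ℕ => ⨆ u ∈ Set.Icc (0 : ℝ) 1,
        eLpNorm (fun ω => Gn n u (past ε 0 ω) - G u (past ε 0 ω)) (ENNReal.ofReal q) P)
      atTop (𝓝 0))
    (CG : ℝ≥0)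
    -- uniform bounds on the `L_q` norms and the `p`-variation
    (hA2 : (⨆ (n : ℕ) (_ : 1 ≤ n), ⨆ u ∈ Set.Icc (0 : ℝ) 1,
          eLpNorm (fun ω => Gn n u (past ε 0 ω)) (ENNReal.ofReal q) P) +
        (⨆ (n : ℕ) (_ : 1 ≤ n), kernelPVar P ε q p (Gn n)) ≤ (CG : ℝ≥0∞))
    -- geometric decay of the physical dependence measure
    (ρ : ℝ) (hρ0 : 0 < ρ) (hρ1 : ρ < 1)
    (hA3 : ∀ (n : ℕ), 1 ≤ n → ∀ u ∈ Set.Icc (0 : ℝ) 1, ∀ (t : ℤ) (j : ℕ),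
      eLpNorm (fun ω => Gn n u (past ε t ω) - Gn n u (pastReplaced ε ε' t j ω))
        (ENNReal.ofReal q) P ≤ (CG : ℝ≥0∞) * ENNReal.ofReal (ρ ^ j))
    -- bounded derivatives of `f` up to order two near the path of `μ_u`
    (f : EuclideanSpace ℝ (Fin d) → ℝ) (δ : ℝ≥0∞) (hδ : 0 < δ) (Cf : ℝ)
    (hA4 : ∀ x ∈ meanNhd (localMean P ε G) δ,
      DifferentiableAt ℝ f x ∧ DifferentiableAt ℝ (fderiv ℝ f) x ∧
        |f x| + ‖fderiv ℝ f x‖ + ‖fderiv ℝ (fderiv ℝ f) x‖ ≤ Cf)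
    -- the offsets, lags and block lengths
    (τ L b : ℕ → ℕ) (hτ1 : ∀ n, 1 ≤ τ n)
    (hτ : (fun n => (τ n : ℝ)) =o[atTop] fun n : ℕ => (n : ℝ))
    (a : ℝ) (ha0 : 0 < a) (ha1 : a < 1)
    (hL_log : (fun n : ℕ => Real.log n ^ (1 + a)) =o[atTop] fun n => (L n : ℝ))
    (hL_1 : (fun n => (L n : ℝ)) =o[atTop] fun n : ℕ => (n : ℝ) ^ (1 / p - 1 / 4))
    (hL_2 : (fun n => (L n : ℝ)) =o[atTop] fun n : ℕ => (n : ℝ) ^ (1 / (2 * p)))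
    (hb : Tendsto b atTop atTop)
    (hb_1 : (fun n => (b n : ℝ)) =o[atTop] fun n : ℕ => (n : ℝ) ^ (2 / (3 * max p 2)))
    (hb_2 : (fun n => (b n : ℝ)) =o[atTop] fun n : ℕ => (n : ℝ) ^ ((q - 4) / (2 * q + 4)))
    -- the pilot estimator `μhat n t`, a filter of the innovations up to time `t`
    (μhat : ℕ → ℕ → Ω → EuclideanSpace ℝ (Fin d))
    (hμ_meas : ∀ n t, τ n ≤ t → t ≤ n →
      Measurable[MeasurableSpace.comap (past ε t) inferInstance] (μhat n t))
    -- rate of the pilot estimator: the sum of squared errors is `o_P(√n)`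
    (hA5 : TendstoInMeasure P
      (fun (n : ℕ) ω => (∑ t ∈ Finset.Icc (τ n) n,
        ‖μhat n t ω - localMean P ε (Gn n) ((t : ℝ) / (n : ℝ))‖ ^ 2) / √(n : ℝ))
      atTop (fun _ => 0))
    -- the pilot estimator stays near the path of `μ_u` with probability tending to one
    (hA6 : Tendsto (fun n : ℕ => P {ω | ∀ t, τ n ≤ t → t ≤ n →
      μhat n t ω ∈ meanNhd (localMean P ε G) δ}) atTop (𝓝 1))
    -- a standard Brownian motion
    {Ω' : Type*} [MeasurableSpace Ω'] (P' : Measure Ω') [IsProbabilityMeasure P']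
    (B : ℝ≥0 → Ω' → ℝ) (hB : IsBrownianReal B P') :
    -- the variance function of the limit process is well defined
    (∀ v ∈ Set.Icc (0 : ℝ) 1, ∀ i j, Summable (autoCov P ε G v i j)) ∧
    (∀ v ∈ Set.Icc (0 : ℝ) 1, 0 ≤ varDensity P ε G f v) ∧
    IntegrableOn (varDensity P ε G f) (Set.Icc 0 1) ∧
    -- the limit process `M(u) = B(∫₀ᵘ Df(μ_v) Σ(v) Df(μ_v)ᵀ dv)` is a random element of `D[0,1]`
    ∃ (M : Ω' → SkorokhodSpace) (hM : AEMeasurable M P'),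
      (∀ᵐ ω ∂P', ∀ u : I,
        M ω u = B (∫ v in (0 : ℝ)..(u : ℝ), varDensity P ε G f v).toNNReal ω) ∧
      -- the bootstrap process has a regular conditional distribution given the data
      (∀ n, ∃ κ : Kernel (Fin n → EuclideanSpace ℝ (Fin d)) SkorokhodSpace, IsMarkovKernel κ ∧
        HasCondDistrib (fun ω => bootstrapPath f n (τ n) (L n) (b n)
          (fun t => obs Gn ε n t ω) (fun t => μhat n t ω) (fun t => Y t ω))
          (data Gn ε n) κ P) ∧
      -- and every version of it converges weakly, in probability, to the law of `M`
      ∀ (κ : ∀ n : ℕ, Kernel (Fin n → EuclideanSpace ℝ (Fin d)) SkorokhodSpace)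
        [∀ n, IsMarkovKernel (κ n)],
        (∀ n, HasCondDistrib (fun ω => bootstrapPath f n (τ n) (L n) (b n)
          (fun t => obs Gn ε n t ω) (fun t => μhat n t ω) (fun t => Y t ω))
          (data Gn ε n) (κ n) P) →
        TendstoWeaklyInProbability P (fun n ω => kernelLaw (κ n) (data Gn ε n ω))
          ⟨P'.map M, Measure.isProbabilityMeasure_map hM⟩ := by
  have hinn : Innovations P ε ε' := ⟨hε_meas, hε_indep, hε_ident⟩
  have hεm : ∀ i, Measurable (ε i) := fun i => hε_meas (Sum.inl i)
  obtain ⟨r, hm⟩ := exists_localModel hinn hGn_meas hG_meas hq hp1 hA1 hA2 hρ0 hρ1 hA3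
  have hf := gradBound_meanNhd hδ hA4
  have hM := hm.localMean_mem hδ
  have hM' : ∀ u ∈ Set.Icc (0 : ℝ) 1, localMean P ε G u ∈ meanNhd (localMean P ε G) δ :=
    fun u hu => mem_meanNhd_of_norm_sub_lt hu (by simpa using hδ)
  have hpow : ∀ {a c : ℝ}, a ≤ c →
      (fun n : ℕ => (n : ℝ) ^ a) =O[atTop] fun n : ℕ => (n : ℝ) ^ c := fun {a c} hac => by
    refine IsBigO.of_bound 1 ?_
    filter_upwards [eventually_ge_atTop 1] with n hn
    have hn' : (1 : ℝ) ≤ n := by exact_mod_cast hn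
    rw [one_mul, Real.norm_of_nonneg (by positivity), Real.norm_of_nonneg (by positivity)]
    exact Real.rpow_le_rpow_of_exponent_le hn' hac
  have hp2 : (2 : ℝ) ≤ max p 2 := le_max_right _ _
  -- Both L and b are o(√n): 1/(2p) ≤ 1/2 because p ≥ 1, and 2/(3 max(p, 2)) ≤ 1/3.
  have hL' := hL_2.trans_isBigO (hpow (c := 1 / 2) (by
    rw [div_le_div_iff₀ (by positivity) (by positivity)]; linarith))
  have hb' := hb_1.trans_isBigO (hpow (c := 1 / 2) (by
    rw [div_le_div_iff₀ (by positivity) (by positivity)]; linarith))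
  have hs := negligible_of_isLittleO hτ1 hτ hL' hb hb'
  have hdrift := tendsto_block_mul_rpow (by positivity) hL' hb' hb_1
  have hsqrt : Tendsto (fun n : ℕ => (b n : ℝ) / √(n : ℝ)) atTop (𝓝 0) := by
    simpa only [Real.sqrt_eq_rpow] using hb'.tendsto_div_nhds_zero
  have hrate : Tendsto (fun n : ℕ => P {ω | 1 ≤ (∑ t ∈ Finset.Icc (τ n) n,
      ‖μhat n t ω - localMean P ε (Gn n) ((t : ℝ) / (n : ℝ))‖ ^ 2) / √(n : ℝ)})
      atTop (𝓝 0) := by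
    refine tendsto_of_tendsto_of_tendsto_of_le_of_le tendsto_const_nhds
      (tendstoInMeasure_iff_norm.1 hA5 1 one_pos) (fun n => zero_le)
      fun n => measure_mono fun ω hω => ?_
    simp only [Set.mem_ofPred_eq, sub_zero] at hω ⊢
    exact hω.trans (le_abs_self _)
  have hmε : MeasurableSpace.comap (fun ω i => ε i ω) inferInstance ≤ ‹MeasurableSpace Ω› :=
    (measurable_pi_lambda _ hεm).comap_le
  have hμm' := fun n t h1 h2 => measurable_comap_of_measurable_past (hμ_meas n t h1 h2)
  have hμm : ∀ n t, τ n ≤ t → t ≤ n → Measurable (μhat n t) :=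
    fun n t h1 h2 => (hμm' n t h1 h2).mono hmε le_rfl
  have hmem : Tendsto (fun n => P {ω | ∀ t, τ n ≤ t → t ≤ n →
      μhat n t ω ∈ meanNhd (localMean P ε G) δ}ᶜ) atTop (𝓝 0) := by
    refine tendsto_measure_compl_of_tendsto_one (fun n => ?_) hA6
    have e : {ω | ∀ t, τ n ≤ t → t ≤ n → μhat n t ω ∈ meanNhd (localMean P ε G) δ} =
        ⋂ t, ⋂ (_ : τ n ≤ t), ⋂ (_ : t ≤ n), μhat n t ⁻¹' meanNhd (localMean P ε G) δ := by
      ext ω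
      simp
    rw [e]
    exact MeasurableSet.iInter fun t => MeasurableSet.iInter fun h1 => MeasurableSet.iInter fun h2 =>
      hμm n t h1 h2 (isOpen_meanNhd _ _).measurableSet
  have hint := integrableOn_varDensity hm hf hM hs hM'
  have hnn : ∀ v ∈ Set.Icc (0 : ℝ) 1, 0 ≤ varDensity P ε G f v :=
    fun v hv => hm.varDensity_nonneg f hv
  let V := varianceFunction (varDensity P ε G f) hint
  let c : ℕ → Ω → ℕ → ℝ := fun n ω => bootstrapCoeff f n (τ n) (L n) (b n)
    (fun t => obs Gn ε n t ω) fun t => μhat n t ω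
  have hc : ∀ n, Measurable (c n) := fun n =>
    measurable_bootstrapCoeff f (measurable_obs hεm hGn_meas n) (hμm n)
  have hD : ∀ n, Measurable (data Gn ε n) := fun n =>
    measurable_pi_lambda _ fun _ => measurable_obs hεm hGn_meas n _
  have hpath : ∀ n, (fun ω => bootstrapPath f n (τ n) (L n) (b n) (fun t => obs Gn ε n t ω)
      (fun t => μhat n t ω) fun t => Y t ω) =
      fun ω => multiplierPath n (fun k => k - b n + 1) (c n ω) fun t => Y t ω := fun n =>
    funext fun ω => bootstrapPath_eq_multiplierPath f (hτ1 n) _ _ _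
  refine ⟨fun v hv i j => hm.summable_autoCov hv i j, hnn, hint, timeChange B V,
    aemeasurable_timeChange hB V, ?_, fun n => ?_, fun κ _ hκ => ?_⟩
  · filter_upwards [hB.cont] with ω hω u
    exact timeChange_apply hω u
  · rw [hpath n]
    exact exists_hasCondDistrib_ofFloor (hD n) fun k _ => Finset.measurable_fun_sum _ fun t _ =>
      ((measurable_pi_apply t).comp (hc n)).mul (hY_meas t)
  · refine tendstoWeaklyInProbability_multiplierPath hY_meas hY_indep hY_law hB V hD hc
      (K := fun n k => k - b n + 1) (fun n k k' hkk' => by dsimp only; omega) (fun n => ?_)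
      (fun u η hη => ?_) κ fun n => by rw [← hpath n]; exact hκ n
    -- The pilot is measurable for the innovations although not necessarily for the data, so the
    -- pair of data and coefficients is independent of the multipliers.
    · rw [IndepFun_iff_Indep]
      exact indep_of_indep_of_le_left ((IndepFun_iff_Indep _ _ _).1 hYε).symm
        (@measurable_data_bootstrapCoeff Ω (MeasurableSpace.comap (fun ω i => ε i ω) inferInstance)
          d ε (fun i => (measurable_pi_apply i).comp (comap_measurable fun ω i => ε i ω)) Gn
          hGn_meas f n (τ n) (L n) (b n) (μhat n) (hμm' n)).comap_le
    · refine (tendsto_measure_sum_sq_pilotBlock hm hf hM hs hdrift hsqrt hrate hmem hM'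
        (u := u) u.2 hη).congr fun n => ?_
      congr 1
      ext ω
      simp only [Set.mem_ofPred_eq, c, V]
      rw [coe_sqSum_bootstrapCoeff f (hτ1 n) (SkorokhodSpace.floor_mul_le n u),
        coe_varianceFunction hint hnn]
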